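/- \textbf{Setting.} Fix a first-order signature of function symbols with equality $\approx$ as the only predicate, an infinite set of variables, and a \emph{desired} term ordering $\prec_T$: a well-founded rewrite ordering (irreflexive, transitive, closed under substitutions and contexts) that is total on ground terms and has only finitely many ground terms below each ground term. Literals are $s\approx t$ and $s\not\approx t$ (sides unordered), $comp$ is the complement, clauses are finite multisets of literals, substitutions have finite domain. A literal $s\approx t$ is compared through the multiset $\{s,t\}$, $s\not\approx t$ through $\{s,s,t,t\}$, clauses through the multiset extension; $L\prec_T\beta$ means that this multiset is below $\{\beta\}$. $\models$ is entailment in first-order logic with equality and $gnd(N)$ the set of ground instances of $N$. For an ordering $\prec$ on ground literals (extended to ground clauses as multisets), a ground clause $C$ is \emph{redundant} w.r.t. $\prec$ and a set $N$ of ground clauses if $\{D\in N\mid D\preceq C\}\models C$; a clause is redundant w.r.t. $\prec$ and $N$ if all its ground instances are redundant w.r.t. $\prec$ and $gnd(N)$. \textbf{Trails.} A trail $\Gamma=[L_1,\dots,L_n]$ is a consistent sequence of ground literals $L_j=K\sigma$, each annotated with a level (non-decreasing along $\Gamma$) and a closure $(K\lor C)\cdot\sigma$ (a clause with a grounding substitution),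 such that $L_j$ is undefined in $[L_1,\dots,L_{j-1}]$ and irreducible by $conv([L_1,\dots,L_{j-1}])$, where $conv(\Gamma)$ is a convergent $\prec_T$-oriented rewrite system for the positive equations of $\Gamma$. A ground literal $L$ is true (false) in $\Gamma$ if $\Gamma\models L$ ($\Gamma\models comp(L)$), defined if it is true or false; a ground clause is true if $\Gamma$ entails it, false if all its literals are false, undefined otherwise. $\beta$-true, $\beta$-false, $\beta$-defined mean in addition $\prec_T\beta$; $\beta$-undefined means undefined or $\succ_T\beta$. $L_j$ is a decision literal if its level is one more than the level of its predecessor ($0$ if there is none), otherwise it is propagated. A core of a defined literal $L$ is an inclusion-minimal subsequence of $\Gamma$ in which $L$ is defined; the defining literal of $L$ is the smallest (in trail order) among the last literals of its cores. The level of $L$ is its annotation if $L\in\Gamma$, otherwise the level of its defining literal, or $0$ if its core is empty; the level of a clause is the maximum over its literals ($0$ for $\bot$). \textbf{Trail induced ordering} $\prec_{\Gamma^*}$, for a ground term $\beta$: $\beta$-defined literals of level $0$ come first, ordered by $\prec_T$; then the $\beta$-defined literals of positive level, ordered by the position in $\Gamma$ of the defining literal $L_i$, and for equal $L_i$ in the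 order $L_i$, $comp(L_i)$, then the remaining ones ordered by $\prec_T$; then all $\beta$-undefined ground literals, ordered by $\prec_T$. \textbf{Rewrite inferences.} Given variable disjoint closures $(l\approx r\lor C_1)\cdot\sigma_1$, with $r\sigma_1\prec_T l\sigma_1$, and $(K\lor C_2)\cdot\sigma_2$, with $K\sigma_2|_p=l\sigma_1$: if $p$ is a position of $K$ and $\mu=mgu(K|_p,l)$, infer $(K[r]_p\mu\lor C_1\mu\lor C_2\mu)\cdot\sigma_1\sigma_2$ with rewrite literal $K[r]_p\mu$; otherwise let $K\delta$ be the most general instance of $K$ that has position $p$, where $\delta$ introduces only fresh variables and $K\delta\sigma_2\rho=K\sigma_2$ with $\rho$ minimal, let $\mu=mgu(K\delta|_p,l)$, and infer $(K\delta[r]_p\mu\lor C_1\mu\lor C_2\delta\mu)\cdot\sigma_1\sigma_2\rho$ with rewrite literal $K\delta[r]_p\mu$. (Mgus are idempotent and introduce no fresh variables.) A reduction chain from $\Gamma$ is a finite sequence of closures with marked rewrite literals, each (a renamed copy of) an annotation in $\Gamma$ or inferred from earlier ones. A reduction chain application from $\Gamma$ to an annotated literal $A=L\sigma^{(L\lor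 C)\cdot\sigma}$ is a minimal reduction chain from $\Gamma,A$ whose last rewrite literal has as ground instance the $conv(\Gamma)$-normal form of $L\sigma$; a refutation from $\Gamma$ and $A$ is a minimal reduction chain from $\Gamma,A$ whose last rewrite literal has a ground instance $s\not\approx s$. \textbf{Calculus SCL(EQ).} States are $(\Gamma;N;U;\beta;k;D)$ with $\beta$ a ground term, $D$ being $\top$, $\bot$ or a closure. Unmentioned components stay unchanged. \begin{itemize} \item Propagate ($D=\top$): if $C_0\lor C_1\lor L\in N\cup U$ with grounding $\sigma$ irreducible by $conv(\Gamma)$, $C_0\sigma$ false in $\Gamma$, $C_1\sigma=L\sigma\lor\dots\lor L\sigma$, $\mu$ the mgu of $L$ and the literals of $C_1$, $L\sigma$ $\beta$-undefined, $(C_0\lor L)\mu\sigma\prec_T\beta$: take a reduction chain application from $\Gamma$ to $L\sigma$ annotated with $k$ and $(L\lor C_0)\mu\cdot\sigma$, with last closure $(K\lor C')\cdot\sigma'$ and rewrite literal $K$, and append $K\sigma'$ annotated with $k$ and $(K\lor C')\cdot\sigma'$ to $\Gamma$. \item Decide ($D=\top$): if $C_0\lor L\in N\cup U$ with grounding $\sigma$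 irreducible by $conv(\Gamma)$, $C_0\sigma$ $\beta$-undefined or $\beta$-true, $L\sigma$ $\beta$-undefined, $(C_0\lor L)\sigma\prec_T\beta$: take a reduction chain application from $\Gamma$ to $L\sigma$ annotated with $k+1$ and $(L\lor C_0)\cdot\sigma$, with last rewrite literal $K$ and substitution $\sigma'$, append $K\sigma'$ annotated with $k+1$ and $(K\lor comp(K))\cdot\sigma'$, and set $k:=k+1$. \item Conflict ($D=\top$): if $C\in N\cup U$ and $C\sigma$ is ground and $\beta$-false in $\Gamma$, $\sigma$ irreducible by $conv(\Gamma)$: $D:=\bot$ if $C\sigma$ has level $0$, otherwise $D:=C\cdot\sigma$. \item Skip ($D=C\cdot\sigma$, $\Gamma=\Gamma_0,K,L$): if $C\sigma$ is $\beta$-false in $\Gamma_0,K$, drop $L$ and set $k$ to the level of $K$. \item Explore-Refutation ($D=(C\lor L)\cdot\sigma$): if $L\sigma$ is strictly $\prec_{\Gamma^*}$-maximal in $(C\lor L)\sigma$ and its defining literal is the last literal of $\Gamma$, replace $D$ by a closure $C'\cdot\sigma'$ of a refutation from $\Gamma$ and $L\sigma$ (annotated with $(C\lor L)\cdot\sigma$)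 such that $C'\sigma'\prec_{\Gamma^*}(C\lor L)\sigma$ is ground and $\beta$-false in $\Gamma$. \item Factorize: replace $(C\lor L\lor L')\cdot\sigma$ with $L\sigma=L'\sigma$ by $(C\lor L)\mu\cdot\sigma$, $\mu=mgu(L,L')$. Equality-Resolution: replace $(C\lor s\not\approx s')\cdot\sigma$ with $s\sigma=s'\sigma$ by $C\mu\cdot\sigma$, $\mu=mgu(s,s')$. \item Backtrack ($\Gamma=\Gamma_0,K,\Gamma_1$, $D=(C\lor L)\cdot\sigma$): if $C\sigma$ has level $<k$, and some ground instance of $C\lor L$ is $\beta$-false in $\Gamma_0,K$ but none is in $\Gamma_0$, go to $(\Gamma_0;N;U\cup\{C\lor L\};\beta;j-i;\top)$, where $j$ is the level of $K$, $i=1$ if $K$ is a decision literal and $i=0$ otherwise. The clause $C\lor L$ is \emph{learned}. \item Grow ($D=\top$): go to $(\epsilon;N;U;\beta';0;\top)$ for a ground term $\beta'\succ_T\beta$. \end{itemize} A run is a sequence of rule applications from $(\epsilon;N;\emptyset;\beta;0;\top)$. It is \emph{regular} if (1) Conflict and Factorize have precedence over all other rules; (2) if $k=0$, Propagate has precedence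 over Decide; (3) Decide never appends $comp(L)$ if Propagate could append $L$ annotated with a clause from $N\cup U$ in the same state; (4) between an application of Conflict and the Backtrack that follows it, Skip is applied at least once, unless Conflict was applied immediately after Decide; (5) if Conflict was applied immediately after Decide, the following Backtrack is applied to $C\cdot\sigma$ only if $comp(L')\in C\sigma$ for the last literal $L'$ of the trail. \textbf{Lemma (Non-Redundant Clause Learning).} Let $N$ be a set of clauses and consider a regular run of SCL(EQ) from $N$. \begin{enumerate} \item Suppose Backtrack is applied in a state $(\Gamma';N;U;\beta;l;C\cdot\sigma)$, so that $C$ is learned, and let $\Gamma$ be the trail of any state of the conflict resolution phase that this Backtrack ends (from the state produced by Conflict up to the state before Backtrack; in particular $\Gamma=\Gamma'$ is allowed). Then $C$ is not redundant with respect to $\prec_{\Gamma^*}$ and $N\cup U$; indeed its ground instance $C\sigma$ is not redundant with respect to $\prec_{\Gamma^*}$ and $gnd(N\cup U)$. \item For the trail only non-redundant clauses need to be considered: let $(\Gamma;N;U;\beta;k;D)$ be a state of the run and let $L_j$ be a propagated literal of $\Gamma=[L_1,\dots,L_n]$ of level greater than zero with annotation $C_j\cdot\sigma_j$. Say that $E\cdot\delta$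 \emph{can justify} $L_j$ if $E=D'\lor K$ with $K\delta=L_j$, $D'\delta$ is $\beta$-false in $[L_1,\dots,L_{j-1}]$, and $\Gamma$ is still a trail when the annotation of $L_j$ is replaced by $(D'\lor K)\cdot\delta$. \begin{enumerate} \item If $G$ is a set of closures $E\cdot\delta$ with $E\in N\cup U$ such that $E\delta\prec_{\Gamma^*}C_j\sigma_j$ for all of them and $\{E\delta\mid E\cdot\delta\in G\}\models C_j\sigma_j$, then some closure in $G$ can justify $L_j$. \item If $C_j\sigma_j$ is entailed by the clauses in $gnd(N\cup U)$ that are strictly $\prec_{\Gamma^*}$-smaller than $C_j\sigma_j$, then there are $E\in N\cup U$ and $\delta$ such that $E\cdot\delta$ can justify $L_j$ and $E\delta$ is not entailed by the clauses in $gnd(N\cup U)$ that are strictly $\prec_{\Gamma^*}$-smaller than $E\delta$. \end{enumerate} \end{enumerate} -/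

import Mathlib

universe u v w

namespace SCLEQ

section

variable {Sg : FirstOrder.Language.{u, v}} {V : Type w}

/-! ### Terms, substitutions, positions -/

open Classical in
/-- The variables occurring in a term. -/
noncomputable def vars (t : Sg.Term V) : Finset V := t.varFinset

/-- A term without variables. -/
def TermGround (t : Sg.Term V) : Prop := vars t = ∅

/-- The subterm of a term at a position (arguments are numbered from `0`), if the position exists. -/
def termAt : Sg.Term V → List ℕ → Option (Sg.Term V)
  | t, [] => some t
  | .var _, _ :: _ => none
  | @FirstOrder.Language.Term.func _ _ n _ ts, i :: p => if h : i < n then termAt (ts ⟨i, h⟩) p else none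

/-- Replacement of the subterm at a position (no change if the position does not exist). -/
def termReplace : Sg.Term V → List ℕ → Sg.Term V → Sg.Term V
  | _, [], r => r
  | .var x, _ :: _, _ => .var x
  | @FirstOrder.Language.Term.func _ _ n f ts, i :: p, r =>
      if h : i < n then
        .func f (Function.update ts ⟨i, h⟩ (termReplace (ts ⟨i, h⟩) p r))
      else .func f ts

/-- Substitutions: total maps from variables to terms with finite domain. -/
structure Subst (Sg : FirstOrder.Language.{u, v}) (V : Type w) where
  map : V → Sg.Term V
  finite_dom : {x | map x ≠ .var x}.Finite

/-- The domain of a substitution. -/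
def Subst.dom (σ : Subst Sg V) : Set V := {x | σ.map x ≠ .var x}

/-- Diagrammatic composition: first `σ`, then `τ`. -/
def Subst.comp (σ τ : Subst Sg V) : Subst Sg V where
  map x := (σ.map x).subst τ.map
  finite_dom := by
    refine (σ.finite_dom.union τ.finite_dom).subset ?_
    intro x hx
    by_contra h
    simp only [Set.mem_union, Set.mem_ofPred_eq, not_or, not_not] at h
    exact hx (by simp [h.1, h.2, FirstOrder.Language.Term.subst])

/-- The substitution transported along a renaming `π` of the variables: if `σ` is grounding for an
object `X`, then this one maps the renamed copy of `X` to the same ground instance. -/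
def Subst.conj (σ : Subst Sg V) (π : Equiv.Perm V) : Subst Sg V where
  map x := (σ.map (π.symm x)).relabel π
  finite_dom := by
    refine (σ.finite_dom.image π).subset ?_
    intro x hx
    refine ⟨π.symm x, ?_, by simp⟩
    intro h
    exact hx (by simp [h, FirstOrder.Language.Term.relabel])

/-- `σ` unifies all pairs in `E`. -/
def Unifies (σ : Subst Sg V) (E : Set (Sg.Term V × Sg.Term V)) : Prop :=
  ∀ e ∈ E, e.1.subst σ.map = e.2.subst σ.map

/-- `μ` is an idempotent most general unifier of `E` that does not introduce fresh variables. -/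
structure IsMGU (μ : Subst Sg V) (E : Set (Sg.Term V × Sg.Term V)) : Prop where
  unifies : Unifies μ E
  mostGeneral : ∀ τ : Subst Sg V, Unifies τ E → ∃ ρ : Subst Sg V, τ = μ.comp ρ
  idempotent : μ.comp μ = μ
  noFresh : ∀ x ∈ μ.dom, ∀ y, (y = x ∨ y ∈ vars (μ.map x)) →
    ∃ e ∈ E, y ∈ vars e.1 ∨ y ∈ vars e.2

/-! ### Literals and clauses -/

/-- Equational literals. `pos = true` is an equation, `pos = false` an inequation; `s ≈ t` and
`t ≈ s` are the same literal. -/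
@[ext]
structure Literal (Sg : FirstOrder.Language.{u, v}) (V : Type w) where
  pos : Bool
  eqn : Sym2 (Sg.Term V)

namespace Literal

/-- The complement. -/
def comp (L : Literal Sg V) : Literal Sg V := ⟨!L.pos, L.eqn⟩

def subst (L : Literal Sg V) (σ : Subst Sg V) : Literal Sg V :=
  ⟨L.pos, L.eqn.map (fun t => t.subst σ.map)⟩

def rename (L : Literal Sg V) (π : Equiv.Perm V) : Literal Sg V :=
  ⟨L.pos, L.eqn.map (fun t => t.relabel π)⟩

def Ground (L : Literal Sg V) : Prop := ∀ t ∈ L.eqn, TermGround t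

/-- The multiset used for comparing literals: `{s, t}` for `s ≈ t`, `{s, s, t, t}` for `s ≉ t`. -/
def terms (L : Literal Sg V) : Multiset (Sg.Term V) :=
  if L.pos then L.eqn.toMultiset else L.eqn.toMultiset + L.eqn.toMultiset

/-- Truth of a literal in a structure under a valuation. -/
def Holds (L : Literal Sg V) {M : Type*} [Sg.Structure M] (ν : V → M) : Prop :=
  (L.eqn.map (fun t => t.realize ν)).IsDiag ↔ L.pos = true

end Literal

/-- Clauses are multisets of literals. -/
abbrev Clause (Sg : FirstOrder.Language.{u, v}) (V : Type w) := Multiset (Literal Sg V)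

namespace Clause

def subst (C : Clause Sg V) (σ : Subst Sg V) : Clause Sg V := C.map (fun L => L.subst σ)

def rename (C : Clause Sg V) (π : Equiv.Perm V) : Clause Sg V := C.map (fun L => L.rename π)

def Ground (C : Clause Sg V) : Prop := ∀ L ∈ C, L.Ground

def vars (C : Clause Sg V) : Set V := {x | ∃ L ∈ C, ∃ t ∈ L.eqn, x ∈ SCLEQ.vars t}

end Clause

/-- All ground instances of clauses in `N`. -/
def gnd (N : Set (Clause Sg V)) : Set (Clause Sg V) :=
  {D | ∃ C ∈ N, ∃ σ : Subst Sg V, D = C.subst σ ∧ D.Ground}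

/-- First-order entailment with equality; clauses are read as universally closed disjunctions. -/
def Entails (N : Set (Clause Sg V)) (C : Clause Sg V) : Prop :=
  ∀ (M : Type (max u w)) [Nonempty M] [Sg.Structure M],
    (∀ D ∈ N, ∀ ν : V → M, ∃ L ∈ D, L.Holds ν) → ∀ ν : V → M, ∃ L ∈ C, L.Holds ν

/-! ### Orderings -/

/-- The multiset extension of a strict ordering. -/
def MulExt {α : Type*} (r : α → α → Prop) (M N : Multiset α) : Prop :=
  ∃ X Y Z : Multiset α, Z ≠ 0 ∧ M = X + Y ∧ N = X + Z ∧ ∀ y ∈ Y, ∃ z ∈ Z, r y z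

/-- Desired term orderings: well-founded rewrite orderings, total on ground terms, such that there
are only finitely many ground terms below each ground term. -/
structure DesiredOrdering (lt : Sg.Term V → Sg.Term V → Prop) : Prop where
  irrefl : ∀ s, ¬ lt s s
  trans : ∀ s t r, lt s t → lt t r → lt s r
  wf : WellFounded lt
  subst : ∀ s t, lt s t → ∀ σ : Subst Sg V, lt (s.subst σ.map) (t.subst σ.map)
  context : ∀ s t, lt s t → ∀ (c : Sg.Term V) (p : List ℕ), (termAt c p).isSome →
    lt (termReplace c p s) (termReplace c p t)
  total : ∀ s t, TermGround s → TermGround t → lt s t ∨ s = t ∨ lt t s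
  finite : ∀ t, TermGround t → {s | TermGround s ∧ lt s t}.Finite

variable (lt : Sg.Term V → Sg.Term V → Prop)

/-- The term ordering on literals. -/
def LitLT (L K : Literal Sg V) : Prop := MulExt lt L.terms K.terms

/-- `L ≺_T β`. -/
def LitBelow (β : Sg.Term V) (L : Literal Sg V) : Prop := MulExt lt L.terms {β}

/-- `β ≺_T L`. -/
def LitAbove (β : Sg.Term V) (L : Literal Sg V) : Prop := MulExt lt {β} L.terms

/-- `C ≺_T β`. -/
def ClauseBelow (β : Sg.Term V) (C : Clause Sg V) : Prop :=
  MulExt (MulExt lt) (C.map Literal.terms) {{β}}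

/-- `β ≺_T C`. -/
def ClauseAbove (β : Sg.Term V) (C : Clause Sg V) : Prop :=
  MulExt (MulExt lt) {{β}} (C.map Literal.terms)

/-- A ground clause `C` is redundant w.r.t. a set `N` of ground clauses and an ordering `r` on ground
literals if the clauses of `N` that are smaller than or equal to `C` entail `C`. -/
def GroundRedundant (r : Literal Sg V → Literal Sg V → Prop) (N : Set (Clause Sg V))
    (C : Clause Sg V) : Prop :=
  Entails {D | D ∈ N ∧ (D = C ∨ MulExt r D C)} C

/-- A clause is redundant w.r.t. `N` if all its ground instances are redundant w.r.t. the ground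
instances of `N`. -/
def Redundant (r : Literal Sg V → Literal Sg V → Prop) (N : Set (Clause Sg V))
    (C : Clause Sg V) : Prop :=
  ∀ C' ∈ gnd {C}, GroundRedundant r (gnd N) C'

/-- The ground clause `C` is entailed by strictly smaller clauses of `N`. -/
def EntailedBySmaller (r : Literal Sg V → Literal Sg V → Prop) (N : Set (Clause Sg V))
    (C : Clause Sg V) : Prop :=
  Entails {D | D ∈ N ∧ MulExt r D C} C

/-! ### Rewriting -/

/-- One rewrite step with a term rewrite system `R`. -/
def Rewrites (R : Set (Sg.Term V × Sg.Term V)) (s t : Sg.Term V) : Prop :=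
  ∃ lr ∈ R, ∃ (p : List ℕ) (σ : Subst Sg V),
    termAt s p = some (lr.1.subst σ.map) ∧ t = termReplace s p (lr.2.subst σ.map)

def TermIrreducible (R : Set (Sg.Term V × Sg.Term V)) (t : Sg.Term V) : Prop :=
  ¬ ∃ t', Rewrites R t t'

def LitIrreducible (R : Set (Sg.Term V × Sg.Term V)) (L : Literal Sg V) : Prop :=
  ∀ t ∈ L.eqn, TermIrreducible R t

def SubstIrreducible (R : Set (Sg.Term V × Sg.Term V)) (σ : Subst Sg V) : Prop :=
  ∀ x ∈ σ.dom, TermIrreducible R (σ.map x)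

/-- `s` is a normal form of `t`. -/
def IsNormalForm (R : Set (Sg.Term V × Sg.Term V)) (t s : Sg.Term V) : Prop :=
  Relation.ReflTransGen (Rewrites R) t s ∧ TermIrreducible R s

/-- A convergent rewrite system for the positive equations in `Γ`: all ground equations that they
entail, oriented by the term ordering. Any other convergent, `≺_T`-oriented system for the same
equational theory has the same normal forms, because the normal form of a ground term is the least
ground term that is equal to it. -/
def conv (Γ : List (Literal Sg V)) : Set (Sg.Term V × Sg.Term V) :=
  {lr | TermGround lr.1 ∧ TermGround lr.2 ∧ lt lr.2 lr.1 ∧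
    Entails {D | ∃ L ∈ Γ, L.pos = true ∧ D = {L}} {⟨true, s(lr.1, lr.2)⟩}}

/-! ### Trails -/

/-- An annotated literal `Lσ^{level : (L ∨ C)·σ}`, with `lit = L` and `rest = C`. -/
structure AnnLit (Sg : FirstOrder.Language.{u, v}) (V : Type w) where
  level : ℕ
  lit : Literal Sg V
  rest : Clause Sg V
  sub : Subst Sg V

namespace AnnLit

/-- The annotated ground literal. -/
def ground (A : AnnLit Sg V) : Literal Sg V := A.lit.subst A.sub

/-- The annotating clause. -/
def clause (A : AnnLit Sg V) : Clause Sg V := A.lit ::ₘ A.rest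

/-- The ground instance of the annotating closure. -/
def groundClause (A : AnnLit Sg V) : Clause Sg V := A.clause.subst A.sub

end AnnLit

/-- The sequence of ground literals of an annotated sequence. -/
def lits (Γ : List (AnnLit Sg V)) : List (Literal Sg V) := Γ.map AnnLit.ground

/-- The literals of a sequence as unit clauses. -/
def units (Γ : List (Literal Sg V)) : Set (Clause Sg V) := {D | ∃ L ∈ Γ, D = {L}}

def LitTrue (Γ : List (Literal Sg V)) (L : Literal Sg V) : Prop := Entails (units Γ) {L}

def LitFalse (Γ : List (Literal Sg V)) (L : Literal Sg V) : Prop := Entails (units Γ) {L.comp}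

def LitDefined (Γ : List (Literal Sg V)) (L : Literal Sg V) : Prop := LitTrue Γ L ∨ LitFalse Γ L

def Consistent (Γ : List (Literal Sg V)) : Prop := ¬ Entails (units Γ) 0

/-- A clause is true in `Γ` if `Γ` entails it. -/
def ClauseTrue (Γ : List (Literal Sg V)) (C : Clause Sg V) : Prop := Entails (units Γ) C

/-- A clause is false in `Γ` if `Γ` entails its negation, i.e. if all its literals are false. -/
def ClauseFalse (Γ : List (Literal Sg V)) (C : Clause Sg V) : Prop := ∀ L ∈ C, LitFalse Γ L

def ClauseUndefined (Γ : List (Literal Sg V)) (C : Clause Sg V) : Prop :=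
  ¬ ClauseTrue Γ C ∧ ¬ ClauseFalse Γ C

/-- `β`-defined literals: defined and smaller than `β`. -/
def BetaDefined (β : Sg.Term V) (Γ : List (Literal Sg V)) (L : Literal Sg V) : Prop :=
  LitBelow lt β L ∧ LitDefined Γ L

def BetaUndefined (β : Sg.Term V) (Γ : List (Literal Sg V)) (L : Literal Sg V) : Prop :=
  LitAbove lt β L ∨ ¬ LitDefined Γ L

def ClauseBetaTrue (β : Sg.Term V) (Γ : List (Literal Sg V)) (C : Clause Sg V) : Prop :=
  ClauseBelow lt β C ∧ ClauseTrue Γ C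

def ClauseBetaFalse (β : Sg.Term V) (Γ : List (Literal Sg V)) (C : Clause Sg V) : Prop :=
  ClauseBelow lt β C ∧ ClauseFalse Γ C

def ClauseBetaUndefined (β : Sg.Term V) (Γ : List (Literal Sg V)) (C : Clause Sg V) : Prop :=
  ClauseAbove lt β C ∨ ClauseUndefined Γ C

/-- Trails. -/
structure IsTrail (Γ : List (AnnLit Sg V)) : Prop where
  closures : ∀ A ∈ Γ, A.groundClause.Ground
  consistent : Consistent (lits Γ)
  levels : Γ.Pairwise (fun A B => A.level ≤ B.level)
  undefined : ∀ (i : ℕ) (A : AnnLit Sg V), Γ[i]? = some A → ¬ LitDefined (lits (Γ.take i)) A.ground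
  irreducible : ∀ (i : ℕ) (A : AnnLit Sg V), Γ[i]? = some A →
    LitIrreducible (conv lt (lits (Γ.take i))) A.ground

/-- The level of the last literal of `Γ`, and `0` if `Γ` is empty. -/
def lastLevel (Γ : List (AnnLit Sg V)) : ℕ := (Γ.getLast?.map AnnLit.level).getD 0

/-- `K`, placed directly after `Γ`, is a decision literal: it opens a new level. -/
def IsDecision (Γ : List (AnnLit Sg V)) (K : AnnLit Sg V) : Prop := K.level = lastLevel Γ + 1

/-- The subsequence of `Γ` given by a set of indices. -/
def sublits (Γ : List (AnnLit Sg V)) (I : Finset ℕ) : Set (Clause Sg V) :=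
  {D | ∃ i ∈ I, ∃ A, Γ[i]? = some A ∧ D = {A.ground}}

/-- `L` is defined in the subsequence of `Γ` given by `I`. -/
def DefinedBy (Γ : List (AnnLit Sg V)) (I : Finset ℕ) (L : Literal Sg V) : Prop :=
  Entails (sublits Γ I) {L} ∨ Entails (sublits Γ I) {L.comp}

/-- Cores: minimal subsequences of `Γ` in which `L` is defined. -/
def IsCore (Γ : List (AnnLit Sg V)) (L : Literal Sg V) (I : Finset ℕ) : Prop :=
  I ⊆ Finset.range Γ.length ∧ DefinedBy Γ I L ∧ ∀ J, J ⊂ I → ¬ DefinedBy Γ J L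

/-- The literal of `Γ` with index `i` is the defining literal of `L`: it is the largest element of
some core, and no core has a smaller largest element. -/
def IsDefining (Γ : List (AnnLit Sg V)) (L : Literal Sg V) (i : ℕ) : Prop :=
  (∃ I, IsCore Γ L I ∧ IsGreatest (I : Set ℕ) i) ∧
    ∀ J, IsCore Γ L J → ∀ j, IsGreatest (J : Set ℕ) j → i ≤ j

open Classical in
/-- The level of a ground literal that is defined in `Γ`. -/
noncomputable def litLevel (Γ : List (AnnLit Sg V)) (L : Literal Sg V) : ℕ :=
  match Γ.find? (fun A => decide (A.ground = L)) with
  | some A => A.level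
  | none =>
    if h : ∃ i A, Γ[i]? = some A ∧ IsDefining Γ L i then h.choose_spec.choose.level else 0

/-- The level of a clause: the maximal level of its literals, and `0` for the empty clause. -/
noncomputable def clauseLevel (Γ : List (AnnLit Sg V)) (C : Clause Sg V) : ℕ :=
  (C.map (litLevel Γ)).sup

/-- `L` is the `i`-th literal of the trail. -/
def IsTrailLit (Γ : List (AnnLit Sg V)) (i : ℕ) (L : Literal Sg V) : Prop :=
  ∃ A, Γ[i]? = some A ∧ A.ground = L

/-- `L` is one of the `β`-defined literals outside `Γ ∪ comp(Γ)` with defining literal `Γ_i`. -/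
def IsOther (β : Sg.Term V) (Γ : List (AnnLit Sg V)) (i : ℕ) (L : Literal Sg V) : Prop :=
  L.Ground ∧ BetaDefined lt β (lits Γ) L ∧ L ∉ lits Γ ∧ L.comp ∉ lits Γ ∧ IsDefining Γ L i

/-- Ground `β`-defined literals of level greater than zero. -/
def PosLevel (β : Sg.Term V) (Γ : List (AnnLit Sg V)) (L : Literal Sg V) : Prop :=
  L.Ground ∧ BetaDefined lt β (lits Γ) L ∧ 0 < litLevel Γ L

/-- Ground `β`-defined literals of level zero. -/
def ZeroLevel (β : Sg.Term V) (Γ : List (AnnLit Sg V)) (L : Literal Sg V) : Prop :=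
  L.Ground ∧ BetaDefined lt β (lits Γ) L ∧ litLevel Γ L = 0

/-- The trail induced ordering `≺_{Γ*}` on ground literals. -/
inductive TrailLT (β : Sg.Term V) (Γ : List (AnnLit Sg V)) : Literal Sg V → Literal Sg V → Prop
  | other_other {L K i j} : PosLevel lt β Γ L → PosLevel lt β Γ K →
      IsOther lt β Γ i L → IsOther lt β Γ j K → (i < j ∨ (i = j ∧ LitLT lt L K)) →
      TrailLT β Γ L K
  | lit_lit {L K i j} : PosLevel lt β Γ L → PosLevel lt β Γ K →
      IsTrailLit Γ i L → IsTrailLit Γ j K → i < j → TrailLT β Γ L K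
  | comp_lit {L K i j} : PosLevel lt β Γ L → PosLevel lt β Γ K →
      IsTrailLit Γ i L.comp → IsTrailLit Γ j K → i < j → TrailLT β Γ L K
  | lit_comp {L K i j} : PosLevel lt β Γ L → PosLevel lt β Γ K →
      IsTrailLit Γ i L → IsTrailLit Γ j K.comp → i ≤ j → TrailLT β Γ L K
  | comp_comp {L K i j} : PosLevel lt β Γ L → PosLevel lt β Γ K →
      IsTrailLit Γ i L.comp → IsTrailLit Γ j K.comp → i < j → TrailLT β Γ L K
  | trail_other {L K i j} : PosLevel lt β Γ L → PosLevel lt β Γ K →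
      (IsTrailLit Γ i L ∨ IsTrailLit Γ i L.comp) → IsOther lt β Γ j K → i ≤ j → TrailLT β Γ L K
  | other_trail {L K i j} : PosLevel lt β Γ L → PosLevel lt β Γ K →
      IsOther lt β Γ i L → (IsTrailLit Γ j K ∨ IsTrailLit Γ j K.comp) → i < j → TrailLT β Γ L K
  | zero_zero {L K} : ZeroLevel lt β Γ L → ZeroLevel lt β Γ K → LitLT lt L K → TrailLT β Γ L K
  | zero_pos {L K} : ZeroLevel lt β Γ L → PosLevel lt β Γ K → TrailLT β Γ L K
  | undef_undef {L K} : L.Ground → K.Ground → ¬ BetaDefined lt β (lits Γ) L →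
      ¬ BetaDefined lt β (lits Γ) K → LitLT lt L K → TrailLT β Γ L K
  | def_undef {L K} : L.Ground → K.Ground → BetaDefined lt β (lits Γ) L →
      ¬ BetaDefined lt β (lits Γ) K → TrailLT β Γ L K

/-! ### Rewrite inferences -/

/-- A literal with a chosen order of its two sides. -/
structure EqLit (Sg : FirstOrder.Language.{u, v}) (V : Type w) where
  pos : Bool
  lhs : Sg.Term V
  rhs : Sg.Term V

namespace EqLit

def toLit (e : EqLit Sg V) : Literal Sg V := ⟨e.pos, s(e.lhs, e.rhs)⟩

def subst (e : EqLit Sg V) (σ : Subst Sg V) : EqLit Sg V :=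
  ⟨e.pos, e.lhs.subst σ.map, e.rhs.subst σ.map⟩

/-- The subterm at a position; `0 :: p` is below the left side and `1 :: p` below the right one. -/
def at? (e : EqLit Sg V) : List ℕ → Option (Sg.Term V)
  | 0 :: p => termAt e.lhs p
  | 1 :: p => termAt e.rhs p
  | _ => none

/-- Replacement of the subterm at a position. -/
def replace (e : EqLit Sg V) : List ℕ → Sg.Term V → EqLit Sg V
  | 0 :: p, r => ⟨e.pos, termReplace e.lhs p r, e.rhs⟩
  | 1 :: p, r => ⟨e.pos, e.lhs, termReplace e.rhs p r⟩
  | _, _ => e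

end EqLit

/-- Rewrite steps `(L·σ, (L ∨ C)·σ, R, S, p)`; `base` is the case in which the last three
components are empty. -/
inductive RewriteStep (Sg : FirstOrder.Language.{u, v}) (V : Type w) where
  | base (L : EqLit Sg V) (C : Clause Sg V) (σ : Subst Sg V)
  | infer (L : EqLit Sg V) (C : Clause Sg V) (σ : Subst Sg V) (R S : RewriteStep Sg V)
      (p : List ℕ)

namespace RewriteStep

/-- The rewrite literal. -/
def lit : RewriteStep Sg V → EqLit Sg V
  | base L _ _ => L
  | infer L _ _ _ _ _ => L

/-- The clause without the rewrite literal. -/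
def rest : RewriteStep Sg V → Clause Sg V
  | base _ C _ => C
  | infer _ C _ _ _ _ => C

def sub : RewriteStep Sg V → Subst Sg V
  | base _ _ σ => σ
  | infer _ _ σ _ _ _ => σ

def clause (I : RewriteStep Sg V) : Clause Sg V := I.lit.toLit ::ₘ I.rest

/-- All variables that a rewrite step involves. -/
def allVars (I : RewriteStep Sg V) : Set V := I.clause.vars ∪ I.sub.dom

end RewriteStep

/-- `δ` is a most general substitution that makes `p` a position of `e`, introduces only fresh
variables, and has `eσ` as an instance via `ρ`, where `ρ` is minimal. -/
structure IsExpansion (e : EqLit Sg V) (p : List ℕ) (σ : Subst Sg V) (used : Set V)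
    (δ ρ : Subst Sg V) : Prop where
  position : ((e.subst δ).at? p).isSome
  dom : ∀ x ∈ δ.dom, x ∈ vars e.lhs ∨ x ∈ vars e.rhs
  fresh : ∀ x ∈ δ.dom, ∀ y ∈ vars (δ.map x), y ∉ used
  factors : ((e.subst δ).subst σ).subst ρ = e.subst σ
  minimal : ∀ ρ' : Subst Sg V, ((e.subst δ).subst σ).subst ρ' = e.subst σ → ρ.dom ⊆ ρ'.dom
  mostGeneral : ∀ δ' ρ' : Subst Sg V, ((e.subst δ').at? p).isSome →
    (e.subst δ').subst ρ' = e.subst σ → ∃ θ : Subst Sg V, e.subst δ' = (e.subst δ).subst θ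

/-- `(L·σ, (L ∨ C)·σ, I₁, I₂, p)` is the result of a rewrite inference: an instance of the left side
of the equation of `I₁` is replaced at position `p` of the literal of `I₂`, where `p` may lie below
a variable position. -/
inductive RewriteInference (I₁ I₂ : RewriteStep Sg V) (p : List ℕ) :
    EqLit Sg V → Clause Sg V → Subst Sg V → Prop
  | direct {l r t : Sg.Term V} {μ : Subst Sg V} :
      Disjoint I₁.allVars I₂.allVars →
      (I₁.lit = ⟨true, l, r⟩ ∨ I₁.lit = ⟨true, r, l⟩) →
      lt (r.subst I₁.sub.map) (l.subst I₁.sub.map) →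
      (I₂.lit.subst I₂.sub).at? p = some (l.subst I₁.sub.map) →
      I₂.lit.at? p = some t →
      IsMGU μ {(t, l)} →
      RewriteInference I₁ I₂ p ((I₂.lit.replace p r).subst μ)
        (I₁.rest.subst μ + I₂.rest.subst μ) (I₁.sub.comp I₂.sub)
  | belowVar {l r t : Sg.Term V} {μ δ ρ : Subst Sg V} :
      Disjoint I₁.allVars I₂.allVars →
      (I₁.lit = ⟨true, l, r⟩ ∨ I₁.lit = ⟨true, r, l⟩) →
      lt (r.subst I₁.sub.map) (l.subst I₁.sub.map) →
      (I₂.lit.subst I₂.sub).at? p = some (l.subst I₁.sub.map) →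
      I₂.lit.at? p = none →
      IsExpansion I₂.lit p I₂.sub (I₁.allVars ∪ I₂.allVars) δ ρ →
      (I₂.lit.subst δ).at? p = some t →
      IsMGU μ {(t, l)} →
      RewriteInference I₁ I₂ p (((I₂.lit.subst δ).replace p r).subst μ)
        (I₁.rest.subst μ + (I₂.rest.subst δ).subst μ) ((I₁.sub.comp I₂.sub).comp ρ)

/-- Reduction chains from `Γ`. Clauses are considered up to renaming of variables, so a closure from
`Γ` may be taken with renamed variables. -/
def IsReductionChain (Γ : List (AnnLit Sg V)) (P : List (RewriteStep Sg V)) : Prop :=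
  ∀ (i : ℕ) (I : RewriteStep Sg V), P[i]? = some I →
    (∃ A ∈ Γ, ∃ (π : Equiv.Perm V) (e : EqLit Sg V), e.toLit = A.lit.rename π ∧
      I = .base e (A.rest.rename π) (A.sub.conj π)) ∨
    (∃ R ∈ P.take i, ∃ S ∈ P.take i, ∃ e C σ p,
      I = .infer e C σ R S p ∧ RewriteInference lt R S p e C σ)

/-- A reduction chain from `Γ, A` whose last literal is the normal form of the ground literal of `A`
w.r.t. `conv Γ`. -/
def Reduces (Γ : List (AnnLit Sg V)) (A : AnnLit Sg V) (P : List (RewriteStep Sg V)) : Prop :=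
  IsReductionChain lt (Γ ++ [A]) P ∧
  ∃ I, P.getLast? = some I ∧ ∃ s t : Sg.Term V, A.ground = ⟨I.lit.pos, s(s, t)⟩ ∧
    IsNormalForm (conv lt (lits Γ)) s (I.lit.subst I.sub).lhs ∧
    IsNormalForm (conv lt (lits Γ)) t (I.lit.subst I.sub).rhs

/-- Reduction chain applications from `Γ` to `A`: minimal chains that reduce `A`. -/
def IsReductionChainApplication (Γ : List (AnnLit Sg V)) (A : AnnLit Sg V)
    (P : List (RewriteStep Sg V)) : Prop :=
  Reduces lt Γ A P ∧ ∀ i < P.length, ¬ Reduces lt Γ A (P.eraseIdx i)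

/-- A reduction chain from `Γ, A` that ends in a literal `s ≉ s`. -/
def Refutes (Γ : List (AnnLit Sg V)) (A : AnnLit Sg V) (P : List (RewriteStep Sg V)) : Prop :=
  IsReductionChain lt (Γ ++ [A]) P ∧
  ∃ I, P.getLast? = some I ∧ I.lit.pos = false ∧
    (I.lit.subst I.sub).lhs = (I.lit.subst I.sub).rhs

/-- Refutations from `Γ` and `A`: no step except the last can be removed. -/
def IsRefutation (Γ : List (AnnLit Sg V)) (A : AnnLit Sg V) (P : List (RewriteStep Sg V)) :
    Prop :=
  Refutes lt Γ A P ∧ ∀ i, i + 1 < P.length → ¬ Refutes lt Γ A (P.eraseIdx i)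

/-! ### The calculus -/

/-- The last component of a state: `⊤`, `⊥`, or a closure. -/
inductive Status (Sg : FirstOrder.Language.{u, v}) (V : Type w) where
  | top
  | bot
  | closure (C : Clause Sg V) (σ : Subst Sg V)

/-- States `(Γ; N; U; β; k; D)`. -/
structure State (Sg : FirstOrder.Language.{u, v}) (V : Type w) where
  trail : List (AnnLit Sg V)
  N : Set (Clause Sg V)
  U : Set (Clause Sg V)
  β : Sg.Term V
  k : ℕ
  status : Status Sg V

/-- The names of the rules. -/
inductive Rule where
  | propagate | decide | conflict | skip | exploreRefutation | factorize | equalityResolution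
  | backtrack | grow

/-- The rules of the calculus. -/
inductive Step : Rule → State Sg V → State Sg V → Prop
  | propagate {Γ N U β k} {C₀ : Clause Sg V} {b : Bool} {s t : Sg.Term V}
      {E : List (Sg.Term V × Sg.Term V)} {σ μ : Subst Sg V} {P : List (RewriteStep Sg V)}
      {I : RewriteStep Sg V} :
      -- the clause `C₀ ∨ C₁ ∨ L` with `L = s # t`, where `C₁` consists of the literals in `E`
      C₀ + Multiset.ofList (E.map fun e => (⟨b, s(e.1, e.2)⟩ : Literal Sg V)) +
        {⟨b, s(s, t)⟩} ∈ N ∪ U →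
      ((C₀ + {⟨b, s(s, t)⟩} : Clause Sg V).subst σ).Ground →
      ClauseFalse (lits Γ) (C₀.subst σ) →
      (∀ e ∈ E, e.1.subst σ.map = s.subst σ.map ∧ e.2.subst σ.map = t.subst σ.map) →
      IsMGU μ {q | ∃ e ∈ E, q = (e.1, s) ∨ q = (e.2, t)} →
      BetaUndefined lt β (lits Γ) (Literal.subst ⟨b, s(s, t)⟩ σ) →
      ClauseBelow lt β (((C₀ + {⟨b, s(s, t)⟩} : Clause Sg V).subst μ).subst σ) →
      SubstIrreducible (conv lt (lits Γ)) σ →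
      IsReductionChainApplication lt Γ
        ⟨k, Literal.subst ⟨b, s(s, t)⟩ μ, C₀.subst μ, σ⟩ P →
      P.getLast? = some I →
      Step .propagate ⟨Γ, N, U, β, k, .top⟩
        ⟨Γ ++ [⟨k, I.lit.toLit, I.rest, I.sub⟩], N, U, β, k, .top⟩
  | decide {Γ N U β k} {C₀ : Clause Sg V} {L : Literal Sg V} {σ : Subst Sg V}
      {P : List (RewriteStep Sg V)} {I : RewriteStep Sg V} :
      C₀ + {L} ∈ N ∪ U →
      ((C₀ + {L}).subst σ).Ground →
      (ClauseBetaUndefined lt β (lits Γ) (C₀.subst σ) ∨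
        ClauseBetaTrue lt β (lits Γ) (C₀.subst σ)) →
      BetaUndefined lt β (lits Γ) (L.subst σ) →
      ClauseBelow lt β ((C₀ + {L}).subst σ) →
      SubstIrreducible (conv lt (lits Γ)) σ →
      IsReductionChainApplication lt Γ ⟨k + 1, L, C₀, σ⟩ P →
      P.getLast? = some I →
      Step .decide ⟨Γ, N, U, β, k, .top⟩
        ⟨Γ ++ [⟨k + 1, I.lit.toLit, {I.lit.toLit.comp}, I.sub⟩], N, U, β, k + 1, .top⟩
  | conflict_bot {Γ N U β k} {C : Clause Sg V} {σ : Subst Sg V} :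
      C ∈ N ∪ U → (C.subst σ).Ground →
      ClauseBetaFalse lt β (lits Γ) (C.subst σ) →
      SubstIrreducible (conv lt (lits Γ)) σ →
      clauseLevel Γ (C.subst σ) = 0 →
      Step .conflict ⟨Γ, N, U, β, k, .top⟩ ⟨Γ, N, U, β, k, .bot⟩
  | conflict {Γ N U β k} {C : Clause Sg V} {σ : Subst Sg V} :
      C ∈ N ∪ U → (C.subst σ).Ground →
      ClauseBetaFalse lt β (lits Γ) (C.subst σ) →
      SubstIrreducible (conv lt (lits Γ)) σ →
      clauseLevel Γ (C.subst σ) ≠ 0 →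
      Step .conflict ⟨Γ, N, U, β, k, .top⟩ ⟨Γ, N, U, β, k, .closure C σ⟩
  | skip {Γ : List (AnnLit Sg V)} {K A : AnnLit Sg V} {N U β k} {C : Clause Sg V}
      {σ : Subst Sg V} :
      ClauseBetaFalse lt β (lits (Γ ++ [K])) (C.subst σ) →
      Step .skip ⟨Γ ++ [K, A], N, U, β, k, .closure C σ⟩
        ⟨Γ ++ [K], N, U, β, K.level, .closure C σ⟩
  | exploreRefutation {Γ N U β k} {C : Clause Sg V} {L : Literal Sg V} {σ : Subst Sg V}
      {P : List (RewriteStep Sg V)} {I : RewriteStep Sg V} :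
      (∀ K ∈ C.subst σ, TrailLT lt β Γ K (L.subst σ)) →
      -- the last literal of the trail is the defining literal of `Lσ`
      (∃ i, i + 1 = Γ.length ∧ IsDefining Γ (L.subst σ) i) →
      IsRefutation lt Γ ⟨k, L, C, σ⟩ P →
      I ∈ P →
      (I.clause.subst I.sub).Ground →
      MulExt (TrailLT lt β Γ) (I.clause.subst I.sub) ((C + {L}).subst σ) →
      ClauseBetaFalse lt β (lits Γ) (I.clause.subst I.sub) →
      Step .exploreRefutation ⟨Γ, N, U, β, k, .closure (C + {L}) σ⟩
        ⟨Γ, N, U, β, k, .closure I.clause I.sub⟩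
  | factorize {Γ N U β k} {C : Clause Sg V} {b : Bool} {s t s' t' : Sg.Term V}
      {σ μ : Subst Sg V} :
      s.subst σ.map = s'.subst σ.map → t.subst σ.map = t'.subst σ.map →
      IsMGU μ {(s, s'), (t, t')} →
      Step .factorize
        ⟨Γ, N, U, β, k, .closure (C + {⟨b, s(s, t)⟩} + {⟨b, s(s', t')⟩}) σ⟩
        ⟨Γ, N, U, β, k, .closure ((C + {⟨b, s(s, t)⟩} : Clause Sg V).subst μ) σ⟩
  | equalityResolution {Γ N U β k} {C : Clause Sg V} {s t : Sg.Term V} {σ μ : Subst Sg V} :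
      s.subst σ.map = t.subst σ.map →
      IsMGU μ {(s, t)} →
      Step .equalityResolution
        ⟨Γ, N, U, β, k, .closure (C + {⟨false, s(s, t)⟩}) σ⟩
        ⟨Γ, N, U, β, k, .closure (C.subst μ) σ⟩
  | backtrack_decision {Γ Γ' : List (AnnLit Sg V)} {K : AnnLit Sg V} {N U β k}
      {C : Clause Sg V} {L : Literal Sg V} {σ : Subst Sg V} :
      clauseLevel (Γ ++ K :: Γ') (C.subst σ) < k →
      (∃ τ : Subst Sg V, ((C + {L}).subst τ).Ground ∧
        ClauseBetaFalse lt β (lits (Γ ++ [K])) ((C + {L}).subst τ)) →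
      (¬ ∃ τ : Subst Sg V, ((C + {L}).subst τ).Ground ∧
        ClauseBetaFalse lt β (lits Γ) ((C + {L}).subst τ)) →
      IsDecision Γ K →
      Step .backtrack ⟨Γ ++ K :: Γ', N, U, β, k, .closure (C + {L}) σ⟩
        ⟨Γ, N, U ∪ {C + {L}}, β, K.level - 1, .top⟩
  | backtrack_propagated {Γ Γ' : List (AnnLit Sg V)} {K : AnnLit Sg V} {N U β k}
      {C : Clause Sg V} {L : Literal Sg V} {σ : Subst Sg V} :
      clauseLevel (Γ ++ K :: Γ') (C.subst σ) < k →
      (∃ τ : Subst Sg V, ((C + {L}).subst τ).Ground ∧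
        ClauseBetaFalse lt β (lits (Γ ++ [K])) ((C + {L}).subst τ)) →
      (¬ ∃ τ : Subst Sg V, ((C + {L}).subst τ).Ground ∧
        ClauseBetaFalse lt β (lits Γ) ((C + {L}).subst τ)) →
      ¬ IsDecision Γ K →
      Step .backtrack ⟨Γ ++ K :: Γ', N, U, β, k, .closure (C + {L}) σ⟩
        ⟨Γ, N, U ∪ {C + {L}}, β, K.level, .top⟩
  | grow {Γ N U β k β'} :
      TermGround β' → lt β β' →
      Step .grow ⟨Γ, N, U, β, k, .top⟩ ⟨[], N, U, β', 0, .top⟩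

/-- A rule is applicable to a state. -/
def Applicable (R : Rule) (S : State Sg V) : Prop := ∃ S', Step lt R S S'

/-- A run of `n` rule applications for the initial clause set `N`: rule `r i` leads from `S i` to
`S (i + 1)`. -/
structure IsRun (N : Set (Clause Sg V)) (n : ℕ) (S : ℕ → State Sg V) (r : ℕ → Rule) : Prop where
  init : ∃ β, TermGround β ∧ S 0 = ⟨[], N, ∅, β, 0, .top⟩
  step : ∀ i < n, Step lt (r i) (S i) (S (i + 1))

/-- `c` is the last application of Conflict before the rule application `b`. -/
def LastConflict (r : ℕ → Rule) (c b : ℕ) : Prop :=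
  c < b ∧ r c = .conflict ∧ ∀ j, c < j → j < b → r j ≠ .conflict

/-- Conflict is applied at `c` immediately after an application of Decide. -/
def AfterDecide (r : ℕ → Rule) (c : ℕ) : Prop := ∃ d, d + 1 = c ∧ r d = .decide

/-- Regular runs. -/
structure IsRegularRun (N : Set (Clause Sg V)) (n : ℕ) (S : ℕ → State Sg V) (r : ℕ → Rule) :
    Prop extends IsRun lt N n S r where
  /-- Conflict and Factorize have precedence over all other rules. -/
  conflict_first : ∀ i < n, Applicable lt .conflict (S i) → r i = .conflict
  factorize_first : ∀ i < n, Applicable lt .factorize (S i) → r i = .factorize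
  /-- At level zero, Propagate has precedence over Decide. -/
  propagate_first : ∀ i < n, (S i).k = 0 → Applicable lt .propagate (S i) → r i ≠ .decide
  /-- Decide does not add the complement of a literal that could be propagated with an annotation
  from `N ∪ U`. -/
  no_bad_decision : ∀ i < n, r i = .decide →
    ∀ A, (S (i + 1)).trail = (S i).trail ++ [A] →
    ¬ ∃ S' B, Step lt .propagate (S i) S' ∧ S'.trail = (S i).trail ++ [B] ∧
      B.clause ∈ (S i).N ∪ (S i).U ∧ A.ground = B.ground.comp
  /-- Skip is applied at least once during conflict resolution, except if Conflict is applied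
  immediately after Decide. -/
  skip_once : ∀ b < n, r b = .backtrack → ∀ c, LastConflict r c b →
    AfterDecide r c ∨ ∃ j, c < j ∧ j < b ∧ r j = .skip
  /-- If Conflict is applied immediately after Decide, then Backtrack is only applied if the
  conflict clause contains the complement of the last trail literal. -/
  backtrack_after_decide : ∀ b < n, r b = .backtrack → ∀ c, LastConflict r c b →
    AfterDecide r c → ∀ C σ, (S b).status = .closure C σ →
    ∃ A, (S b).trail.getLast? = some A ∧ A.ground.comp ∈ C.subst σ

/-- The state is in conflict resolution: its last component is a closure. -/
def State.InConflict (S : State Sg V) : Prop := ∃ C σ, S.status = .closure C σ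

/-- The closure `E·δ`, with `E = K ∨ D`, can replace the justification of the `j`-th literal `A` of
`Γ`: the literal stays the same, `Dδ` is false in the part of `Γ` to the left of it, and the sequence
with the new annotation is a trail. -/
def CanJustify (β : Sg.Term V) (Γ : List (AnnLit Sg V)) (j : ℕ) (A : AnnLit Sg V)
    (E : Clause Sg V) (δ : Subst Sg V) : Prop :=
  ∃ (K : Literal Sg V) (D : Clause Sg V), E = K ::ₘ D ∧ K.subst δ = A.ground ∧
    ClauseBetaFalse lt β (lits (Γ.take j)) (D.subst δ) ∧
    IsTrail lt (Γ.set j ⟨A.level, K, D, δ⟩)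

end

end SCLEQ

/-!
A clause that is smaller, for the ordering induced by a trail, than a clause that is `β`-false in an
initial segment of the trail can only contain literals that are defined in this segment. Now let
smaller clauses of `N ∪ U` entail the learned clause, and take a model of a segment in which the
learned clause is false. This model falsifies one of the smaller clauses, whose literals are then
all false in the segment, so that Conflict was applicable before the trail grew beyond the segment,
contrary to regularity. If Conflict was applied immediately after Decide, the segment is the trail
before the decision; the falsified clause may then also contain the complement of the decision
literal, which it could have propagated in place of the decision.

For a propagated literal `L`, the same argument in a model of the trail to the left of `L` that
falsifies `L` shows that one of the smaller clauses can justify `L`. A minimal clause that can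
justify `L` is not entailed by smaller ones, because the induced ordering is well-founded.
-/

namespace SCLEQ

open FirstOrder.Language (Term)

section Terms

variable {Sg : FirstOrder.Language.{u, v}} {V : Type w} {t u r : Sg.Term V} {f g : V → Sg.Term V}
  {x y : V} {p q : List ℕ} {R : Set (Sg.Term V × Sg.Term V)} {lt : Sg.Term V → Sg.Term V → Prop}

/-! ### Variables and substitutions -/

@[simp]
theorem mem_vars_var : x ∈ vars (Term.var y : Sg.Term V) ↔ x = y := by
  simp [vars, Term.varFinset]

@[simp]
theorem mem_vars_func {n : ℕ} {F : Sg.Functions n} {ts : Fin n → Sg.Term V} :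
    x ∈ vars (Term.func F ts) ↔ ∃ i, x ∈ vars (ts i) := by
  simp [vars, Term.varFinset]

theorem termGround_iff : TermGround t ↔ ∀ x, x ∉ vars t :=
  Finset.eq_empty_iff_forall_notMem

theorem not_termGround_var : ¬ TermGround (Term.var x : Sg.Term V) :=
  fun h => termGround_iff.1 h x (mem_vars_var.2 rfl)

theorem termGround_func {n : ℕ} {F : Sg.Functions n} {ts : Fin n → Sg.Term V} :
    TermGround (Term.func F ts) ↔ ∀ i, TermGround (ts i) := by
  simp only [termGround_iff, mem_vars_func, not_exists]
  exact forall_comm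

theorem subst_eq_subst_iff : t.subst f = t.subst g ↔ ∀ x ∈ vars t, f x = g x := by
  induction t with
  | var y => simp [Term.subst]
  | func F ts ih =>
    simp only [Term.subst, Term.func.injEq, heq_eq_eq, true_and, funext_iff, ih, mem_vars_func]
    exact ⟨fun h x ⟨i, hx⟩ => h i x hx, fun h i x hx => h x ⟨i, hx⟩⟩

theorem subst_var (t : Sg.Term V) : t.subst Term.var = t := by
  induction t with
  | var y => rfl
  | func F ts ih => simp only [Term.subst, ih]

theorem subst_subst (t : Sg.Term V) (f g : V → Sg.Term V) :
    (t.subst f).subst g = t.subst fun x => (f x).subst g := by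
  induction t with
  | var y => rfl
  | func F ts ih => simp only [Term.subst, ih]

theorem relabel_eq_subst (t : Sg.Term V) (π : V → V) :
    t.relabel π = t.subst fun x => Term.var (π x) := by
  induction t with
  | var y => rfl
  | func F ts ih => simp only [Term.subst, Term.relabel, ih]

theorem termGround_subst : TermGround (t.subst f) ↔ ∀ y ∈ vars t, TermGround (f y) := by
  induction t with
  | var y => simp [Term.subst]
  | func F ts ih =>
    simp only [Term.subst, termGround_func, ih, mem_vars_func]
    exact ⟨fun h y ⟨i, hy⟩ => h i y hy, fun h i y hy => h y ⟨i, hy⟩⟩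

theorem TermGround.subst_eq (h : TermGround t) (f : V → Sg.Term V) : t.subst f = t := by
  conv_rhs => rw [← subst_var t]
  exact subst_eq_subst_iff.2 fun x hx => absurd hx (termGround_iff.1 h x)

theorem TermGround.relabel_eq (h : TermGround t) (π : V → V) : t.relabel π = t := by
  rw [relabel_eq_subst, h.subst_eq]

theorem TermGround.realize_eq {M : Type*} [Sg.Structure M] (h : TermGround t) (ν ν' : V → M) :
    t.realize ν = t.realize ν' := by
  induction t with
  | var x => exact absurd h not_termGround_var
  | func F ts ih =>
    simp only [Term.realize]
    congr 1
    exact funext fun i => ih i (termGround_func.1 h i)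

theorem Subst.ext {σ τ : Subst Sg V} (h : ∀ x, σ.map x = τ.map x) : σ = τ := by
  cases σ; cases τ; cases funext h; rfl

theorem Subst.subst_comp (σ τ : Subst Sg V) (t : Sg.Term V) :
    t.subst (σ.comp τ).map = (t.subst σ.map).subst τ.map :=
  (subst_subst t σ.map τ.map).symm

theorem Subst.comp_assoc (σ τ ρ : Subst Sg V) : (σ.comp τ).comp ρ = σ.comp (τ.comp ρ) :=
  Subst.ext fun x => subst_subst (σ.map x) τ.map ρ.map

theorem Subst.map_eq_var {σ : Subst Sg V} (h : x ∉ σ.dom) : σ.map x = .var x :=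
  not_not.1 h

/-- The identity substitution. -/
def Subst.id : Subst Sg V := ⟨Term.var, by simp⟩

theorem Subst.id_comp (σ : Subst Sg V) : Subst.id.comp σ = σ := rfl

theorem Subst.conj_one (σ : Subst Sg V) : σ.conj 1 = σ :=
  Subst.ext fun x => Term.relabel_id (σ.map x)

theorem IsMGU.comp_eq {μ τ : Subst Sg V} {E : Set (Sg.Term V × Sg.Term V)} (hμ : IsMGU μ E)
    (hτ : Unifies τ E) : μ.comp τ = τ := by
  obtain ⟨ρ, rfl⟩ := hμ.mostGeneral τ hτ
  rw [← Subst.comp_assoc, hμ.idempotent]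

theorem isMGU_id_empty : IsMGU (Subst.id : Subst Sg V) ∅ where
  unifies := by simp [Unifies]
  mostGeneral τ _ := ⟨τ, (Subst.id_comp τ).symm⟩
  idempotent := Subst.id_comp _
  noFresh x hx := absurd rfl hx

/-! ### Positions -/

theorem termAt_func {n : ℕ} {F : Sg.Functions n} {ts : Fin n → Sg.Term V} (i : Fin n) :
    termAt (Term.func F ts) (i :: p) = termAt (ts i) p := by
  rw [termAt, dif_pos i.2]

theorem termReplace_func {n : ℕ} {F : Sg.Functions n} {ts : Fin n → Sg.Term V} (i : Fin n) :
    termReplace (Term.func F ts) (i :: p) r =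
      Term.func F (Function.update ts i (termReplace (ts i) p r)) := by
  rw [termReplace, dif_pos i.2]

theorem termAt_induction {motive : Sg.Term V → List ℕ → Prop} (nil : motive u [])
    (func : ∀ {n : ℕ} (F : Sg.Functions n) (ts : Fin n → Sg.Term V) (i : Fin n) (p : List ℕ),
      motive (ts i) p → motive (Term.func F ts) (i :: p))
    (h : termAt t p = some u) : motive t p := by
  induction p generalizing t with
  | nil =>
    rw [termAt, Option.some.injEq] at h
    exact h ▸ nil
  | cons i p ih =>
    cases t with
    | var x => simp [termAt] at h
    | @func n F ts =>
      by_cases hi : i < n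
      · exact func F ts ⟨i, hi⟩ p (ih (by rwa [termAt, dif_pos hi] at h))
      · rw [termAt, dif_neg hi] at h
        cases h

theorem termAt_append (h : termAt t p = some u) (q : List ℕ) : termAt t (p ++ q) = termAt u q :=
  termAt_induction (motive := fun t p => termAt t (p ++ q) = termAt u q) rfl
    (fun _ _ i _ ih => (termAt_func i).trans ih) h

theorem termAt_subst (h : termAt t p = some u) (f : V → Sg.Term V) :
    termAt (t.subst f) p = some (u.subst f) :=
  termAt_induction (motive := fun t p => termAt (t.subst f) p = some (u.subst f))
    (by rw [termAt])
    (fun _ _ i _ ih => (termAt_func i).trans ih) h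

theorem termReplace_self (h : termAt t p = some u) : termReplace t p u = t :=
  termAt_induction (motive := fun t p => termReplace t p u = t) (by rw [termReplace])
    (fun F ts i p ih => by rw [termReplace_func, ih, Function.update_eq_self]) h

theorem termReplace_subst (h : termAt t p = some u) (r : Sg.Term V) (f : V → Sg.Term V) :
    (termReplace t p r).subst f = termReplace (t.subst f) p (r.subst f) := by
  refine termAt_induction
    (motive := fun t p => (termReplace t p r).subst f = termReplace (t.subst f) p (r.subst f))
    (by rw [termReplace, termReplace]) (fun F ts i p ih => ?_) h
  simp only [termReplace_func, Term.subst, ← ih]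
  congr 1
  exact Function.comp_update (fun s : Sg.Term V => s.subst f) ts i _

theorem realize_termReplace {M : Type*} [Sg.Structure M] {ν : V → M} (h : termAt t p = some u)
    (hr : r.realize ν = u.realize ν) : (termReplace t p r).realize ν = t.realize ν := by
  refine termAt_induction (motive := fun t p => (termReplace t p r).realize ν = t.realize ν)
    (by rwa [termReplace]) (fun F ts i p ih => ?_) h
  simp only [termReplace_func, Term.realize]
  congr 1
  exact (Function.comp_update (fun s : Sg.Term V => s.realize ν) ts i _).trans
    (Function.update_eq_self_iff.2 ih)

theorem termGround_termReplace (h : termAt t p = some u) (ht : TermGround t) (hr : TermGround r) :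
    TermGround (termReplace t p r) := by
  refine termAt_induction (motive := fun t p => TermGround t → TermGround (termReplace t p r))
    (fun _ => by rwa [termReplace]) (fun F ts i p ih hts => ?_) h ht
  rw [termReplace_func, termGround_func, Function.forall_update_iff ts fun _ s => TermGround s]
  rw [termGround_func] at hts
  exact ⟨ih (hts i), fun j _ => hts j⟩

theorem exists_termAt_var (h : x ∈ vars t) : ∃ p, termAt t p = some (.var x) := by
  induction t with
  | var y => exact ⟨[], by rw [mem_vars_var.1 h]; rfl⟩
  | func F ts ih =>
    obtain ⟨i, hi⟩ := mem_vars_func.1 h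
    obtain ⟨p, hp⟩ := ih i hi
    exact ⟨i :: p, (termAt_func i).trans hp⟩

/-! ### Irreducible terms -/

theorem TermIrreducible.subterm (ht : TermIrreducible R t) (h : termAt t p = some u) :
    TermIrreducible R u := by
  rintro ⟨_, lr, hlr, q, σ, hq, rfl⟩
  exact ht ⟨_, lr, hlr, p ++ q, σ, by rw [termAt_append h, hq], rfl⟩

theorem TermIrreducible.of_subst (ht : TermIrreducible R (t.subst f)) (hx : x ∈ vars t) :
    TermIrreducible R (f x) := by
  obtain ⟨p, hp⟩ := exists_termAt_var hx
  exact ht.subterm (termAt_subst hp f)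

/-! ### Monotonic orderings -/

/-- Monotonic orderings: well-founded strict orderings of terms that are closed under contexts. -/
structure MonotonicOrdering (lt : Sg.Term V → Sg.Term V → Prop) : Prop where
  trans : ∀ s t r, lt s t → lt t r → lt s r
  wf : WellFounded lt
  context : ∀ s t, lt s t → ∀ (c : Sg.Term V) (p : List ℕ), (termAt c p).isSome →
    lt (termReplace c p s) (termReplace c p t)

theorem DesiredOrdering.monotonicOrdering (hlt : DesiredOrdering lt) : MonotonicOrdering lt :=
  ⟨hlt.trans, hlt.wf, hlt.context⟩

namespace MonotonicOrdering

variable {s : Sg.Term V}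

theorem lt_of_reflTransGen (hlt : MonotonicOrdering lt) (hst : Relation.ReflTransGen lt s t)
    (htr : lt t r) : lt s r := by
  induction hst with
  | refl => exact htr
  | tail _ hbc ih => exact ih (hlt.trans _ _ _ hbc htr)

theorem termReplace_lt (hlt : MonotonicOrdering lt) (h : termAt t p = some u) (hr : lt r u) :
    lt (termReplace t p r) t := by
  simpa only [termReplace_self h] using hlt.context r u hr t p (by simp [h])

theorem func_update_lt (hlt : MonotonicOrdering lt) {n : ℕ} (F : Sg.Functions n)
    (ts : Fin n → Sg.Term V) (i : Fin n) (h : lt s t) :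
    lt (.func F (Function.update ts i s)) (.func F (Function.update ts i t)) := by
  have key := hlt.context s t h (.func F ts) [i] (by simp [termAt])
  rwa [termReplace_func, termReplace_func, termReplace, termReplace] at key

theorem func_reflTransGen (hlt : MonotonicOrdering lt) {n : ℕ} (F : Sg.Functions n)
    {ss ts : Fin n → Sg.Term V} (h : ∀ i, Relation.ReflTransGen lt (ss i) (ts i)) :
    Relation.ReflTransGen lt (Term.func F ss) (Term.func F ts) := by
  suffices key : ∀ I : Finset (Fin n),
      Relation.ReflTransGen lt (Term.func F (I.piecewise ss ts)) (Term.func F ts) by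
    simpa using key Finset.univ
  intro I
  induction I using Finset.induction_on with
  | empty => rw [Finset.piecewise_empty]
  | insert i I hi ih =>
    refine .trans ?_ ih
    have hstep : Relation.ReflTransGen lt
        (Term.func F (Function.update (I.piecewise ss ts) i (ss i)))
        (Term.func F (Function.update (I.piecewise ss ts) i (ts i))) :=
      (h i).lift (fun s => Term.func F (Function.update (I.piecewise ss ts) i s))
        fun _ _ => hlt.func_update_lt F _ i
    rwa [← Finset.piecewise_insert, ← I.piecewise_eq_of_notMem ss ts hi,
      Function.update_eq_self] at hstep

theorem subst_reflTransGen (hlt : MonotonicOrdering lt) (t : Sg.Term V)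
    (h : ∀ x ∈ vars t, Relation.ReflTransGen lt (f x) (g x)) :
    Relation.ReflTransGen lt (t.subst f) (t.subst g) := by
  induction t with
  | var x => exact h x (mem_vars_var.2 rfl)
  | func F ts ih =>
    exact hlt.func_reflTransGen F fun i => ih i fun x hx => h x (mem_vars_func.2 ⟨i, hx⟩)

end MonotonicOrdering

end Terms

section Semantics

variable {Sg : FirstOrder.Language.{u, v}} {V : Type w} {b : Bool} {s t s' t' β : Sg.Term V}
  {f g : V → Sg.Term V} {σ τ : Subst Sg V} {L : Literal Sg V} {C : Clause Sg V}
  {N N' : Set (Clause Sg V)} {Γ Δ : List (Literal Sg V)}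
  {R : Set (Sg.Term V × Sg.Term V)} {lt : Sg.Term V → Sg.Term V → Prop}

/-! ### Literals and clauses -/

namespace Literal

theorem comp_comp (L : Literal Sg V) : L.comp.comp = L := by
  cases L; simp [comp]

theorem comp_subst (L : Literal Sg V) (σ : Subst Sg V) :
    L.comp.subst σ = (L.subst σ).comp := rfl

theorem subst_mk (b : Bool) (s t : Sg.Term V) (σ : Subst Sg V) :
    Literal.subst ⟨b, s(s, t)⟩ σ = ⟨b, s(s.subst σ.map, t.subst σ.map)⟩ := rfl

theorem ground_mk : Literal.Ground ⟨b, s(s, t)⟩ ↔ TermGround s ∧ TermGround t := by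
  simp [Ground]

theorem comp_ground : L.comp.Ground ↔ L.Ground := Iff.rfl

theorem exists_mk (L : Literal Sg V) : ∃ b s t, L = ⟨b, s(s, t)⟩ := by
  obtain ⟨b, e⟩ := L
  induction e using Sym2.ind with
  | _ s t => exact ⟨b, s, t, rfl⟩

theorem subst_comp (L : Literal Sg V) (σ τ : Subst Sg V) :
    L.subst (σ.comp τ) = (L.subst σ).subst τ := by
  obtain ⟨b, s, t, rfl⟩ := L.exists_mk
  simp only [subst_mk, Subst.subst_comp]

theorem subst_congr (h : ∀ t ∈ L.eqn, ∀ x ∈ vars t, σ.map x = τ.map x) :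
    L.subst σ = L.subst τ := by
  obtain ⟨b, s, t, rfl⟩ := L.exists_mk
  rw [subst_mk, subst_mk, subst_eq_subst_iff.2 (h s (by simp)),
    subst_eq_subst_iff.2 (h t (by simp))]

section Holds

variable {M : Type*} [Sg.Structure M] {ν : V → M}

theorem holds_mk : Holds ⟨b, s(s, t)⟩ ν ↔ (s.realize ν = t.realize ν ↔ b = true) := by
  simp [Holds]

theorem holds_comp : L.comp.Holds ν ↔ ¬ L.Holds ν := by
  obtain ⟨b, e⟩ := L
  cases b <;> simp [Holds, comp]

theorem Ground.holds_iff (hL : L.Ground) (ν ν' : V → M) : L.Holds ν ↔ L.Holds ν' := by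
  obtain ⟨b, s, t, rfl⟩ := L.exists_mk
  obtain ⟨hs, ht⟩ := ground_mk.1 hL
  rw [holds_mk, holds_mk, hs.realize_eq ν ν', ht.realize_eq ν ν']

end Holds

end Literal

namespace Clause

theorem subst_comp (C : Clause Sg V) (σ τ : Subst Sg V) :
    Clause.subst C (σ.comp τ) = Clause.subst (Clause.subst C σ) τ := by
  simp only [Clause.subst, Multiset.map_map]
  exact Multiset.map_congr rfl fun L _ => L.subst_comp σ τ

theorem subst_add (C D : Clause Sg V) (σ : Subst Sg V) :
    Clause.subst (C + D) σ = Clause.subst C σ + Clause.subst D σ := Multiset.map_add _ _ _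

theorem subst_cons (L : Literal Sg V) (D : Clause Sg V) (σ : Subst Sg V) :
    Clause.subst (L ::ₘ D) σ = L.subst σ ::ₘ Clause.subst D σ := Multiset.map_cons _ _ _

theorem subst_singleton (L : Literal Sg V) (σ : Subst Sg V) :
    Clause.subst {L} σ = {L.subst σ} := Multiset.map_singleton _ _

theorem subst_congr (h : ∀ x ∈ Clause.vars C, σ.map x = τ.map x) :
    Clause.subst C σ = Clause.subst C τ :=
  Multiset.map_congr rfl fun L hL => Literal.subst_congr fun t ht x hx => h x ⟨L, hL, t, ht, hx⟩

theorem finite_vars (C : Clause Sg V) : (Clause.vars C).Finite := by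
  classical
  have h : Clause.vars C =
      ⋃ L ∈ C.toFinset, ⋃ t ∈ L.eqn.toMultiset.toFinset, (SCLEQ.vars t : Set V) := by
    ext x
    simp [Clause.vars]
  rw [h]
  exact Set.Finite.biUnion (Finset.finite_toSet _) fun L _ =>
    Set.Finite.biUnion (Finset.finite_toSet _) fun t _ => Finset.finite_toSet _

theorem ground_subst_iff :
    Clause.Ground (Clause.subst C σ) ↔ ∀ x ∈ Clause.vars C, TermGround (σ.map x) := by
  constructor
  · rintro h x ⟨L, hL, t, ht, hx⟩
    exact termGround_subst.1
      (h _ (Multiset.mem_map_of_mem _ hL) _ (Sym2.mem_map.2 ⟨t, ht, rfl⟩)) x hx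
  · intro h L' hL' t' ht'
    obtain ⟨L, hL, rfl⟩ := Multiset.mem_map.1 hL'
    obtain ⟨t, ht, rfl⟩ := Sym2.mem_map.1 ht'
    exact termGround_subst.2 fun x hx => h x ⟨L, hL, t, ht, hx⟩

end Clause

/-! ### Entailment -/

theorem Entails.mono (hN : N ⊆ N') (h : Entails N C) : Entails N' C :=
  fun M _ _ hM => h M fun D hD => hM D (hN hD)

/-- `M` is a model of the literals in `Γ`, read as universally closed. -/
def Models (M : Type*) [Sg.Structure M] (Γ : List (Literal Sg V)) : Prop :=
  ∀ L ∈ Γ, ∀ ν : V → M, L.Holds ν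

theorem Models.mono {M : Type*} [Sg.Structure M] (h : Δ ⊆ Γ) (hM : Models M Γ) : Models M Δ :=
  fun L hL => hM L (h hL)

theorem models_iff_units {M : Type*} [Sg.Structure M] :
    Models M Γ ↔ ∀ D ∈ units Γ, ∀ ν : V → M, ∃ L ∈ D, L.Holds ν := by
  constructor
  · rintro hM D ⟨L, hL, rfl⟩ ν
    exact ⟨L, Multiset.mem_singleton_self L, hM L hL ν⟩
  · intro hM L hL ν
    obtain ⟨K, hK, hν⟩ := hM {L} ⟨L, hL, rfl⟩ ν
    rwa [Multiset.mem_singleton.1 hK] at hν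

theorem units_mono (h : Δ ⊆ Γ) : units Δ ⊆ units Γ := by
  rintro D ⟨L, hL, rfl⟩
  exact ⟨L, h hL, rfl⟩

theorem litTrue_iff :
    LitTrue Γ L ↔ ∀ (M : Type (max u w)) [Nonempty M] [Sg.Structure M], Models M Γ →
      ∀ ν : V → M, L.Holds ν := by
  simp only [LitTrue, Entails, ← models_iff_units, Multiset.mem_singleton, exists_eq_left]

theorem litFalse_iff :
    LitFalse Γ L ↔ ∀ (M : Type (max u w)) [Nonempty M] [Sg.Structure M], Models M Γ →
      ∀ ν : V → M, ¬ L.Holds ν := by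
  simp only [← Literal.holds_comp]
  exact litTrue_iff

theorem consistent_iff_exists_model :
    Consistent Γ ↔
      ∃ (M : Type (max u w)) (_ : Nonempty M) (_ : Sg.Structure M), Models M Γ := by
  constructor
  · intro h
    by_contra! hM
    exact h fun M _ _ hΓ => absurd (models_iff_units.2 hΓ) (hM M inferInstance inferInstance)
  · rintro ⟨M, ⟨x⟩, _, hM⟩ h
    have : Nonempty M := ⟨x⟩
    obtain ⟨L, hL, -⟩ := h M (models_iff_units.1 hM) fun _ => x
    exact Multiset.notMem_zero L hL

theorem Consistent.mono (h : Δ ⊆ Γ) (hΓ : Consistent Γ) : Consistent Δ :=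
  fun hΔ => hΓ (hΔ.mono (units_mono h))

theorem LitTrue.mono (h : Δ ⊆ Γ) (hL : LitTrue Δ L) : LitTrue Γ L :=
  Entails.mono (units_mono h) hL

theorem LitFalse.mono (h : Δ ⊆ Γ) (hL : LitFalse Δ L) : LitFalse Γ L :=
  LitTrue.mono h hL

theorem LitDefined.mono (h : Δ ⊆ Γ) (hL : LitDefined Δ L) : LitDefined Γ L :=
  hL.imp (LitTrue.mono h) (LitFalse.mono h)

theorem LitTrue.of_mem (h : L ∈ Γ) : LitTrue Γ L :=
  litTrue_iff.2 fun _ _ _ hM => hM L h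

theorem LitFalse.of_comp_mem (h : L.comp ∈ Γ) : LitFalse Γ L := LitTrue.of_mem h

theorem litDefined_comp : LitDefined Γ L.comp ↔ LitDefined Γ L := by
  unfold LitDefined LitFalse LitTrue
  rw [L.comp_comp, or_comm]

theorem Consistent.not_true_of_false (h : Consistent Γ) (hF : LitFalse Γ L) : ¬ LitTrue Γ L := by
  obtain ⟨M, ⟨x⟩, _, hM⟩ := consistent_iff_exists_model.1 h
  have : Nonempty M := ⟨x⟩
  exact fun hT => litFalse_iff.1 hF M hM (fun _ => x) (litTrue_iff.1 hT M hM _)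

theorem Consistent.comp_notMem (h : Consistent Γ) (hL : L ∈ Γ) : L.comp ∉ Γ :=
  fun hm => h.not_true_of_false (.of_comp_mem hm) (.of_mem hL)

theorem Consistent.append (hL : L.Ground) (h : ¬ LitDefined Γ L) : Consistent (Γ ++ [L]) := by
  by_contra hc
  refine h (Or.inr (litFalse_iff.2 fun M _ _ hM ν hν => hc ?_))
  refine consistent_iff_exists_model.2 ⟨M, inferInstance, inferInstance, fun K hK ν' => ?_⟩
  rcases List.mem_append.1 hK with hK | hK
  · exact hM K hK ν'
  · rw [List.mem_singleton.1 hK]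
    exact (hL.holds_iff ν ν').1 hν

theorem LitDefined.false_of_not_holds (h : LitDefined Γ L) {M : Type (max u w)} [Nonempty M]
    [Sg.Structure M] (hM : Models M Γ) {ν : V → M} (hν : ¬ L.Holds ν) : LitFalse Γ L :=
  h.resolve_left fun hT => hν (litTrue_iff.1 hT M hM ν)

/-! ### Comparison with a term -/

theorem mulExt_singleton {α : Type*} {r : α → α → Prop} {M : Multiset α} {a : α} :
    MulExt r M {a} ↔ ∀ c ∈ M, r c a := by
  constructor
  · rintro ⟨X, Y, Z, hZ, rfl, hN, h⟩ c hc
    have hX : X = 0 := by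
      have hcard := congrArg Multiset.card hN
      rw [Multiset.card_singleton, Multiset.card_add] at hcard
      exact Multiset.card_eq_zero.1 (by have := Multiset.card_pos.2 hZ; omega)
    subst hX
    rw [zero_add] at hN hc
    subst hN
    obtain ⟨z, hz, hr⟩ := h c hc
    rwa [Multiset.mem_singleton.1 hz] at hr
  · intro h
    exact ⟨0, M, {a}, by simp, by simp, by simp, fun c hc => ⟨a, by simp, h c hc⟩⟩

theorem Literal.mem_terms : t ∈ L.terms ↔ t ∈ L.eqn := by
  unfold Literal.terms
  split <;> simp

theorem litBelow_iff : LitBelow lt β L ↔ ∀ t ∈ L.eqn, lt t β := by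
  simp only [LitBelow, mulExt_singleton, Literal.mem_terms]

theorem litBelow_mk : LitBelow lt β ⟨b, s(s, t)⟩ ↔ lt s β ∧ lt t β := by
  simp [litBelow_iff]

theorem litBelow_comp : LitBelow lt β L.comp ↔ LitBelow lt β L := by
  simp only [litBelow_iff, Literal.comp]

theorem clauseBelow_iff : ClauseBelow lt β C ↔ ∀ L ∈ C, LitBelow lt β L := by
  simp only [ClauseBelow, mulExt_singleton, Multiset.mem_map, forall_exists_index, and_imp,
    forall_apply_eq_imp_iff₂, LitBelow]

theorem not_litAbove_of_litBelow (hlt : WellFounded lt) (h : LitBelow lt β L) :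
    ¬ LitAbove lt β L := by
  rw [LitBelow, mulExt_singleton] at h
  rintro ⟨X, Y, Z, -, hX, hZ, hY⟩
  rw [hZ] at h
  rcases Multiset.mem_add.1 (hX ▸ Multiset.mem_singleton_self β) with hβ | hβ
  · have hββ := h β (Multiset.mem_add.2 (Or.inl hβ))
    exact hlt.asymmetric _ _ hββ hββ
  · obtain ⟨z, hz, hβz⟩ := hY β hβ
    exact hlt.asymmetric _ _ hβz (h z (Multiset.mem_add.2 (Or.inr hz)))

theorem BetaUndefined.not_defined (hlt : WellFounded lt) (h : BetaUndefined lt β Γ L)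
    (hL : LitBelow lt β L) : ¬ LitDefined Γ L :=
  h.resolve_left (not_litAbove_of_litBelow hlt hL)

/-! ### Equality modulo a trail -/

/-- The equation `s ≈ t` holds in all models of `Γ`. -/
def EqIn (Γ : List (Literal Sg V)) (s t : Sg.Term V) : Prop :=
  ∀ (M : Type (max u w)) [Nonempty M] [Sg.Structure M], Models M Γ →
    ∀ ν : V → M, s.realize ν = t.realize ν

theorem EqIn.refl (Γ : List (Literal Sg V)) (t : Sg.Term V) : EqIn Γ t t :=
  fun _ _ _ _ _ => rfl

theorem EqIn.trans {r : Sg.Term V} (hst : EqIn Γ s t) (htr : EqIn Γ t r) : EqIn Γ s r :=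
  fun M _ _ hM ν => (hst M hM ν).trans (htr M hM ν)

theorem EqIn.subst (t : Sg.Term V) (h : ∀ x ∈ vars t, EqIn Γ (f x) (g x)) :
    EqIn Γ (t.subst f) (t.subst g) := by
  intro M _ _ hM ν
  induction t with
  | var x => exact h x (mem_vars_var.2 rfl) M hM ν
  | func F ts ih =>
    simp only [Term.subst, Term.realize]
    congr 1
    exact funext fun i => ih i fun x hx => h x (mem_vars_func.2 ⟨i, hx⟩)

theorem litTrue_congr (hs : EqIn Γ s s') (ht : EqIn Γ t t') :
    LitTrue Γ ⟨b, s(s, t)⟩ ↔ LitTrue Γ ⟨b, s(s', t')⟩ := by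
  simp only [litTrue_iff, Literal.holds_mk]
  constructor <;> intro h M _ _ hM ν
  · rw [← hs M hM ν, ← ht M hM ν]
    exact h M hM ν
  · rw [hs M hM ν, ht M hM ν]
    exact h M hM ν

theorem litFalse_congr (hs : EqIn Γ s s') (ht : EqIn Γ t t') :
    LitFalse Γ ⟨b, s(s, t)⟩ ↔ LitFalse Γ ⟨b, s(s', t')⟩ := litTrue_congr hs ht

theorem litDefined_congr (hs : EqIn Γ s s') (ht : EqIn Γ t t') :
    LitDefined Γ ⟨b, s(s, t)⟩ ↔ LitDefined Γ ⟨b, s(s', t')⟩ :=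
  or_congr (litTrue_congr hs ht) (litFalse_congr hs ht)

/-! ### Normal forms -/

namespace Rewrites

theorem exists_termReplace (h : Rewrites (conv lt Γ) s t) :
    ∃ (p : List ℕ) (l r : Sg.Term V), (l, r) ∈ conv lt Γ ∧ termAt s p = some l ∧
      t = termReplace s p r := by
  obtain ⟨⟨l, r⟩, hlr, p, σ, hp, rfl⟩ := h
  rw [hlr.1.subst_eq] at hp
  rw [hlr.2.1.subst_eq]
  exact ⟨p, l, r, hlr, hp, rfl⟩

theorem eqIn (h : Rewrites (conv lt Γ) s t) : EqIn Γ s t := by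
  obtain ⟨p, l, r, ⟨-, -, -, hE⟩, hp, rfl⟩ := h.exists_termReplace
  have hlr : LitTrue Γ ⟨true, s(l, r)⟩ := Entails.mono (by
    rintro D ⟨L, hL, -, rfl⟩
    exact ⟨L, hL, rfl⟩) hE
  intro M _ _ hM ν
  exact (realize_termReplace hp ((Literal.holds_mk.1 (litTrue_iff.1 hlr M hM ν)).2 rfl).symm).symm

theorem termGround (h : Rewrites (conv lt Γ) s t) (hs : TermGround s) : TermGround t := by
  obtain ⟨p, l, r, ⟨-, hr, -, -⟩, hp, rfl⟩ := h.exists_termReplace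
  exact termGround_termReplace hp hs hr

end Rewrites

theorem MonotonicOrdering.lt_of_rewrites (hlt : MonotonicOrdering lt)
    (h : Rewrites (conv lt Γ) s t) : lt t s := by
  obtain ⟨p, l, r, ⟨-, -, hrl, -⟩, hp, rfl⟩ := h.exists_termReplace
  exact hlt.termReplace_lt hp hrl

namespace IsNormalForm

theorem eqIn (h : IsNormalForm (conv lt Γ) s t) : EqIn Γ s t := by
  obtain ⟨h, -⟩ := h
  induction h with
  | refl => exact .refl Γ s
  | tail _ hstep ih => exact ih.trans hstep.eqIn

theorem reflTransGen (hlt : MonotonicOrdering lt) (h : IsNormalForm (conv lt Γ) s t) :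
    Relation.ReflTransGen lt t s :=
  Relation.ReflTransGen.mono (fun _ _ => hlt.lt_of_rewrites) _ _ h.1.swap

theorem termGround (h : IsNormalForm (conv lt Γ) s t) (hs : TermGround s) : TermGround t := by
  obtain ⟨h, -⟩ := h
  induction h with
  | refl => exact hs
  | tail _ hstep ih => exact hstep.termGround ih

theorem eq_of_irreducible (h : IsNormalForm R t s) (ht : TermIrreducible R t) : s = t := by
  rcases h.1.cases_head with rfl | ⟨t', htt', -⟩
  · rfl
  · exact absurd ⟨t', htt'⟩ ht

end IsNormalForm

theorem exists_isNormalForm (hlt : MonotonicOrdering lt) (Γ : List (Literal Sg V))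
    (t : Sg.Term V) : ∃ s, IsNormalForm (conv lt Γ) t s := by
  induction t using hlt.wf.induction with
  | _ t ih =>
    by_cases h : ∃ t', Rewrites (conv lt Γ) t t'
    · obtain ⟨t', h⟩ := h
      obtain ⟨s, hs, hi⟩ := ih t' (hlt.lt_of_rewrites h)
      exact ⟨s, .head h hs, hi⟩
    · exact ⟨t, .refl, h⟩

/-! ### Normalizing grounding substitutions -/

/-- On the variables of `C`, the values of `τ` are normal forms of those of `σ`. -/
def NormalizesOn (R : Set (Sg.Term V × Sg.Term V)) (C : Clause Sg V) (σ τ : Subst Sg V) : Prop :=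
  ∀ x ∈ Clause.vars C, IsNormalForm R (σ.map x) (τ.map x)

theorem exists_normalizesOn (hlt : MonotonicOrdering lt) (Γ : List (Literal Sg V))
    (C : Clause Sg V) (σ : Subst Sg V) :
    ∃ τ : Subst Sg V, SubstIrreducible (conv lt Γ) τ ∧ NormalizesOn (conv lt Γ) C σ τ := by
  classical
  choose nf hnf using fun x => exists_isNormalForm hlt Γ (σ.map x)
  have hdom : {x | (if x ∈ Clause.vars C then nf x else .var x) ≠ .var x} ⊆ Clause.vars C :=
    fun x hx => by_contra fun h => hx (if_neg h)
  refine ⟨⟨_, (Clause.finite_vars C).subset hdom⟩, fun x hx => ?_, fun x hx => ?_⟩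
  · simp only [if_pos (hdom hx)]
    exact (hnf x).2
  · simp only [if_pos hx]
    exact hnf x

namespace NormalizesOn

theorem ground (h : NormalizesOn (conv lt Γ) C σ τ) (hC : Clause.Ground (Clause.subst C σ)) :
    Clause.Ground (Clause.subst C τ) :=
  Clause.ground_subst_iff.2 fun x hx => (h x hx).termGround (Clause.ground_subst_iff.1 hC x hx)

theorem litFalse (h : NormalizesOn (conv lt Γ) C σ τ) (hL : L ∈ C)
    (hF : LitFalse Γ (L.subst σ)) : LitFalse Γ (L.subst τ) := by
  obtain ⟨b, s, t, rfl⟩ := L.exists_mk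
  exact (litFalse_congr
    (.subst s fun x hx => (h x ⟨_, hL, s, by simp, hx⟩).eqIn)
    (.subst t fun x hx => (h x ⟨_, hL, t, by simp, hx⟩).eqIn)).1 hF

theorem litBelow (hlt : MonotonicOrdering lt) (h : NormalizesOn (conv lt Γ) C σ τ) (hL : L ∈ C)
    (hβ : LitBelow lt β (L.subst σ)) : LitBelow lt β (L.subst τ) := by
  rw [litBelow_iff] at hβ ⊢
  intro t ht
  obtain ⟨s, hs, rfl⟩ := Sym2.mem_map.1 ht
  exact hlt.lt_of_reflTransGen
    (hlt.subst_reflTransGen s fun x hx => (h x ⟨L, hL, s, hs, hx⟩).reflTransGen hlt)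
    (hβ _ (Sym2.mem_map.2 ⟨s, hs, rfl⟩))

theorem subst_eq (h : NormalizesOn R C σ τ) (hL : L ∈ C) (hi : LitIrreducible R (L.subst σ)) :
    L.subst τ = L.subst σ :=
  Literal.subst_congr fun t ht x hx => (h x ⟨L, hL, t, ht, hx⟩).eq_of_irreducible
    ((hi _ (Sym2.mem_map.2 ⟨t, ht, rfl⟩)).of_subst hx)

end NormalizesOn

end Semantics

section Chains

variable {Sg : FirstOrder.Language.{u, v}} {V : Type w} {lt : Sg.Term V → Sg.Term V → Prop}
  {β l r t : Sg.Term V} {p : List ℕ} {e : EqLit Sg V} {σ τ μ : Subst Sg V} {L K : Literal Sg V}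
  {C D : Clause Sg V} {Γ Δ : List (Literal Sg V)} {I I₁ I₂ : RewriteStep Sg V}
  {P : List (RewriteStep Sg V)}

/-! ### Soundness of reduction chains -/

namespace EqLit

theorem toLit_subst (e : EqLit Sg V) (σ : Subst Sg V) :
    (e.subst σ).toLit = e.toLit.subst σ := rfl

theorem subst_comp (e : EqLit Sg V) (σ τ : Subst Sg V) :
    e.subst (σ.comp τ) = (e.subst σ).subst τ := by
  simp only [EqLit.subst, Subst.subst_comp]

theorem at?_cases (h : e.at? p = some t) :
    (∃ q, p = 0 :: q ∧ termAt e.lhs q = some t) ∨ (∃ q, p = 1 :: q ∧ termAt e.rhs q = some t) := by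
  rcases p with _ | ⟨_ | _ | n, q⟩
  · simp [EqLit.at?] at h
  · exact Or.inl ⟨q, rfl, h⟩
  · exact Or.inr ⟨q, rfl, h⟩
  · simp [EqLit.at?] at h

theorem at?_subst (h : e.at? p = some t) (σ : Subst Sg V) :
    (e.subst σ).at? p = some (t.subst σ.map) := by
  rcases at?_cases h with ⟨q, rfl, hq⟩ | ⟨q, rfl, hq⟩ <;> exact termAt_subst hq _

theorem replace_subst (h : e.at? p = some t) (r : Sg.Term V) (σ : Subst Sg V) :
    (e.replace p r).subst σ = (e.subst σ).replace p (r.subst σ.map) := by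
  rcases at?_cases h with ⟨q, rfl, hq⟩ | ⟨q, rfl, hq⟩ <;>
    simp only [EqLit.replace, EqLit.subst, termReplace_subst hq]

theorem ground_replace (h : e.at? p = some t) (he : e.toLit.Ground) (hr : TermGround r) :
    (e.replace p r).toLit.Ground := by
  obtain ⟨hlhs, hrhs⟩ := Literal.ground_mk.1 he
  rcases at?_cases h with ⟨q, rfl, hq⟩ | ⟨q, rfl, hq⟩
  · exact Literal.ground_mk.2 ⟨termGround_termReplace hq hlhs hr, hrhs⟩
  · exact Literal.ground_mk.2 ⟨hlhs, termGround_termReplace hq hrhs hr⟩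

theorem litBelow_replace (hlt : MonotonicOrdering lt) (h : e.at? p = some t) (hr : lt r t)
    (he : LitBelow lt β e.toLit) : LitBelow lt β (e.replace p r).toLit := by
  obtain ⟨hlhs, hrhs⟩ := litBelow_mk.1 he
  rcases at?_cases h with ⟨q, rfl, hq⟩ | ⟨q, rfl, hq⟩
  · exact litBelow_mk.2 ⟨hlt.trans _ _ _ (hlt.termReplace_lt hq hr) hlhs, hrhs⟩
  · exact litBelow_mk.2 ⟨hlhs, hlt.trans _ _ _ (hlt.termReplace_lt hq hr) hrhs⟩

end EqLit

/-- The ground clause `L ∨ C` is below `β`, and `C` is false in `Γ`. Reduction chains preserve this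
property of the ground instances of their closures, where `L` is the rewrite literal. -/
structure SoundInstance (lt : Sg.Term V → Sg.Term V → Prop) (β : Sg.Term V)
    (Γ : List (Literal Sg V)) (L : Literal Sg V) (C : Clause Sg V) : Prop where
  ground : Clause.Ground (L ::ₘ C)
  below : ClauseBelow lt β (L ::ₘ C)
  restFalse : ClauseFalse Γ C

namespace SoundInstance

theorem mono (hΓ : Γ ⊆ Δ) (h : SoundInstance lt β Γ L C) : SoundInstance lt β Δ L C where
  ground := h.ground
  below := h.below
  restFalse K hK := (h.restFalse K hK).mono hΓ

theorem litGround (h : SoundInstance lt β Γ L C) : L.Ground :=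
  h.ground L (Multiset.mem_cons_self L C)

theorem litBelow (h : SoundInstance lt β Γ L C) : LitBelow lt β L :=
  clauseBelow_iff.1 h.below L (Multiset.mem_cons_self L C)

theorem replace (hlt : MonotonicOrdering lt) (h₁ : SoundInstance lt β Γ ⟨true, s(l, r)⟩ C)
    (h₂ : SoundInstance lt β Γ e.toLit D) (hrl : lt r l) (hp : e.at? p = some l) :
    SoundInstance lt β Γ (e.replace p r).toLit (C + D) := by
  have hrest {Q : Literal Sg V → Prop} (hC : ∀ K ∈ C, Q K) (hD : ∀ K ∈ D, Q K) :
      ∀ K ∈ C + D, Q K := fun K hK => (Multiset.mem_add.1 hK).elim (hC K) (hD K)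
  refine ⟨Multiset.forall_mem_cons.2 ⟨?_, ?_⟩, clauseBelow_iff.2 (Multiset.forall_mem_cons.2
    ⟨EqLit.litBelow_replace hlt hp hrl h₂.litBelow, ?_⟩), hrest h₁.restFalse h₂.restFalse⟩
  · exact EqLit.ground_replace hp h₂.litGround (Literal.ground_mk.1 h₁.litGround).2
  · exact hrest (Multiset.forall_mem_cons.1 h₁.ground).2 (Multiset.forall_mem_cons.1 h₂.ground).2
  · exact hrest (Multiset.forall_mem_cons.1 (clauseBelow_iff.1 h₁.below)).2
      (Multiset.forall_mem_cons.1 (clauseBelow_iff.1 h₂.below)).2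

end SoundInstance

namespace RewriteStep

theorem subst_lit_congr (h : ∀ x ∈ Clause.vars I.clause, σ.map x = τ.map x) :
    I.lit.subst σ = I.lit.subst τ := by
  have hmem : I.lit.toLit ∈ I.clause := Multiset.mem_cons_self _ _
  simp only [EqLit.subst, EqLit.mk.injEq, true_and, subst_eq_subst_iff]
  exact ⟨fun x hx => h x ⟨_, hmem, _, Sym2.mem_mk_left _ _, hx⟩,
    fun x hx => h x ⟨_, hmem, _, Sym2.mem_mk_right _ _, hx⟩⟩

theorem subst_rest_congr (h : ∀ x ∈ Clause.vars I.clause, σ.map x = τ.map x) :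
    Clause.subst I.rest σ = Clause.subst I.rest τ :=
  Clause.subst_congr fun x ⟨K, hK, hx⟩ => h x ⟨K, Multiset.mem_cons_of_mem hK, hx⟩

theorem ground_map (h : Clause.Ground (Clause.subst I.clause I.sub)) {x : V}
    (hx : x ∈ Clause.vars I.clause) : TermGround (I.sub.map x) :=
  Clause.ground_subst_iff.1 h x hx

theorem map_comp_eq (h : Clause.Ground (Clause.subst I.clause I.sub)) {x : V}
    (hx : x ∈ Clause.vars I.clause) (τ : Subst Sg V) : (I.sub.comp τ).map x = I.sub.map x :=
  (ground_map h hx).subst_eq τ.map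

end RewriteStep

theorem Subst.comp_map_eq_right {x : V} (hx : x ∉ σ.dom) (τ : Subst Sg V) :
    (σ.comp τ).map x = τ.map x := by
  change (σ.map x).subst τ.map = τ.map x
  rw [Subst.map_eq_var hx, Term.subst]

theorem IsExpansion.map_eq {δ ρ : Subst Sg V} (hdisj : Disjoint I₁.allVars I₂.allVars)
    (hδ : IsExpansion I₂.lit p I₂.sub (I₁.allVars ∪ I₂.allVars) δ ρ)
    (hg : Clause.Ground (Clause.subst I₂.clause I₂.sub)) {x : V}
    (hx : x ∈ Clause.vars I₂.clause) :
    (δ.comp ((I₁.sub.comp I₂.sub).comp ρ)).map x = I₂.sub.map x := by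
  have hfix : (δ.map x).subst I₁.sub.map = δ.map x := by
    conv_rhs => rw [← subst_var (δ.map x)]
    refine subst_eq_subst_iff.2 fun y hy => Subst.map_eq_var fun hyd => ?_
    by_cases hxd : x ∈ δ.dom
    · exact hδ.fresh x hxd y hy (Or.inl (Or.inr hyd))
    · rw [Subst.map_eq_var hxd, mem_vars_var] at hy
      exact Set.disjoint_left.1 hdisj (Or.inr (hy ▸ hyd)) (Or.inl hx)
  change (δ.map x).subst ((I₁.sub.comp I₂.sub).comp ρ).map = _
  rw [Subst.subst_comp, Subst.subst_comp, hfix]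
  by_cases hxd : x ∈ δ.dom
  · have hfac := hδ.factors
    rw [← EqLit.subst_comp, ← EqLit.subst_comp] at hfac
    simp only [EqLit.subst, EqLit.mk.injEq, true_and, subst_eq_subst_iff] at hfac
    have hxfac := (hδ.dom x hxd).elim (hfac.1 x) (hfac.2 x)
    rwa [← Subst.subst_comp]
  · rw [Subst.map_eq_var hxd]
    exact (RewriteStep.ground_map hg hx).subst_eq _

theorem IsMGU.comp_eq_of_at? (hμ : IsMGU μ {(t, l)}) (ht : e.at? p = some t)
    (hl : (e.subst τ).at? p = some (l.subst τ.map)) : μ.comp τ = τ := by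
  refine hμ.comp_eq fun q hq => ?_
  rw [Set.mem_singleton_iff.1 hq]
  exact Option.some.inj ((EqLit.at?_subst ht τ).symm.trans hl)

theorem subst_rewrite_conclusion (hlit : I₁.lit = ⟨true, l, r⟩ ∨ I₁.lit = ⟨true, r, l⟩)
    (hp : (I₂.lit.subst I₂.sub).at? p = some (l.subst I₁.sub.map))
    (hτ : ∀ x ∈ Clause.vars I₁.clause, τ.map x = I₁.sub.map x)
    (he : e.subst τ = I₂.lit.subst I₂.sub)
    (hD : Clause.subst D τ = Clause.subst I₂.rest I₂.sub)
    (ht : e.at? p = some t) (hμ : IsMGU μ {(t, l)}) :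
    ((e.replace p r).subst μ).subst τ =
        (I₂.lit.subst I₂.sub).replace p (r.subst I₁.sub.map) ∧
      Clause.subst (Clause.subst I₁.rest μ + Clause.subst D μ) τ =
        Clause.subst I₁.rest I₁.sub + Clause.subst I₂.rest I₂.sub := by
  obtain ⟨hl, hr⟩ : l.subst τ.map = l.subst I₁.sub.map ∧ r.subst τ.map = r.subst I₁.sub.map := by
    have hlit' := RewriteStep.subst_lit_congr hτ
    rcases hlit with hlit | hlit <;>
      simp only [hlit, EqLit.subst, EqLit.mk.injEq, true_and] at hlit'
    exacts [hlit', hlit'.symm]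
  have hμτ : μ.comp τ = τ := hμ.comp_eq_of_at? ht (by rw [he, hp, hl])
  constructor
  · rw [← EqLit.subst_comp, hμτ, EqLit.replace_subst ht, he, hr]
  · rw [Clause.subst_add, ← Clause.subst_comp, ← Clause.subst_comp, hμτ, hD,
      RewriteStep.subst_rest_congr hτ]

namespace RewriteInference

theorem subst_conclusion (h : RewriteInference lt I₁ I₂ p e C σ)
    (hg₁ : Clause.Ground (Clause.subst I₁.clause I₁.sub))
    (hg₂ : Clause.Ground (Clause.subst I₂.clause I₂.sub)) :
    ∃ l r, I₁.lit.toLit.subst I₁.sub = ⟨true, s(l, r)⟩ ∧ lt r l ∧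
      (I₂.lit.subst I₂.sub).at? p = some l ∧
      e.subst σ = (I₂.lit.subst I₂.sub).replace p r ∧
      Clause.subst C σ = Clause.subst I₁.rest I₁.sub + Clause.subst I₂.rest I₂.sub := by
  have hinst {l r : Sg.Term V} (hlit : I₁.lit = ⟨true, l, r⟩ ∨ I₁.lit = ⟨true, r, l⟩) :
      I₁.lit.toLit.subst I₁.sub = ⟨true, s(l.subst I₁.sub.map, r.subst I₁.sub.map)⟩ := by
    rcases hlit with hlit | hlit <;> rw [hlit]
    · rfl
    · exact congrArg _ Sym2.eq_swap
  cases h with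
  | direct hdisj hlit hrl hp ht hμ =>
    have hσ₂ (x) (hx : x ∈ Clause.vars I₂.clause) : (I₁.sub.comp I₂.sub).map x = I₂.sub.map x :=
      Subst.comp_map_eq_right
        (fun hx₁ => Set.disjoint_left.1 hdisj (Or.inr hx₁) (Or.inl hx)) _
    exact ⟨_, _, hinst hlit, hrl, hp, subst_rewrite_conclusion hlit hp
      (fun x hx => RewriteStep.map_comp_eq hg₁ hx _) (RewriteStep.subst_lit_congr hσ₂)
      (RewriteStep.subst_rest_congr hσ₂) ht hμ⟩
  | belowVar hdisj hlit hrl hp _ hδ ht hμ =>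
    have hσ₂ (x) (hx : x ∈ Clause.vars I₂.clause) := hδ.map_eq hdisj hg₂ hx
    refine ⟨_, _, hinst hlit, hrl, hp, subst_rewrite_conclusion hlit hp
      (fun x hx => ?_) ?_ ?_ ht hμ⟩
    · rw [Subst.comp_assoc]
      exact RewriteStep.map_comp_eq hg₁ hx _
    · rw [← EqLit.subst_comp]
      exact RewriteStep.subst_lit_congr hσ₂
    · rw [← Clause.subst_comp]
      exact RewriteStep.subst_rest_congr hσ₂

theorem soundInstance (hlt : MonotonicOrdering lt) (h : RewriteInference lt I₁ I₂ p e C σ)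
    (h₁ : SoundInstance lt β Γ (I₁.lit.toLit.subst I₁.sub) (Clause.subst I₁.rest I₁.sub))
    (h₂ : SoundInstance lt β Γ (I₂.lit.toLit.subst I₂.sub) (Clause.subst I₂.rest I₂.sub)) :
    SoundInstance lt β Γ (e.toLit.subst σ) (Clause.subst C σ) := by
  obtain ⟨l, r, hlit, hrl, hp, he, hC⟩ := h.subst_conclusion
    (by rw [RewriteStep.clause, Clause.subst_cons]; exact h₁.ground)
    (by rw [RewriteStep.clause, Clause.subst_cons]; exact h₂.ground)
  rw [← EqLit.toLit_subst, he, hC]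
  rw [hlit] at h₁
  exact h₁.replace hlt h₂ hrl hp

end RewriteInference

theorem Literal.Ground.rename_conj (h : (L.subst σ).Ground) (π : Equiv.Perm V) :
    (L.rename π).subst (σ.conj π) = L.subst σ := by
  obtain ⟨b, s, t, rfl⟩ := L.exists_mk
  have hterm {u : Sg.Term V} (hu : TermGround (u.subst σ.map)) :
      (u.relabel π).subst (σ.conj π).map = u.subst σ.map := by
    rw [relabel_eq_subst, subst_subst, subst_eq_subst_iff]
    intro x hx
    change (σ.map (π.symm (π x))).relabel π = σ.map x
    rw [π.symm_apply_apply]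
    exact (termGround_subst.1 hu x hx).relabel_eq _
  obtain ⟨hs, ht⟩ := Literal.ground_mk.1 h
  rw [subst_mk, ← hterm hs, ← hterm ht]
  rfl

theorem Clause.Ground.rename_conj (h : Clause.Ground (Clause.subst C σ)) (π : Equiv.Perm V) :
    Clause.subst (Clause.rename C π) (σ.conj π) = Clause.subst C σ := by
  simp only [Clause.rename, Clause.subst, Multiset.map_map]
  exact Multiset.map_congr rfl fun K hK =>
    Literal.Ground.rename_conj (h _ (Multiset.mem_map_of_mem _ hK)) π

theorem IsReductionChain.soundInstance (hlt : MonotonicOrdering lt) {Θ : List (AnnLit Sg V)}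
    (hΘ : ∀ A ∈ Θ, SoundInstance lt β Γ A.ground (Clause.subst A.rest A.sub))
    (hP : IsReductionChain lt Θ P) (hI : I ∈ P) :
    SoundInstance lt β Γ (I.lit.toLit.subst I.sub) (Clause.subst I.rest I.sub) := by
  obtain ⟨i, hi⟩ := List.mem_iff_getElem?.1 hI
  clear hI
  induction i using Nat.strong_induction_on generalizing I with
  | _ i ih =>
    have hpre : ∀ R ∈ P.take i,
        SoundInstance lt β Γ (R.lit.toLit.subst R.sub) (Clause.subst R.rest R.sub) := by
      intro R hR
      obtain ⟨j, hj, rfl⟩ := List.mem_take_iff_getElem.1 hR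
      exact ih j (lt_min_iff.1 hj).1 (List.getElem?_eq_getElem _)
    rcases hP i I hi with ⟨A, hA, π, e, he, rfl⟩ | ⟨R, hR, S, hS, e, C, σ, p, rfl, h⟩
    · have hsound := hΘ A hA
      simp only [RewriteStep.lit, RewriteStep.rest, RewriteStep.sub, he]
      rw [hsound.litGround.rename_conj,
        Clause.Ground.rename_conj (Multiset.forall_mem_cons.1 hsound.ground).2]
      exact hsound
    · exact h.soundInstance hlt (hpre R hR) (hpre S hS)

/-! ### Reduction chain applications -/

/-- `K` arises from `L` by replacing both sides of `L` by normal forms. -/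
def IsLitNormalForm (R : Set (Sg.Term V × Sg.Term V)) (L K : Literal Sg V) : Prop :=
  ∃ b s t s' t', L = ⟨b, s(s, t)⟩ ∧ K = ⟨b, s(s', t')⟩ ∧ IsNormalForm R s s' ∧ IsNormalForm R t t'

namespace IsLitNormalForm

theorem litDefined_iff (h : IsLitNormalForm (conv lt Γ) L K) :
    LitDefined Γ L ↔ LitDefined Γ K := by
  obtain ⟨b, s, t, s', t', rfl, rfl, hs, ht⟩ := h
  exact litDefined_congr hs.eqIn ht.eqIn

theorem litIrreducible {R : Set (Sg.Term V × Sg.Term V)} (h : IsLitNormalForm R L K) :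
    LitIrreducible R K := by
  obtain ⟨b, s, t, s', t', rfl, rfl, hs, ht⟩ := h
  exact Sym2.ball.2 ⟨hs.2, ht.2⟩

theorem ground (h : IsLitNormalForm (conv lt Γ) L K) (hL : L.Ground) : K.Ground := by
  obtain ⟨b, s, t, s', t', rfl, rfl, hs, ht⟩ := h
  obtain ⟨hsg, htg⟩ := Literal.ground_mk.1 hL
  exact Literal.ground_mk.2 ⟨hs.termGround hsg, ht.termGround htg⟩

theorem litBelow (hlt : MonotonicOrdering lt) (h : IsLitNormalForm (conv lt Γ) L K)
    (hL : LitBelow lt β L) : LitBelow lt β K := by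
  obtain ⟨b, s, t, s', t', rfl, rfl, hs, ht⟩ := h
  obtain ⟨hsβ, htβ⟩ := litBelow_mk.1 hL
  exact litBelow_mk.2 ⟨hlt.lt_of_reflTransGen (hs.reflTransGen hlt) hsβ,
    hlt.lt_of_reflTransGen (ht.reflTransGen hlt) htβ⟩

end IsLitNormalForm

theorem IsReductionChainApplication.isLitNormalForm {Θ : List (AnnLit Sg V)} {A : AnnLit Sg V}
    (hP : IsReductionChainApplication lt Θ A P) (hI : P.getLast? = some I) :
    IsLitNormalForm (conv lt (lits Θ)) A.ground (I.lit.toLit.subst I.sub) := by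
  obtain ⟨⟨-, J, hJ, s, t, hA, hs, ht⟩, -⟩ := hP
  obtain rfl : J = I := Option.some.inj (hJ.symm.trans hI)
  exact ⟨_, s, t, _, _, hA, rfl, hs, ht⟩

theorem Literal.rename_one (L : Literal Sg V) : L.rename 1 = L := by
  obtain ⟨b, s, t, rfl⟩ := L.exists_mk
  exact congrArg (Literal.mk b) (congrArg₂ (fun s t => s(s, t)) s.relabel_id t.relabel_id)

theorem Clause.rename_one (C : Clause Sg V) : Clause.rename C 1 = C :=
  (Multiset.map_congr rfl fun L _ => L.rename_one).trans (Multiset.map_id C)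

theorem isReductionChainApplication_singleton {Θ : List (AnnLit Sg V)} (k : ℕ)
    (h : LitIrreducible (conv lt (lits Θ)) (e.toLit.subst σ)) :
    IsReductionChainApplication lt Θ ⟨k, e.toLit, C, σ⟩ [.base e C σ] := by
  refine ⟨⟨fun i I hI => Or.inl ⟨_, List.mem_append_right _ (List.mem_singleton_self _), 1, e,
    (Literal.rename_one _).symm, ?_⟩, _, rfl, _, _, rfl,
    ⟨.refl, h _ (Sym2.mem_mk_left _ _)⟩, ⟨.refl, h _ (Sym2.mem_mk_right _ _)⟩⟩, ?_⟩
  · rw [Clause.rename_one, Subst.conj_one]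
    exact List.mem_singleton.1 (List.mem_of_getElem? hI)
  · intro i hi
    obtain rfl : i = 0 := by simpa using hi
    rintro ⟨-, I, hI, -⟩
    simp at hI

end Chains

section Trails

variable {Sg : FirstOrder.Language.{u, v}} {V : Type w} {lt : Sg.Term V → Sg.Term V → Prop}
  {β : Sg.Term V} {L K : Literal Sg V} {Γ Δ : List (AnnLit Sg V)} {A : AnnLit Sg V} {i j m : ℕ}

/-! ### Defining literals -/

theorem lits_append (Γ Δ : List (AnnLit Sg V)) : lits (Γ ++ Δ) = lits Γ ++ lits Δ :=
  List.map_append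

theorem lits_take_subset_lits_take {n : ℕ} (h : m ≤ n) : lits (Γ.take m) ⊆ lits (Γ.take n) :=
  List.map_subset _ (List.take_subset_take_left Γ h)

theorem lits_take_subset (Γ : List (AnnLit Sg V)) (m : ℕ) : lits (Γ.take m) ⊆ lits Γ :=
  List.map_subset _ (List.take_subset _ _)

theorem ground_mem_lits (h : Γ[i]? = some A) : A.ground ∈ lits Γ :=
  List.mem_map_of_mem (List.mem_of_getElem? h)

theorem ground_mem_lits_take (h : Γ[i]? = some A) (him : i < m) : A.ground ∈ lits (Γ.take m) :=
  ground_mem_lits (i := i) (by rw [List.getElem?_take, if_pos him, h])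

theorem IsTrailLit.mem (h : IsTrailLit Γ i L) : L ∈ lits Γ := by
  obtain ⟨A, hA, rfl⟩ := h
  exact ground_mem_lits hA

theorem sublits_range (Γ : List (AnnLit Sg V)) (m : ℕ) :
    sublits Γ (Finset.range m) = units (lits (Γ.take m)) := by
  ext D
  constructor
  · rintro ⟨i, hi, A, hA, rfl⟩
    exact ⟨A.ground, ground_mem_lits_take hA (Finset.mem_range.1 hi), rfl⟩
  · rintro ⟨L, hL, rfl⟩
    obtain ⟨A, hA, rfl⟩ := List.mem_map.1 hL
    obtain ⟨i, hi⟩ := List.mem_iff_getElem?.1 hA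
    rw [List.getElem?_take, Option.ite_none_right_eq_some] at hi
    exact ⟨i, Finset.mem_range.2 hi.1, A, hi.2, rfl⟩

theorem definedBy_range_iff :
    DefinedBy Γ (Finset.range m) L ↔ LitDefined (lits (Γ.take m)) L := by
  rw [DefinedBy, sublits_range]
  rfl

theorem DefinedBy.mono {I J : Finset ℕ} (hIJ : I ⊆ J) (h : DefinedBy Γ I L) :
    DefinedBy Γ J L := by
  have hsub : sublits Γ I ⊆ sublits Γ J := fun D ⟨i, hi, h⟩ => ⟨i, hIJ hi, h⟩
  exact h.imp (.mono hsub) (.mono hsub)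

theorem DefinedBy.litDefined_take (h : DefinedBy Γ ∅ L) (m : ℕ) :
    LitDefined (lits (Γ.take m)) L :=
  definedBy_range_iff.1 (h.mono (Finset.empty_subset _))

theorem LitDefined.exists_core (h : LitDefined (lits (Γ.take m)) L) :
    ∃ J ⊆ Finset.range m, IsCore Γ L J := by
  have hd : DefinedBy Γ (Finset.range (min m Γ.length)) L := by
    rwa [definedBy_range_iff, ← List.take_take, List.take_length]
  obtain ⟨J, hJ, hmin⟩ := exists_minimal_le_of_wellFoundedLT (DefinedBy Γ · L) _ hd
  exact ⟨J, hJ.trans (Finset.range_subset_range.2 (min_le_left _ _)),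
    hJ.trans (Finset.range_subset_range.2 (min_le_right _ _)), hmin.prop,
    fun _ hI => hmin.not_prop_of_lt hI⟩

theorem LitDefined.exists_isDefining (h : LitDefined (lits Γ) L) (h0 : ¬ DefinedBy Γ ∅ L) :
    ∃ i, IsDefining Γ L i := by
  classical
  obtain ⟨J, -, hJ⟩ := LitDefined.exists_core (Γ := Γ) (m := Γ.length) (by rwa [List.take_length])
  have hne : J.Nonempty := Finset.nonempty_iff_ne_empty.2 fun h => h0 (h ▸ hJ.2.1)
  have hex : ∃ j I, IsCore Γ L I ∧ IsGreatest (I : Set ℕ) j := ⟨_, J, hJ, J.isGreatest_max' hne⟩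
  exact ⟨Nat.find hex, Nat.find_spec hex, fun J hJ j hj => Nat.find_min' hex ⟨J, hJ, hj⟩⟩

theorem IsDefining.lt_length (h : IsDefining Γ L i) : i < Γ.length := by
  obtain ⟨⟨I, hI, hi⟩, -⟩ := h
  exact Finset.mem_range.1 (hI.1 hi.1)

theorem IsDefining.litDefined_take_iff (h : IsDefining Γ L i) (m : ℕ) :
    LitDefined (lits (Γ.take m)) L ↔ i < m := by
  obtain ⟨⟨I, hI, hi⟩, hleast⟩ := h
  constructor
  · intro hd
    obtain ⟨J, hJ, hc⟩ := hd.exists_core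
    have hne : J.Nonempty := by
      by_contra h
      rw [Finset.not_nonempty_iff_eq_empty] at h
      subst h
      exact hI.2.2 ∅ (Finset.empty_ssubset.2 ⟨i, hi.1⟩) hc.2.1
    exact (hleast J hc _ (J.isGreatest_max' hne)).trans_lt
      (Finset.mem_range.1 (hJ (J.max'_mem hne)))
  · exact fun him => definedBy_range_iff.1
      (hI.2.1.mono fun j hj => Finset.mem_range.2 ((hi.2 hj).trans_lt him))

/-- The literal of `Γ` with index `i` makes `L` defined: it is `L`, its complement or the defining
literal of `L`. -/
def DefinesAt (Γ : List (AnnLit Sg V)) (L : Literal Sg V) (i : ℕ) : Prop :=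
  (IsTrailLit Γ i L ∨ IsTrailLit Γ i L.comp) ∨ IsDefining Γ L i

theorem IsTrail.litDefined_take_ground_iff (hΓ : IsTrail lt Γ) (hA : Γ[i]? = some A) (m : ℕ) :
    LitDefined (lits (Γ.take m)) A.ground ↔ i < m := by
  constructor
  · intro hd
    by_contra hm
    exact hΓ.undefined i A hA (hd.mono (lits_take_subset_lits_take (not_lt.1 hm)))
  · exact fun him => Or.inl (.of_mem (ground_mem_lits_take hA him))

theorem DefinesAt.litDefined_take_iff (hΓ : IsTrail lt Γ) (h : DefinesAt Γ L i) (m : ℕ) :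
    LitDefined (lits (Γ.take m)) L ↔ i < m := by
  rcases h with (⟨A, hA, rfl⟩ | ⟨A, hA, e⟩) | h
  · exact hΓ.litDefined_take_ground_iff hA m
  · rw [← litDefined_comp, ← e]
    exact hΓ.litDefined_take_ground_iff hA m
  · exact h.litDefined_take_iff m

theorem DefinesAt.lt_length (h : DefinesAt Γ L i) : i < Γ.length := by
  rcases h with (⟨A, hA, -⟩ | ⟨A, hA, -⟩) | h
  · exact (List.getElem?_eq_some_iff.1 hA).1
  · exact (List.getElem?_eq_some_iff.1 hA).1
  · exact h.lt_length

theorem DefinesAt.unique (hΓ : IsTrail lt Γ) (hi : DefinesAt Γ L i) (hj : DefinesAt Γ L j) :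
    i = j :=
  eq_of_forall_gt_iff fun m =>
    (hi.litDefined_take_iff hΓ m).symm.trans (hj.litDefined_take_iff hΓ m)

/-! ### Levels -/

theorem LitDefined.litLevel_eq (h : LitDefined (lits Γ) L) :
    (∃ i A, Γ[i]? = some A ∧ DefinesAt Γ L i ∧ litLevel Γ L = A.level) ∨
      (DefinedBy Γ ∅ L ∧ litLevel Γ L = 0) := by
  unfold litLevel
  split
  · next A hA =>
    obtain ⟨i, hi⟩ := List.mem_iff_getElem?.1 (List.mem_of_find?_eq_some hA)
    exact Or.inl ⟨i, A, hi, Or.inl (Or.inl ⟨A, hi, by simpa using List.find?_some hA⟩), rfl⟩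
  · split
    · next hd =>
      exact Or.inl ⟨hd.choose, hd.choose_spec.choose, hd.choose_spec.choose_spec.1,
        Or.inr hd.choose_spec.choose_spec.2, rfl⟩
    · next hd =>
      refine Or.inr ⟨by_contra fun h0 => ?_, rfl⟩
      obtain ⟨i, hi⟩ := h.exists_isDefining h0
      exact hd ⟨i, _, List.getElem?_eq_getElem hi.lt_length, hi⟩

theorem LitDefined.exists_definesAt (h : LitDefined (lits Γ) L) (hl : 0 < litLevel Γ L) :
    ∃ i A, Γ[i]? = some A ∧ DefinesAt Γ L i ∧ litLevel Γ L = A.level :=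
  h.litLevel_eq.resolve_right fun h0 => hl.ne' h0.2

theorem LitDefined.take_of_level (hΓ : IsTrail lt Γ) (h : LitDefined (lits Γ) L)
    (hm : ∀ i A, Γ[i]? = some A → A.level = litLevel Γ L → i < m) :
    LitDefined (lits (Γ.take m)) L := by
  rcases h.litLevel_eq with ⟨i, A, hA, hi, hl⟩ | ⟨h0, -⟩
  · exact (hi.litDefined_take_iff hΓ m).2 (hm i A hA hl.symm)
  · exact h0.litDefined_take m

theorem DefinesAt.litLevel_eq (hΓ : IsTrail lt Γ) (hA : Γ[i]? = some A) (h : DefinesAt Γ L i) :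
    litLevel Γ L = A.level := by
  have hd : LitDefined (lits Γ) L := by
    simpa using (h.litDefined_take_iff hΓ Γ.length).2 h.lt_length
  rcases hd.litLevel_eq with ⟨j, B, hB, hj, hl⟩ | ⟨h0, -⟩
  · obtain rfl := hj.unique hΓ h
    rw [hl, Option.some.inj (hB.symm.trans hA)]
  · exact absurd ((h.litDefined_take_iff hΓ i).1 (h0.litDefined_take i)) (lt_irrefl i)

theorem definesAt_ground (hA : Γ[i]? = some A) : DefinesAt Γ A.ground i :=
  Or.inl (Or.inl ⟨A, hA, rfl⟩)

theorem definesAt_ground_comp (hA : Γ[i]? = some A) : DefinesAt Γ A.ground.comp i :=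
  Or.inl (Or.inr ⟨A, hA, (Literal.comp_comp _).symm⟩)

/-! ### The trail induced ordering -/

theorem wellFounded_mulExt {α : Type*} {r : α → α → Prop} (h : WellFounded r) :
    WellFounded (MulExt r) := by
  have : IsWellFounded α r := ⟨h⟩
  refine Subrelation.wf ?_ (InvImage.wf (Multiset.map (IsWellFounded.rank r))
    Multiset.wellFounded_isDershowitzMannaLT)
  rintro M N ⟨X, Y, Z, hZ, rfl, rfl, hY⟩
  refine ⟨X.map (IsWellFounded.rank r), Y.map (IsWellFounded.rank r), Z.map (IsWellFounded.rank r),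
    by simpa using hZ, Multiset.map_add _ _ _, Multiset.map_add _ _ _, fun y hy => ?_⟩
  obtain ⟨a, ha, rfl⟩ := Multiset.mem_map.1 hy
  obtain ⟨b, hb, hab⟩ := hY a ha
  exact ⟨_, Multiset.mem_map.2 ⟨b, hb, rfl⟩, IsWellFounded.rank_lt_of_rel hab⟩

theorem wellFounded_litLT (h : WellFounded lt) : WellFounded (LitLT lt) :=
  InvImage.wf Literal.terms (wellFounded_mulExt h)

open Classical in
/-- The block of the trail induced ordering that `L` belongs to: `(0, 0)` for level zero,
`(i + 1, 0)`, `(i + 1, 1)` and `(i + 1, 2)` for `L_i`, its complement and the other literals that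
`L_i` defines, and `(|Γ| + 1, 0)` for the `β`-undefined literals. Within a block literals are
compared by the term ordering. -/
noncomputable def trailRank (lt : Sg.Term V → Sg.Term V → Prop) (β : Sg.Term V)
    (Γ : List (AnnLit Sg V)) (L : Literal Sg V) : ℕ ×ₗ ℕ :=
  if ¬ BetaDefined lt β (lits Γ) L then toLex (Γ.length + 1, 0)
  else if litLevel Γ L = 0 then toLex (0, 0)
  else toLex (sInf {m | LitDefined (lits (Γ.take m)) L},
    if L ∈ lits Γ then 0 else if L.comp ∈ lits Γ then 1 else 2)

theorem trailRank_of_not_betaDefined (h : ¬ BetaDefined lt β (lits Γ) L) :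
    trailRank lt β Γ L = toLex (Γ.length + 1, 0) :=
  if_pos h

theorem trailRank_of_litLevel_eq_zero (h : BetaDefined lt β (lits Γ) L) (h0 : litLevel Γ L = 0) :
    trailRank lt β Γ L = toLex (0, 0) := by
  rw [trailRank, if_neg (not_not.2 h), if_pos h0]

open Classical in
theorem DefinesAt.trailRank_eq (hΓ : IsTrail lt Γ) (hi : DefinesAt Γ L i) (h : LitBelow lt β L)
    (h0 : 0 < litLevel Γ L) :
    trailRank lt β Γ L =
      toLex (i + 1, if L ∈ lits Γ then 0 else if L.comp ∈ lits Γ then 1 else 2) := by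
  have hset : {m | LitDefined (lits (Γ.take m)) L} = Set.Ici (i + 1) :=
    Set.ext fun m => hi.litDefined_take_iff hΓ m
  have hd : LitDefined (lits Γ) L := by
    simpa using (hi.litDefined_take_iff hΓ Γ.length).2 hi.lt_length
  rw [trailRank, if_neg (not_not.2 ⟨h, hd⟩), if_neg h0.ne', hset, csInf_Ici]

theorem trailRank_cases (hΓ : IsTrail lt Γ) (L : Literal Sg V) :
    (¬ BetaDefined lt β (lits Γ) L ∧ trailRank lt β Γ L = toLex (Γ.length + 1, 0)) ∨
      (BetaDefined lt β (lits Γ) L ∧ litLevel Γ L = 0 ∧ trailRank lt β Γ L = toLex (0, 0)) ∨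
      ∃ i k, BetaDefined lt β (lits Γ) L ∧ 0 < litLevel Γ L ∧ DefinesAt Γ L i ∧
        trailRank lt β Γ L = toLex (i + 1, k) := by
  by_cases h : BetaDefined lt β (lits Γ) L
  · rcases Nat.eq_zero_or_pos (litLevel Γ L) with h0 | h0
    · exact Or.inr (Or.inl ⟨h, h0, trailRank_of_litLevel_eq_zero h h0⟩)
    · obtain ⟨i, -, -, hi, -⟩ := h.2.exists_definesAt h0
      exact Or.inr (Or.inr ⟨i, _, h, h0, hi, hi.trailRank_eq hΓ h.1 h0⟩)
  · exact Or.inl ⟨h, trailRank_of_not_betaDefined h⟩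

namespace PosLevel

theorem trailRank_of_isTrailLit (hΓ : IsTrail lt Γ) (h : PosLevel lt β Γ L)
    (hi : IsTrailLit Γ i L) : trailRank lt β Γ L = toLex (i + 1, 0) := by
  rw [DefinesAt.trailRank_eq hΓ (Or.inl (Or.inl hi)) h.2.1.1 h.2.2, if_pos hi.mem]

theorem trailRank_of_isTrailLit_comp (hΓ : IsTrail lt Γ) (h : PosLevel lt β Γ L)
    (hi : IsTrailLit Γ i L.comp) : trailRank lt β Γ L = toLex (i + 1, 1) := by
  have hL : L ∉ lits Γ := fun hL => hΓ.consistent.comp_notMem hL hi.mem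
  rw [DefinesAt.trailRank_eq hΓ (Or.inl (Or.inr hi)) h.2.1.1 h.2.2, if_neg hL, if_pos hi.mem]

theorem trailRank_of_isOther (hΓ : IsTrail lt Γ) (h : PosLevel lt β Γ L)
    (hi : IsOther lt β Γ i L) : trailRank lt β Γ L = toLex (i + 1, 2) := by
  rw [DefinesAt.trailRank_eq hΓ (Or.inr hi.2.2.2.2) h.2.1.1 h.2.2, if_neg hi.2.2.1,
    if_neg hi.2.2.2.1]

end PosLevel

theorem TrailLT.trailRank_lt_or_eq (hΓ : IsTrail lt Γ) (h : TrailLT lt β Γ L K) :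
    trailRank lt β Γ L < trailRank lt β Γ K ∨
      trailRank lt β Γ L = trailRank lt β Γ K ∧ LitLT lt L K := by
  cases h with
  | other_other hL hK hi hj hij =>
    rw [hL.trailRank_of_isOther hΓ hi, hK.trailRank_of_isOther hΓ hj]
    rcases hij with hij | ⟨rfl, hLK⟩
    · exact Or.inl (Prod.Lex.toLex_lt_toLex.2 (Or.inl (Nat.succ_lt_succ hij)))
    · exact Or.inr ⟨rfl, hLK⟩
  | lit_lit hL hK hi hj hij =>
    rw [hL.trailRank_of_isTrailLit hΓ hi, hK.trailRank_of_isTrailLit hΓ hj]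
    simpa [Prod.Lex.toLex_lt_toLex] using Or.inl hij
  | comp_lit hL hK hi hj hij =>
    rw [hL.trailRank_of_isTrailLit_comp hΓ hi, hK.trailRank_of_isTrailLit hΓ hj]
    simpa [Prod.Lex.toLex_lt_toLex] using hij
  | lit_comp hL hK hi hj hij =>
    rw [hL.trailRank_of_isTrailLit hΓ hi, hK.trailRank_of_isTrailLit_comp hΓ hj]
    simpa [Prod.Lex.toLex_lt_toLex] using hij.lt_or_eq
  | comp_comp hL hK hi hj hij =>
    rw [hL.trailRank_of_isTrailLit_comp hΓ hi, hK.trailRank_of_isTrailLit_comp hΓ hj]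
    simpa [Prod.Lex.toLex_lt_toLex] using Or.inl hij
  | trail_other hL hK hi hj hij =>
    rw [hK.trailRank_of_isOther hΓ hj]
    rcases hi with hi | hi
    on_goal 1 => rw [hL.trailRank_of_isTrailLit hΓ hi]
    on_goal 2 => rw [hL.trailRank_of_isTrailLit_comp hΓ hi]
    all_goals simpa [Prod.Lex.toLex_lt_toLex] using hij.lt_or_eq
  | other_trail hL hK hi hj hij =>
    rw [hL.trailRank_of_isOther hΓ hi]
    rcases hj with hj | hj
    on_goal 1 => rw [hK.trailRank_of_isTrailLit hΓ hj]
    on_goal 2 => rw [hK.trailRank_of_isTrailLit_comp hΓ hj]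
    all_goals simpa [Prod.Lex.toLex_lt_toLex] using hij
  | zero_zero hL hK h =>
    rw [trailRank_of_litLevel_eq_zero hL.2.1 hL.2.2, trailRank_of_litLevel_eq_zero hK.2.1 hK.2.2]
    exact Or.inr ⟨rfl, h⟩
  | zero_pos hL hK =>
    obtain ⟨j, -, -, hj, -⟩ := hK.2.1.2.exists_definesAt hK.2.2
    rw [trailRank_of_litLevel_eq_zero hL.2.1 hL.2.2, hj.trailRank_eq hΓ hK.2.1.1 hK.2.2]
    simp [Prod.Lex.toLex_lt_toLex]
  | undef_undef _ _ hL hK h =>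
    exact Or.inr ⟨(trailRank_of_not_betaDefined hL).trans (trailRank_of_not_betaDefined hK).symm, h⟩
  | def_undef _ _ hL hK =>
    rw [trailRank_of_not_betaDefined hK]
    rcases trailRank_cases hΓ L with ⟨h, -⟩ | ⟨-, -, h⟩ | ⟨i, k, -, -, hi, h⟩
    · exact absurd hL h
    · simp [h, Prod.Lex.toLex_lt_toLex]
    · simpa [h, Prod.Lex.toLex_lt_toLex] using Or.inl hi.lt_length

theorem wellFounded_trailLT (hlt : WellFounded lt) (hΓ : IsTrail lt Γ) :
    WellFounded (TrailLT lt β Γ) := by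
  refine Subrelation.wf (fun {L K} h => ?_) (InvImage.wf (fun L => (trailRank lt β Γ L, L))
    (wellFounded_lt.prod_lex (wellFounded_litLT hlt)))
  exact Prod.lex_def.2 (h.trailRank_lt_or_eq hΓ)

/-! ### Literals below a literal of the trail -/

/-- All literals of level zero are among the first `m` literals of `Γ`. -/
def ZeroBefore (Γ : List (AnnLit Sg V)) (m : ℕ) : Prop :=
  ∀ i A, Γ[i]? = some A → A.level = 0 → i < m

theorem ZeroBefore.level_pos (hm : ZeroBefore Γ m) (hA : Γ[m]? = some A) : 0 < A.level :=
  Nat.pos_of_ne_zero fun h0 => lt_irrefl m (hm m A hA h0)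

theorem betaDefined_take_iff (hΓ : IsTrail lt Γ) (hm : ZeroBefore Γ m) (hml : m ≤ Γ.length) :
    BetaDefined lt β (lits (Γ.take m)) L ↔ (ofLex (trailRank lt β Γ L)).1 ≤ m := by
  rcases trailRank_cases (β := β) hΓ L with ⟨hL, e⟩ | ⟨hL, h0, e⟩ | ⟨i, k, hL, -, hi, e⟩ <;>
    rw [e, ofLex_toLex]
  · exact iff_of_false (fun h => hL ⟨h.1, h.2.mono (lits_take_subset Γ m)⟩)
      (Nat.not_le.2 (Nat.lt_succ_of_le hml))
  · exact iff_of_true ⟨hL.1, hL.2.take_of_level hΓ fun i A hA hl => hm i A hA (hl.trans h0)⟩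
      (Nat.zero_le m)
  · rw [BetaDefined, and_iff_right hL.1]
    exact hi.litDefined_take_iff hΓ m

theorem TrailLT.betaDefined_take (hΓ : IsTrail lt Γ) (hm : ZeroBefore Γ m) (hml : m ≤ Γ.length)
    (h : TrailLT lt β Γ L K) (hK : BetaDefined lt β (lits (Γ.take m)) K) :
    BetaDefined lt β (lits (Γ.take m)) L := by
  have hle : trailRank lt β Γ L ≤ trailRank lt β Γ K :=
    (h.trailRank_lt_or_eq hΓ).elim le_of_lt fun h => h.1.le
  rw [betaDefined_take_iff hΓ hm hml] at hK ⊢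
  exact (Prod.Lex.monotone_fst _ _ hle).trans hK

theorem exists_isTrailLit (h : L ∈ lits Γ) : ∃ i, IsTrailLit Γ i L := by
  obtain ⟨A, hA, rfl⟩ := List.mem_map.1 h
  obtain ⟨i, hi⟩ := List.mem_iff_getElem?.1 hA
  exact ⟨i, A, hi, rfl⟩

theorem IsTrailLit.eq_ground (h : IsTrailLit Γ m L) (hA : Γ[m]? = some A) : L = A.ground := by
  obtain ⟨B, hB, rfl⟩ := h
  rw [Option.some.inj (hA.symm.trans hB)]

theorem isTrailLit_of_trailRank_eq {k : ℕ} (hΓ : IsTrail lt Γ) (hm : m < Γ.length)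
    (h : trailRank lt β Γ L = toLex (m + 1, k)) :
    (k = 0 → IsTrailLit Γ m L) ∧ (k = 1 → IsTrailLit Γ m L.comp) := by
  rcases trailRank_cases (β := β) hΓ L with ⟨-, e⟩ | ⟨-, -, e⟩ | ⟨i, -, hL, h0, hi, -⟩
  · rw [e, toLex_inj, Prod.mk.injEq] at h
    omega
  · rw [e, toLex_inj, Prod.mk.injEq] at h
    omega
  · rw [hi.trailRank_eq hΓ hL.1 h0, toLex_inj, Prod.mk.injEq] at h
    obtain ⟨him, hk⟩ := h
    obtain rfl : i = m := Nat.succ.inj him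
    split_ifs at hk with h1 h2
    · obtain ⟨j, hj⟩ := exists_isTrailLit h1
      obtain rfl := hi.unique hΓ (Or.inl (Or.inl hj))
      exact ⟨fun _ => hj, by omega⟩
    · obtain ⟨j, hj⟩ := exists_isTrailLit h2
      obtain rfl := hi.unique hΓ (Or.inl (Or.inr hj))
      exact ⟨by omega, fun _ => hj⟩
    · exact ⟨by omega, by omega⟩

theorem trailRank_ground (hΓ : IsTrail lt Γ) (hm : ZeroBefore Γ m) (hA : Γ[m]? = some A)
    (hβ : LitBelow lt β A.ground) : trailRank lt β Γ A.ground = toLex (m + 1, 0) := by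
  have hi := definesAt_ground hA
  have h0 : 0 < litLevel Γ A.ground := (hi.litLevel_eq hΓ hA).symm ▸ hm.level_pos hA
  rw [hi.trailRank_eq hΓ hβ h0, if_pos (ground_mem_lits hA)]

theorem trailRank_ground_comp (hΓ : IsTrail lt Γ) (hm : ZeroBefore Γ m) (hA : Γ[m]? = some A)
    (hβ : LitBelow lt β A.ground) : trailRank lt β Γ A.ground.comp = toLex (m + 1, 1) := by
  have hi := definesAt_ground_comp hA
  have h0 : 0 < litLevel Γ A.ground.comp := (hi.litLevel_eq hΓ hA).symm ▸ hm.level_pos hA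
  have hmem := ground_mem_lits hA
  rw [hi.trailRank_eq hΓ (litBelow_comp.2 hβ) h0, if_neg (hΓ.consistent.comp_notMem hmem),
    Literal.comp_comp, if_pos hmem]

theorem TrailLT.betaDefined_take_of_ground (hlt : WellFounded lt) (hΓ : IsTrail lt Γ)
    (hm : ZeroBefore Γ m) (hA : Γ[m]? = some A) (hβ : LitBelow lt β A.ground)
    (h : TrailLT lt β Γ L A.ground) : BetaDefined lt β (lits (Γ.take m)) L := by
  have hml : m < Γ.length := (List.getElem?_eq_some_iff.1 hA).1
  rw [betaDefined_take_iff hΓ hm hml.le]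
  have hr := h.trailRank_lt_or_eq hΓ
  rw [trailRank_ground hΓ hm hA hβ] at hr
  rcases hr with hr | ⟨hr, -⟩
  · exact ((Prod.Lex.lt_iff.1 hr).elim Nat.le_of_lt_succ fun h => absurd h.2 (Nat.not_lt_zero _))
  · rw [((isTrailLit_of_trailRank_eq hΓ hml hr).1 rfl).eq_ground hA] at h
    exact absurd h ((wellFounded_trailLT hlt hΓ).irrefl.irrefl _)

theorem TrailLT.betaDefined_take_or_eq_of_comp (hlt : WellFounded lt) (hΓ : IsTrail lt Γ)
    (hm : ZeroBefore Γ m) (hA : Γ[m]? = some A) (hβ : LitBelow lt β A.ground)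
    (h : TrailLT lt β Γ L A.ground.comp) :
    BetaDefined lt β (lits (Γ.take m)) L ∨ L = A.ground := by
  have hml : m < Γ.length := (List.getElem?_eq_some_iff.1 hA).1
  rw [betaDefined_take_iff hΓ hm hml.le]
  have hr := h.trailRank_lt_or_eq hΓ
  rw [trailRank_ground_comp hΓ hm hA hβ] at hr
  rcases hr with hr | ⟨hr, -⟩
  · refine (Prod.Lex.lt_iff.1 hr).imp Nat.le_of_lt_succ fun ⟨h1, h2⟩ => ?_
    have hr' : trailRank lt β Γ L = toLex (m + 1, 0) := Prod.ext h1 (Nat.lt_one_iff.1 h2)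
    exact ((isTrailLit_of_trailRank_eq hΓ hml hr').1 rfl).eq_ground hA
  · have hL := ((isTrailLit_of_trailRank_eq hΓ hml hr).2 rfl).eq_ground hA
    rw [← hL, Literal.comp_comp] at h
    exact absurd h ((wellFounded_trailLT hlt hΓ).irrefl.irrefl _)

end Trails

section Redundancy

variable {Sg : FirstOrder.Language.{u, v}} {V : Type w} {lt : Sg.Term V → Sg.Term V → Prop}
  {β : Sg.Term V} {B : Literal Sg V} {C D E R : Clause Sg V} {N : Set (Clause Sg V)}
  {δ : Subst Sg V} {Γ Δ : List (AnnLit Sg V)} {A A' : AnnLit Sg V} {i j m : ℕ}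

/-! ### Clauses that are smaller than a false clause -/

theorem MulExt.forall_mem {α : Type*} {r : α → α → Prop} {p : α → Prop} {M N : Multiset α}
    (h : MulExt r M N) (hN : ∀ a ∈ N, p a) (hp : ∀ a ∈ M, ∀ b ∈ N, r a b → p a) :
    ∀ a ∈ M, p a := by
  obtain ⟨X, Y, Z, -, rfl, rfl, hY⟩ := h
  intro a ha
  rcases Multiset.mem_add.1 ha with haX | haY
  · exact hN a (Multiset.mem_add.2 (Or.inl haX))
  · obtain ⟨b, hb, hab⟩ := hY a haY
    exact hp a ha b (Multiset.mem_add.2 (Or.inr hb)) hab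

theorem MulExt.forall_mem_or_cons {α : Type*} {r : α → α → Prop} {p : α → Prop}
    {M N : Multiset α} {c : α} (h : MulExt r M (c ::ₘ N)) (hN : ∀ a ∈ N, p a)
    (hp : ∀ a ∈ M, ∀ b ∈ c ::ₘ N, r a b → p a) :
    (∀ a ∈ M, p a) ∨ ∃ M', M = c ::ₘ M' ∧ ∀ a ∈ M', p a := by
  obtain ⟨X, Y, Z, -, rfl, hXZ, hY⟩ := h
  have hpY : ∀ a ∈ Y, p a := fun a ha => by
    obtain ⟨b, hb, hab⟩ := hY a ha
    exact hp a (Multiset.mem_add.2 (Or.inr ha)) b (hXZ ▸ Multiset.mem_add.2 (Or.inr hb)) hab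
  by_cases hc : c ∈ X
  · obtain ⟨X', rfl⟩ := Multiset.exists_cons_of_mem hc
    rw [Multiset.cons_add, Multiset.cons_inj_right] at hXZ
    refine Or.inr ⟨X' + Y, Multiset.cons_add _ _ _, fun a ha => ?_⟩
    exact (Multiset.mem_add.1 ha).elim
      (fun haX => hN a (hXZ ▸ Multiset.mem_add.2 (Or.inl haX))) (hpY a)
  · refine Or.inl fun a ha => (Multiset.mem_add.1 ha).elim (fun haX => ?_) (hpY a)
    have ha' : a ∈ c ::ₘ N := hXZ ▸ Multiset.mem_add.2 (Or.inl haX)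
    exact hN a ((Multiset.mem_cons.1 ha').resolve_left fun e => hc (e ▸ haX))

theorem clauseBetaFalse_iff {Γ : List (Literal Sg V)} :
    ClauseBetaFalse lt β Γ C ↔ ∀ L ∈ C, LitBelow lt β L ∧ LitFalse Γ L := by
  rw [ClauseBetaFalse, clauseBelow_iff]
  exact forall₂_and.symm

theorem ClauseBetaFalse.mono {Γ Δ : List (Literal Sg V)} (hΓ : Γ ⊆ Δ)
    (h : ClauseBetaFalse lt β Γ C) : ClauseBetaFalse lt β Δ C :=
  ⟨h.1, fun L hL => (h.2 L hL).mono hΓ⟩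

theorem ClauseBetaFalse.of_subset {Γ : List (Literal Sg V)} (hD : D ⊆ C)
    (h : ClauseBetaFalse lt β Γ C) : ClauseBetaFalse lt β Γ D :=
  clauseBetaFalse_iff.2 fun L hL => clauseBetaFalse_iff.1 h L (hD hL)

/-- No ground instance of a clause of `N` is `β`-false in `Γ`, so that Conflict is not
applicable. -/
def NoConflict (lt : Sg.Term V → Sg.Term V → Prop) (β : Sg.Term V) (Γ : List (Literal Sg V))
    (N : Set (Clause Sg V)) : Prop :=
  ∀ D ∈ gnd N, ¬ ClauseBetaFalse lt β Γ D

theorem Entails.exists_not_holds (h : Entails N C) (M : Type (max u w)) [Nonempty M]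
    [Sg.Structure M] {ν : V → M} (hC : ∀ L ∈ C, ¬ L.Holds ν) :
    ∃ D ∈ N, ∃ ν : V → M, ∀ L ∈ D, ¬ L.Holds ν := by
  by_contra! hN
  obtain ⟨L, hL, hν⟩ := h M hN ν
  exact hC L hL hν

theorem BetaDefined.false_of_not_holds {Γ : List (Literal Sg V)} {L : Literal Sg V}
    (h : BetaDefined lt β Γ L) {M : Type (max u w)} [Nonempty M] [Sg.Structure M]
    (hM : Models M Γ) {ν : V → M} (hν : ¬ L.Holds ν) : LitBelow lt β L ∧ LitFalse Γ L :=
  ⟨h.1, h.2.false_of_not_holds hM hν⟩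

theorem TrailLT.betaDefined_take_of_false {L K : Literal Sg V} (hΓ : IsTrail lt Γ)
    (hm : ZeroBefore Γ m) (hml : m ≤ Γ.length) (hC : ClauseBetaFalse lt β (lits (Γ.take m)) C)
    (hK : K ∈ C) (h : TrailLT lt β Γ L K) : BetaDefined lt β (lits (Γ.take m)) L :=
  h.betaDefined_take hΓ hm hml ⟨(clauseBetaFalse_iff.1 hC K hK).1, Or.inr (hC.2 K hK)⟩

theorem not_groundRedundant_of_noConflict (hΓ : IsTrail lt Γ) (hm : ZeroBefore Γ m)
    (hml : m ≤ Γ.length) (hC : ClauseBetaFalse lt β (lits (Γ.take m)) C)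
    (hN : NoConflict lt β (lits (Γ.take m)) N) :
    ¬ GroundRedundant (TrailLT lt β Γ) (gnd N) C := by
  intro h
  obtain ⟨M, ⟨x⟩, _, hM⟩ :=
    consistent_iff_exists_model.1 (hΓ.consistent.mono (lits_take_subset Γ m))
  have : Nonempty M := ⟨x⟩
  obtain ⟨D, ⟨hD, hDC⟩, ν, hν⟩ := h.exists_not_holds M (ν := fun _ => x)
    fun L hL => litFalse_iff.1 (hC.2 L hL) M hM _
  refine hN D hD ?_
  rcases hDC with rfl | hDC
  · exact hC
  · exact clauseBetaFalse_iff.2 (hDC.forall_mem (clauseBetaFalse_iff.1 hC) fun L hL K hK hLK =>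
      (hLK.betaDefined_take_of_false hΓ hm hml hC hK).false_of_not_holds hM (hν L hL))

theorem GroundRedundant.exists_comp_cons_mem (hlt : WellFounded lt) (hΓ : IsTrail lt Γ)
    (hm : ZeroBefore Γ m) (hA : Γ[m]? = some A) (hβ : LitBelow lt β A.ground)
    (hR : ClauseBetaFalse lt β (lits (Γ.take m)) R) (hN : NoConflict lt β (lits (Γ.take m)) N)
    (h : GroundRedundant (TrailLT lt β Γ) (gnd N) (A.ground.comp ::ₘ R)) :
    ∃ D, A.ground.comp ::ₘ D ∈ gnd N ∧ ClauseBetaFalse lt β (lits (Γ.take m)) D := by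
  have hml : m ≤ Γ.length := (List.getElem?_eq_some_iff.1 hA).1.le
  obtain ⟨M, ⟨x⟩, _, hMΓ⟩ := consistent_iff_exists_model.1 hΓ.consistent
  have : Nonempty M := ⟨x⟩
  have hMA : ∀ ν : V → M, A.ground.Holds ν := hMΓ _ (ground_mem_lits hA)
  have hM : Models M (lits (Γ.take m)) := hMΓ.mono (lits_take_subset Γ m)
  obtain ⟨D, ⟨hD, hDC⟩, ν, hν⟩ := h.exists_not_holds M (ν := fun _ => x) <|
    Multiset.forall_mem_cons.2 ⟨by rw [Literal.holds_comp, not_not]; exact hMA _,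
      fun L hL => litFalse_iff.1 (hR.2 L hL) M hM _⟩
  rcases hDC with rfl | hDC
  · exact ⟨R, hD, hR⟩
  have hsmaller : ∀ L ∈ D, ∀ K ∈ A.ground.comp ::ₘ R, TrailLT lt β Γ L K →
      LitBelow lt β L ∧ LitFalse (lits (Γ.take m)) L := fun L hL K hK hLK => by
    refine BetaDefined.false_of_not_holds ?_ hM (hν L hL)
    rcases Multiset.mem_cons.1 hK with rfl | hK
    · refine (hLK.betaDefined_take_or_eq_of_comp hlt hΓ hm hA hβ).resolve_right ?_
      rintro rfl
      exact hν _ hL (hMA ν)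
    · exact hLK.betaDefined_take_of_false hΓ hm hml hR hK
  rcases hDC.forall_mem_or_cons (clauseBetaFalse_iff.1 hR) hsmaller with h | ⟨D', rfl, h⟩
  · exact absurd (clauseBetaFalse_iff.2 h) (hN D hD)
  · exact ⟨D', hD, clauseBetaFalse_iff.2 h⟩

theorem Entails.exists_cons_mem (hlt : WellFounded lt) (hΓ : IsTrail lt Γ)
    (hm : ZeroBefore Γ m) (hA : Γ[m]? = some A) (hβ : LitBelow lt β A.ground)
    (hR : ClauseBetaFalse lt β (lits (Γ.take m)) R)
    (hsmaller : ∀ D ∈ N, MulExt (TrailLT lt β Γ) D (A.ground ::ₘ R))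
    (hN : ∀ D ∈ N, ¬ ClauseBetaFalse lt β (lits (Γ.take m)) D)
    (h : Entails N (A.ground ::ₘ R)) :
    ∃ D, A.ground ::ₘ D ∈ N ∧ ClauseBetaFalse lt β (lits (Γ.take m)) D := by
  have hml : m ≤ Γ.length := (List.getElem?_eq_some_iff.1 hA).1.le
  have hA_not_true : ¬ LitTrue (lits (Γ.take m)) A.ground := fun h => hΓ.undefined m A hA (Or.inl h)
  rw [litTrue_iff] at hA_not_true
  push Not at hA_not_true
  obtain ⟨M, _, _, hM, ν₀, hν₀⟩ := hA_not_true
  obtain ⟨D, hD, ν, hν⟩ := h.exists_not_holds M (ν := ν₀) <|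
    Multiset.forall_mem_cons.2 ⟨hν₀, fun L hL => litFalse_iff.1 (hR.2 L hL) M hM _⟩
  have hDR := (hsmaller D hD).forall_mem_or_cons (clauseBetaFalse_iff.1 hR) fun L hL K hK hLK => by
    refine BetaDefined.false_of_not_holds ?_ hM (hν L hL)
    rcases Multiset.mem_cons.1 hK with rfl | hK
    · exact hLK.betaDefined_take_of_ground hlt hΓ hm hA hβ
    · exact hLK.betaDefined_take_of_false hΓ hm hml hR hK
  rcases hDR with h | ⟨D', rfl, h⟩
  · exact absurd (clauseBetaFalse_iff.2 h) (hN D hD)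
  · exact ⟨D', hD, clauseBetaFalse_iff.2 h⟩

theorem Clause.exists_of_subst_eq_cons (h : Clause.subst E δ = B ::ₘ D) :
    ∃ L C, E = L ::ₘ C ∧ L.subst δ = B ∧ Clause.subst C δ = D := by
  have hB : B ∈ Clause.subst E δ := h ▸ Multiset.mem_cons_self B D
  obtain ⟨L, hL, rfl⟩ := Multiset.mem_map.1 hB
  obtain ⟨C, rfl⟩ := Multiset.exists_cons_of_mem hL
  rw [Clause.subst_cons, Multiset.cons_inj_right] at h
  exact ⟨L, C, rfl, rfl, h⟩

/-! ### Operations on trails -/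

namespace IsTrail

theorem level_mono (hΓ : IsTrail lt Γ) (hA : Γ[i]? = some A) (hA' : Γ[j]? = some A')
    (hij : i ≤ j) : A.level ≤ A'.level := by
  obtain ⟨hi, rfl⟩ := List.getElem?_eq_some_iff.1 hA
  obtain ⟨hj, rfl⟩ := List.getElem?_eq_some_iff.1 hA'
  rcases hij.lt_or_eq with h | rfl
  · exact List.pairwise_iff_getElem.1 hΓ.levels i j hi hj h
  · exact le_rfl

theorem congr (hΓ : IsTrail lt Γ) (hlits : lits Δ = lits Γ)
    (hlevels : Δ.map AnnLit.level = Γ.map AnnLit.level)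
    (hclosures : ∀ A ∈ Δ, A.groundClause.Ground) : IsTrail lt Δ := by
  have htake : ∀ i, lits (Δ.take i) = lits (Γ.take i) := fun i => by
    rw [lits, List.map_take, ← lits, hlits, lits, lits, List.map_take]
  have hget : ∀ (i : ℕ) (A : AnnLit Sg V), Δ[i]? = some A →
      ∃ A' : AnnLit Sg V, Γ[i]? = some A' ∧ A'.ground = A.ground :=
    fun i A hA => Option.map_eq_some_iff.1 <| by
      rw [← List.getElem?_map, ← lits, ← hlits, lits, List.getElem?_map, hA, Option.map_some]
  refine ⟨hclosures, hlits ▸ hΓ.consistent, ?_, fun i A hA => ?_, fun i A hA => ?_⟩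
  · rw [← List.pairwise_map (f := AnnLit.level) (R := (· ≤ ·)), hlevels, List.pairwise_map]
    exact hΓ.levels
  all_goals
    obtain ⟨A', hA', hAA'⟩ := hget i A hA
    rw [htake, ← hAA']
  · exact hΓ.undefined i A' hA'
  · exact hΓ.irreducible i A' hA'

theorem set (hΓ : IsTrail lt Γ) (hA : Γ[j]? = some A) (hlevel : A'.level = A.level)
    (hground : A'.ground = A.ground) (hclosure : A'.groundClause.Ground) :
    IsTrail lt (Γ.set j A') := by
  obtain ⟨hj, rfl⟩ := List.getElem?_eq_some_iff.1 hA
  refine hΓ.congr ?_ ?_ fun B hB => ?_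
  · simpa [lits, List.map_set, hground] using
      List.set_getElem_self (as := lits Γ) (i := j) (by simpa [lits] using hj)
  · rw [List.map_set, hlevel, ← List.getElem_map AnnLit.level (h := by simpa using hj)]
    exact List.set_getElem_self _
  · rcases List.mem_or_eq_of_mem_set hB with hB | rfl
    · exact hΓ.closures B hB
    · exact hclosure

theorem canJustify (hΓ : IsTrail lt Γ) (hA : Γ[j]? = some A)
    (hE : Clause.subst E δ = A.ground ::ₘ D) (hground : Clause.Ground (Clause.subst E δ))
    (hD : ClauseBetaFalse lt β (lits (Γ.take j)) D) : CanJustify lt β Γ j A E δ := by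
  obtain ⟨L, C, rfl, hL, rfl⟩ := Clause.exists_of_subst_eq_cons hE
  exact ⟨L, C, rfl, hL, hD, hΓ.set hA rfl hL hground⟩

end IsTrail

theorem lastLevel_nil : lastLevel ([] : List (AnnLit Sg V)) = 0 := rfl

theorem lastLevel_concat (Γ : List (AnnLit Sg V)) (A : AnnLit Sg V) :
    lastLevel (Γ ++ [A]) = A.level := by
  rw [lastLevel, List.getLast?_concat, Option.map_some, Option.getD_some]

theorem IsTrail.level_le_lastLevel (hΓ : IsTrail lt Γ) (hA : A ∈ Γ) : A.level ≤ lastLevel Γ := by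
  rcases List.eq_nil_or_concat Γ with rfl | ⟨Δ, B, rfl⟩
  · cases hA
  · rw [List.concat_eq_append] at *
    rw [lastLevel_concat]
    rcases List.mem_append.1 hA with hA | hA
    · exact (List.pairwise_append.1 hΓ.levels).2.2 A hA B (List.mem_singleton_self B)
    · rw [List.mem_singleton.1 hA]

theorem isTrail_nil : IsTrail lt ([] : List (AnnLit Sg V)) where
  closures A hA := by cases hA
  consistent :=
    consistent_iff_exists_model.2 ⟨PUnit, ⟨⟨⟩⟩, ⟨fun _ _ => ⟨⟩, fun _ _ => True⟩, fun _ hL => by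
      cases hL⟩
  levels := List.Pairwise.nil
  undefined i A h := by cases h
  irreducible i A h := by cases h

theorem getElem?_append_of_eq_some {α : Type*} {l l' : List α} {a : α} (h : l[i]? = some a) :
    (l ++ l')[i]? = some a ∧ (l ++ l').take i = l.take i := by
  have hi := (List.getElem?_eq_some_iff.1 h).1
  exact ⟨by rw [List.getElem?_append_left hi, h], List.take_append_of_le_length hi.le⟩

theorem IsTrail.of_append (h : IsTrail lt (Γ ++ Δ)) : IsTrail lt Γ where
  closures A hA := h.closures A (List.mem_append_left _ hA)
  consistent := h.consistent.mono (lits_append Γ Δ ▸ List.subset_append_left _ _)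
  levels := (List.pairwise_append.1 h.levels).1
  undefined i A hA := by
    obtain ⟨hget, htake⟩ := getElem?_append_of_eq_some (l' := Δ) hA
    exact htake ▸ h.undefined i A hget
  irreducible i A hA := by
    obtain ⟨hget, htake⟩ := getElem?_append_of_eq_some (l' := Δ) hA
    exact htake ▸ h.irreducible i A hget

theorem getElem?_concat_cases {α : Type*} {l : List α} {a b : α} (h : (l ++ [b])[i]? = some a) :
    (l[i]? = some a ∧ (l ++ [b]).take i = l.take i ∧ (l ++ [b]).take (i + 1) = l.take (i + 1)) ∨
      (a = b ∧ i = l.length ∧ (l ++ [b]).take i = l ∧ (l ++ [b]).take (i + 1) = l ++ [b]) := by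
  rcases lt_trichotomy i l.length with hi | rfl | hi
  · rw [List.getElem?_append_left hi] at h
    exact Or.inl ⟨h, List.take_append_of_le_length hi.le, List.take_append_of_le_length hi⟩
  · refine Or.inr ⟨by simpa using h.symm, rfl, by simp, List.take_of_length_le (by simp)⟩
  · rw [List.getElem?_eq_none (by simpa using hi)] at h
    cases h

theorem IsTrail.concat (h : IsTrail lt Γ) (hclosure : A.groundClause.Ground)
    (hground : A.ground.Ground) (hlevel : lastLevel Γ ≤ A.level)
    (hundef : ¬ LitDefined (lits Γ) A.ground)
    (hirred : LitIrreducible (conv lt (lits Γ)) A.ground) : IsTrail lt (Γ ++ [A]) where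
  closures B hB := by
    rcases List.mem_append.1 hB with hB | hB
    · exact h.closures B hB
    · rwa [List.mem_singleton.1 hB]
  consistent := lits_append Γ [A] ▸ Consistent.append hground hundef
  levels := List.pairwise_append.2 ⟨h.levels, List.pairwise_singleton _ _, fun B hB C hC => by
    rw [List.mem_singleton.1 hC]
    exact (h.level_le_lastLevel hB).trans hlevel⟩
  undefined i B hB := by
    rcases getElem?_concat_cases hB with ⟨hget, htake, -⟩ | ⟨rfl, -, htake, -⟩
    · exact htake ▸ h.undefined i B hget
    · rwa [htake]
  irreducible i B hB := by
    rcases getElem?_concat_cases hB with ⟨hget, htake, -⟩ | ⟨rfl, -, htake, -⟩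
    · exact htake ▸ h.irreducible i B hget
    · rwa [htake]

end Redundancy

section Runs

variable {Sg : FirstOrder.Language.{u, v}} {V : Type w} {lt : Sg.Term V → Sg.Term V → Prop}
  {β : Sg.Term V} {C D : Clause Sg V} {N : Set (Clause Sg V)} {σ τ : Subst Sg V}
  {Γ Δ : List (AnnLit Sg V)} {A : AnnLit Sg V} {P : List (RewriteStep Sg V)}
  {I : RewriteStep Sg V} {R : Rule} {S S' : State Sg V}

/-! ### Invariants of runs -/

/-- A trail whose annotations are below `β` and false, except for the annotated literal: in the part
of the trail to the left of that literal if it is propagated, and in the part up to and including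
it if it is a decision literal `K`, whose annotation is `K ∨ comp K`. -/
structure AnnotatedTrail (lt : Sg.Term V → Sg.Term V → Prop) (β : Sg.Term V)
    (Γ : List (AnnLit Sg V)) : Prop where
  isTrail : IsTrail lt Γ
  annotation : ∀ (i : ℕ) (A : AnnLit Sg V), Γ[i]? = some A →
    (A.level = lastLevel (Γ.take i) ∧
      SoundInstance lt β (lits (Γ.take i)) A.ground (Clause.subst A.rest A.sub)) ∨
    (IsDecision (Γ.take i) A ∧
      SoundInstance lt β (lits (Γ.take (i + 1))) A.ground (Clause.subst A.rest A.sub))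

namespace AnnotatedTrail

theorem nil : AnnotatedTrail lt β [] := ⟨isTrail_nil, fun i A h => by cases h⟩

theorem sound (h : AnnotatedTrail lt β Γ) (hA : A ∈ Γ) :
    SoundInstance lt β (lits Γ) A.ground (Clause.subst A.rest A.sub) := by
  obtain ⟨i, hi⟩ := List.mem_iff_getElem?.1 hA
  rcases h.annotation i A hi with ⟨-, h⟩ | ⟨-, h⟩ <;> exact h.mono (lits_take_subset _ _)

theorem of_append (h : AnnotatedTrail lt β (Γ ++ Δ)) : AnnotatedTrail lt β Γ where
  isTrail := h.isTrail.of_append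
  annotation i A hA := by
    obtain ⟨hget, htake⟩ := getElem?_append_of_eq_some (l' := Δ) hA
    have hann := h.annotation i A hget
    rwa [htake, List.take_append_of_le_length (List.getElem?_eq_some_iff.1 hA).1] at hann

theorem concat (h : AnnotatedTrail lt β Γ) (hundef : ¬ LitDefined (lits Γ) A.ground)
    (hirred : LitIrreducible (conv lt (lits Γ)) A.ground)
    (hA : (A.level = lastLevel Γ ∧
        SoundInstance lt β (lits Γ) A.ground (Clause.subst A.rest A.sub)) ∨
      (IsDecision Γ A ∧
        SoundInstance lt β (lits (Γ ++ [A])) A.ground (Clause.subst A.rest A.sub))) :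
    AnnotatedTrail lt β (Γ ++ [A]) where
  isTrail := by
    have hground : Clause.Ground (A.ground ::ₘ Clause.subst A.rest A.sub) :=
      hA.elim (fun h => h.2.ground) fun h => h.2.ground
    have hlevel : lastLevel Γ ≤ A.level := hA.elim (fun h => h.1.ge) fun h => h.1 ▸ Nat.le_succ _
    refine h.isTrail.concat ?_ (hground _ (Multiset.mem_cons_self _ _)) hlevel hundef hirred
    rwa [AnnLit.groundClause, AnnLit.clause, Clause.subst_cons]
  annotation i B hB := by
    rcases getElem?_concat_cases hB with ⟨hget, htake, htake'⟩ | ⟨rfl, -, htake, htake'⟩ <;>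
      rw [htake, htake']
    · exact h.annotation i B hget
    · exact hA

theorem concat_propagated (hlt : MonotonicOrdering lt) (h : AnnotatedTrail lt β Γ)
    (hA : SoundInstance lt β (lits Γ) A.ground (Clause.subst A.rest A.sub))
    (hundef : BetaUndefined lt β (lits Γ) A.ground)
    (hP : IsReductionChainApplication lt Γ A P) (hI : P.getLast? = some I) :
    AnnotatedTrail lt β (Γ ++ [⟨lastLevel Γ, I.lit.toLit, I.rest, I.sub⟩]) := by
  have hnf := hP.isLitNormalForm hI
  have hsound : ∀ B ∈ Γ ++ [A],
      SoundInstance lt β (lits Γ) B.ground (Clause.subst B.rest B.sub) := fun B hB => by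
    rcases List.mem_append.1 hB with hB | hB
    · exact h.sound hB
    · rwa [List.mem_singleton.1 hB]
  refine h.concat (fun hd => ?_) hnf.litIrreducible
    (Or.inl ⟨rfl, hP.1.1.soundInstance hlt hsound (List.mem_of_getLast? hI)⟩)
  exact hundef.not_defined hlt.wf hA.litBelow (hnf.litDefined_iff.2 hd)

theorem concat_decision (hlt : MonotonicOrdering lt) (h : AnnotatedTrail lt β Γ)
    (hground : A.ground.Ground) (hβ : LitBelow lt β A.ground)
    (hundef : BetaUndefined lt β (lits Γ) A.ground)
    (hP : IsReductionChainApplication lt Γ A P) (hI : P.getLast? = some I) :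
    AnnotatedTrail lt β (Γ ++ [⟨lastLevel Γ + 1, I.lit.toLit, {I.lit.toLit.comp}, I.sub⟩]) := by
  have hnf := hP.isLitNormalForm hI
  have hKground := hnf.ground hground
  have hKbelow := hnf.litBelow hlt hβ
  refine h.concat (fun hd => hundef.not_defined hlt.wf hβ (hnf.litDefined_iff.2 hd))
    hnf.litIrreducible (Or.inr ⟨rfl, ?_⟩)
  rw [Clause.subst_singleton, Literal.comp_subst]
  refine ⟨Multiset.forall_mem_cons.2 ⟨hKground, ?_⟩,
    clauseBelow_iff.2 (Multiset.forall_mem_cons.2 ⟨hKbelow, ?_⟩), ?_⟩ <;>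
    refine fun K hK => Multiset.mem_singleton.1 hK ▸ ?_
  · exact Literal.comp_ground.2 hKground
  · exact litBelow_comp.2 hKbelow
  · refine .of_comp_mem ?_
    rw [Literal.comp_comp, lits_append]
    exact List.mem_append_right _ (List.mem_singleton_self _)

end AnnotatedTrail

/-- No proper initial segment of the trail `Γ` falsifies a ground instance of a clause of `N`:
Conflict could not have been applied earlier. -/
def NoEarlierConflict (lt : Sg.Term V → Sg.Term V → Prop) (β : Sg.Term V)
    (Γ : List (AnnLit Sg V)) (N : Set (Clause Sg V)) : Prop :=
  ∀ m < Γ.length, NoConflict lt β (lits (Γ.take m)) N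

namespace NoEarlierConflict

theorem of_append (h : NoEarlierConflict lt β (Γ ++ Δ) N) : NoEarlierConflict lt β Γ N :=
  fun m hm => by
    have hno := h m (hm.trans_le (List.length_append ▸ Nat.le_add_right _ _))
    rwa [List.take_append_of_le_length hm.le] at hno

theorem concat (h : NoEarlierConflict lt β Γ N) (hΓ : NoConflict lt β (lits Γ) N) :
    NoEarlierConflict lt β (Γ ++ [A]) N := fun m hm => by
  rw [List.length_append, List.length_singleton, Nat.lt_succ_iff] at hm
  rw [List.take_append_of_le_length hm]
  rcases hm.lt_or_eq with hm | rfl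
  · exact h m hm
  · rwa [List.take_length]

theorem learn {U : Set (Clause Sg V)} (h : NoEarlierConflict lt β Γ (N ∪ U))
    (hC : ¬ ∃ τ : Subst Sg V, Clause.Ground (Clause.subst C τ) ∧
      ClauseBetaFalse lt β (lits Γ) (Clause.subst C τ)) :
    NoEarlierConflict lt β Γ (N ∪ (U ∪ {C})) := by
  rintro m hm D ⟨E, hE, δ, rfl, hground⟩ hfalse
  rw [← Set.union_assoc] at hE
  rcases hE with hE | rfl
  · exact h m hm _ ⟨E, hE, δ, rfl, hground⟩ hfalse
  · exact hC ⟨δ, hground, hfalse.mono (lits_take_subset _ _)⟩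

end NoEarlierConflict

/-- The properties of the states of a run in which Conflict has precedence. -/
structure State.Invariant (lt : Sg.Term V → Sg.Term V → Prop) (S : State Sg V) : Prop where
  trail : AnnotatedTrail lt S.β S.trail
  level : S.k = lastLevel S.trail
  noEarlierConflict : NoEarlierConflict lt S.β S.trail (S.N ∪ S.U)
  closure : ∀ C σ, S.status = .closure C σ →
    Clause.Ground (Clause.subst C σ) ∧ ClauseBetaFalse lt S.β (lits S.trail) (Clause.subst C σ)

theorem NormalizesOn.clauseBetaFalse (hlt : MonotonicOrdering lt) {Γ : List (Literal Sg V)}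
    (h : NormalizesOn (conv lt Γ) C σ τ) (hDC : D ⊆ C)
    (hD : ClauseBetaFalse lt β Γ (Clause.subst D σ)) :
    ClauseBetaFalse lt β Γ (Clause.subst D τ) := by
  rw [clauseBetaFalse_iff, Clause.subst, Multiset.forall_mem_map_iff] at hD ⊢
  exact fun L hL => ⟨h.litBelow hlt (hDC hL) (hD L hL).1, h.litFalse (hDC hL) (hD L hL).2⟩

theorem noConflict_of_not_applicable (hlt : MonotonicOrdering lt) (hS : S.status = .top)
    (h : ¬ Applicable lt .conflict S) : NoConflict lt S.β (lits S.trail) (S.N ∪ S.U) := by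
  obtain ⟨Γ, N, U, β, k, _⟩ := S
  obtain rfl : _ = Status.top := hS
  rintro D ⟨E, hE, δ, rfl, hground⟩ hfalse
  obtain ⟨δ', hirred, hnorm⟩ := exists_normalizesOn hlt (lits Γ) E δ
  have hground' := hnorm.ground hground
  have hfalse' := hnorm.clauseBetaFalse hlt (Multiset.Subset.refl E) hfalse
  by_cases hlevel : clauseLevel Γ (Clause.subst E δ') = 0
  · exact h ⟨_, .conflict_bot hE hground' hfalse' hirred hlevel⟩
  · exact h ⟨_, .conflict hE hground' hfalse' hirred hlevel⟩

namespace State.Invariant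

theorem of_nil {U : Set (Clause Sg V)} : Invariant lt ⟨[], N, U, β, 0, .top⟩ where
  trail := .nil
  level := rfl
  noEarlierConflict m hm := absurd hm (Nat.not_lt_zero m)
  closure C σ h := by cases h

theorem of_closure {U : Set (Clause Sg V)} {k : ℕ} {D' : Status Sg V}
    (hS : Invariant lt ⟨Γ, N, U, β, k, D'⟩) (hground : Clause.Ground (Clause.subst C σ))
    (hfalse : ClauseBetaFalse lt β (lits Γ) (Clause.subst C σ)) :
    Invariant lt ⟨Γ, N, U, β, k, .closure C σ⟩ where
  __ := hS
  closure C' σ' h := by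
    cases h
    exact ⟨hground, hfalse⟩

theorem of_closure_subset {U : Set (Clause Sg V)} {k : ℕ}
    (hS : Invariant lt ⟨Γ, N, U, β, k, .closure C σ⟩)
    (hDC : Clause.subst D τ ⊆ Clause.subst C σ) :
    Invariant lt ⟨Γ, N, U, β, k, .closure D τ⟩ := by
  obtain ⟨hground, hfalse⟩ := hS.closure C σ rfl
  exact hS.of_closure (fun L hL => hground L (hDC hL)) (hfalse.of_subset hDC)

theorem propagate (hlt : MonotonicOrdering lt) (hS : S.Invariant lt)
    (hno : NoConflict lt S.β (lits S.trail) (S.N ∪ S.U)) (h : Step lt .propagate S S') :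
    S'.Invariant lt := by
  obtain ⟨htrail, hlevel, hearlier, -⟩ := hS
  cases h with
  | @propagate Γ N U β k C₀ b s t E σ μ P I hmem hground hfalse hE hμ hundef hbelow hi hP hI =>
    obtain rfl : k = lastLevel Γ := hlevel
    have hμσ : μ.comp σ = σ := hμ.comp_eq <| by
      rintro q ⟨e, he, rfl | rfl⟩
      exacts [(hE e he).1, (hE e he).2]
    refine ⟨htrail.concat_propagated hlt ?_ ?_ hP hI, by rw [lastLevel_concat],
      hearlier.concat hno, fun C σ h => by cases h⟩
    · rw [← Clause.subst_comp, hμσ, add_comm, Multiset.singleton_add, Clause.subst_cons] at hbelow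
      rw [add_comm, Multiset.singleton_add, Clause.subst_cons] at hground
      rw [AnnLit.ground, ← Literal.subst_comp, ← Clause.subst_comp, hμσ]
      exact ⟨hground, hbelow, hfalse⟩
    · rwa [AnnLit.ground, ← Literal.subst_comp, hμσ]

theorem decide (hlt : MonotonicOrdering lt) (hS : S.Invariant lt)
    (hno : NoConflict lt S.β (lits S.trail) (S.N ∪ S.U)) (h : Step lt .decide S S') :
    S'.Invariant lt := by
  obtain ⟨htrail, hlevel, hearlier, -⟩ := hS
  cases h with
  | @decide Γ N U β k C₀ L σ P I hmem hground hC₀ hundef hbelow hirred hP hI =>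
    obtain rfl : k = lastLevel Γ := hlevel
    have hL : L.subst σ ∈ Clause.subst (C₀ + {L}) σ :=
      Multiset.mem_map_of_mem _ (Multiset.mem_add.2 (Or.inr (Multiset.mem_singleton_self L)))
    exact ⟨htrail.concat_decision (A := ⟨lastLevel Γ + 1, L, C₀, σ⟩) hlt (hground _ hL)
        (clauseBelow_iff.1 hbelow _ hL) hundef hP hI,
      by rw [lastLevel_concat], hearlier.concat hno, fun C σ h => by cases h⟩

theorem conflict (hS : S.Invariant lt) (h : Step lt .conflict S S') : S'.Invariant lt := by
  cases h with
  | conflict_bot => exact ⟨hS.trail, hS.level, hS.noEarlierConflict, fun C σ h => by cases h⟩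
  | conflict _ hground hfalse => exact hS.of_closure hground hfalse

theorem skip (hS : S.Invariant lt) (h : Step lt .skip S S') : S'.Invariant lt := by
  obtain ⟨htrail, hlevel, hearlier, hclosure⟩ := hS
  cases h with
  | @skip Γ K A N U β k C σ hfalse =>
    have hsplit : Γ ++ [K, A] = (Γ ++ [K]) ++ [A] := List.append_cons Γ K [A]
    simp only [hsplit] at htrail hearlier
    refine ⟨htrail.of_append, by rw [lastLevel_concat], hearlier.of_append, fun C' σ' h => ?_⟩
    cases h
    exact ⟨(hclosure C σ rfl).1, hfalse⟩

theorem exploreRefutation (hS : S.Invariant lt) (h : Step lt .exploreRefutation S S') :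
    S'.Invariant lt := by
  cases h with
  | exploreRefutation _ _ _ _ hground _ hfalse => exact hS.of_closure hground hfalse

theorem factorize (hS : S.Invariant lt) (h : Step lt .factorize S S') : S'.Invariant lt := by
  cases h with
  | @factorize Γ N U β k C b s t s' t' σ μ hs ht hμ =>
    have hμσ : μ.comp σ = σ := hμ.comp_eq <| by
      rintro q (rfl | rfl)
      exacts [hs, ht]
    refine hS.of_closure_subset ?_
    rw [← Clause.subst_comp, hμσ]
    exact Multiset.subset_of_le (Multiset.map_le_map (Multiset.le_add_right _ _))

theorem equalityResolution (hS : S.Invariant lt) (h : Step lt .equalityResolution S S') :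
    S'.Invariant lt := by
  cases h with
  | @equalityResolution Γ N U β k C s t σ μ hs hμ =>
    have hμσ : μ.comp σ = σ := hμ.comp_eq <| by
      rintro q rfl
      exact hs
    refine hS.of_closure_subset ?_
    rw [← Clause.subst_comp, hμσ]
    exact Multiset.subset_of_le (Multiset.map_le_map (Multiset.le_add_right _ _))

theorem backtrack (hS : S.Invariant lt) (h : Step lt .backtrack S S') : S'.Invariant lt := by
  obtain ⟨htrail, -, hearlier, -⟩ := hS
  cases h with
  | @backtrack_decision Γ Γ' K N U β k C L σ _ _ hno hK =>
    exact ⟨htrail.of_append, (congrArg (· - 1) hK).trans (Nat.add_sub_cancel _ _),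
      hearlier.of_append.learn hno, fun C σ h => by cases h⟩
  | @backtrack_propagated Γ Γ' K N U β k C L σ _ _ hno hK =>
    have hann := htrail.annotation Γ.length K (by simp)
    rw [List.take_left] at hann
    exact ⟨htrail.of_append, (hann.resolve_right fun h => hK h.1).1, hearlier.of_append.learn hno,
      fun C σ h => by cases h⟩

theorem grow (h : Step lt .grow S S') : S'.Invariant lt := by
  cases h
  exact of_nil

end State.Invariant

theorem Step.status_of_conflict (h : Step lt .conflict S S') : S.status = .top := by
  cases h <;> rfl

theorem Step.invariant (hlt : MonotonicOrdering lt) (h : Step lt R S S') (hS : S.Invariant lt)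
    (hconflict : Applicable lt .conflict S → R = .conflict) : S'.Invariant lt := by
  have hno (hR : R ≠ .conflict) (htop : S.status = .top) :=
    noConflict_of_not_applicable hlt htop (mt hconflict hR)
  cases R with
  | propagate => exact hS.propagate hlt (hno nofun (by cases h; rfl)) h
  | decide => exact hS.decide hlt (hno nofun (by cases h; rfl)) h
  | conflict => exact hS.conflict h
  | skip => exact hS.skip h
  | exploreRefutation => exact hS.exploreRefutation h
  | factorize => exact hS.factorize h
  | equalityResolution => exact hS.equalityResolution h
  | backtrack => exact hS.backtrack h
  | grow => exact .grow h

theorem IsRun.invariant (hlt : MonotonicOrdering lt) {n : ℕ} {S : ℕ → State Sg V} {r : ℕ → Rule}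
    (hrun : IsRun lt N n S r)
    (hconflict : ∀ i < n, Applicable lt .conflict (S i) → r i = .conflict) {i : ℕ} (hi : i ≤ n) :
    (S i).Invariant lt := by
  induction i with
  | zero =>
    obtain ⟨β, -, h⟩ := hrun.init
    exact h ▸ .of_nil
  | succ i ih => exact (hrun.step i hi).invariant hlt (ih (Nat.le_of_succ_le hi)) (hconflict i hi)

/-! ### Conflict resolution phases -/

theorem State.not_inConflict_of_top (h : S.status = .top) : ¬ S.InConflict := by
  rintro ⟨C, σ, hC⟩
  exact nomatch h.symm.trans hC

/-- States with the same clauses and the same bound `β`; within a conflict resolution phase, states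
differ only in the other components. -/
structure State.SameProblem (S T : State Sg V) : Prop where
  clauses : S.N ∪ S.U = T.N ∪ T.U
  bound : S.β = T.β

theorem State.SameProblem.trans {S T T' : State Sg V} (h : S.SameProblem T)
    (h' : T.SameProblem T') : S.SameProblem T' :=
  ⟨h.clauses.trans h'.clauses, h.bound.trans h'.bound⟩

theorem Step.conflict_resolution (h : Step lt R S S') (hS : S.InConflict)
    (hS' : S'.InConflict) :
    S'.SameProblem S ∧ S'.trail <+: S.trail ∧ (S'.trail ≠ S.trail ↔ R = .skip) := by
  obtain ⟨C, σ, hS⟩ := hS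
  obtain ⟨C', σ', hS'⟩ := hS'
  cases h with
  | propagate | decide | conflict_bot | conflict | grow => cases hS
  | backtrack_decision | backtrack_propagated => cases hS'
  | @skip Γ K A => exact ⟨⟨rfl, rfl⟩, ⟨[A], by simp⟩, by simp⟩
  | exploreRefutation | factorize | equalityResolution =>
    exact ⟨⟨rfl, rfl⟩, List.prefix_rfl, by simp⟩

theorem Step.enter_conflict (h : Step lt R S S') (hS : ¬ S.InConflict) (hS' : S'.InConflict) :
    R = .conflict ∧ S'.SameProblem S ∧ S'.trail = S.trail := by
  obtain ⟨C, σ, hS'⟩ := hS'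
  cases h with
  | propagate | decide | conflict_bot | backtrack_decision | backtrack_propagated | grow =>
    cases hS'
  | conflict => exact ⟨rfl, ⟨rfl, rfl⟩, rfl⟩
  | skip | exploreRefutation | factorize | equalityResolution => exact absurd ⟨_, _, rfl⟩ hS

theorem Step.sameProblem_of_decide (h : Step lt .decide S S') :
    S'.SameProblem S ∧ ∃ A, S'.trail = S.trail ++ [A] ∧ A.level = S.k + 1 := by
  cases h
  exact ⟨⟨rfl, rfl⟩, _, rfl, rfl⟩

theorem Step.status_of_decide (h : Step lt .decide S S') : S.status = .top := by
  cases h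
  rfl

theorem Step.clauseLevel_lt_of_backtrack (h : Step lt .backtrack S S')
    (hC : S.status = .closure C σ) :
    ∃ D L, C = D + {L} ∧ clauseLevel S.trail (Clause.subst D σ) < S.k := by
  cases h <;> cases hC <;> exact ⟨_, _, rfl, ‹_›⟩

section Phases

variable {n i b : ℕ} {S : ℕ → State Sg V} {r : ℕ → Rule}

theorem IsRun.conflict_resolution (hrun : IsRun lt N n S r) (hib : i ≤ b) (hb : b ≤ n)
    (h : ∀ j, i ≤ j → j ≤ b → (S j).InConflict) :
    (S b).SameProblem (S i) ∧ (S b).trail <+: (S i).trail ∧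
      ((S b).trail ≠ (S i).trail ↔ ∃ j, i ≤ j ∧ j < b ∧ r j = .skip) := by
  induction b, hib using Nat.le_induction with
  | base =>
    exact ⟨⟨rfl, rfl⟩, List.prefix_rfl, iff_of_false (fun h => h rfl)
      fun ⟨j, hij, hji, _⟩ => hij.not_gt hji⟩
  | succ b hib ih =>
    obtain ⟨hsame, hpre, hskip⟩ := ih (by omega) fun j hij hjb => h j hij (by omega)
    obtain ⟨hsame', hpre', hskip'⟩ := (hrun.step b (by omega)).conflict_resolution
      (h b hib (by omega)) (h (b + 1) (by omega) le_rfl)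
    refine ⟨hsame'.trans hsame, hpre'.trans hpre, ?_⟩
    have hsplit : (∃ j, i ≤ j ∧ j < b + 1 ∧ r j = .skip) ↔
        (∃ j, i ≤ j ∧ j < b ∧ r j = .skip) ∨ r b = .skip := by
      simp only [Nat.lt_succ_iff_lt_or_eq]
      grind
    rw [hsplit, ← hskip, ← hskip', ← not_and_or, not_iff_not]
    refine ⟨fun heq => ?_, fun heq => heq.2.trans heq.1⟩
    have heq' := hpre.eq_of_length_le (heq ▸ hpre'.length_le)
    exact ⟨heq', heq.trans heq'.symm⟩

theorem IsRun.exists_lastConflict (hrun : IsRun lt N n S r) (hb : b ≤ n)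
    (h : (S b).InConflict) :
    ∃ c, LastConflict r c b ∧ ∀ j, c < j → j ≤ b → (S j).InConflict := by
  induction b with
  | zero =>
    obtain ⟨β, -, h₀⟩ := hrun.init
    exact absurd h (State.not_inConflict_of_top (h₀ ▸ rfl))
  | succ b ih =>
    have hstep := hrun.step b hb
    by_cases hSb : (S b).InConflict
    · obtain ⟨c, ⟨hcb, hrc, hlast⟩, hphase⟩ := ih (by omega) hSb
      refine ⟨c, ⟨by omega, hrc, fun j hcj hjb => ?_⟩, fun j hcj hjb => ?_⟩
      · rcases Nat.lt_succ_iff_lt_or_eq.1 hjb with hjb | rfl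
        · exact hlast j hcj hjb
        · intro hrj
          exact State.not_inConflict_of_top (hrj ▸ hstep).status_of_conflict hSb
      · rcases Nat.le_succ_iff.1 hjb with hjb | rfl
        · exact hphase j hcj hjb
        · exact h
    · refine ⟨b, ⟨Nat.lt_succ_self b, (hstep.enter_conflict hSb h).1, by omega⟩,
        fun j hbj hjb => ?_⟩
      rwa [show j = b + 1 by omega]

end Phases

/-! ### Propagation -/

theorem Literal.subst_id (L : Literal Sg V) : L.subst Subst.id = L := by
  obtain ⟨b, s, t, rfl⟩ := L.exists_mk
  exact congrArg (Literal.mk b) (congrArg₂ (fun s t => s(s, t)) (subst_var s) (subst_var t))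

theorem Clause.subst_id (C : Clause Sg V) : Clause.subst C Subst.id = C :=
  (Multiset.map_congr rfl fun L _ => L.subst_id).trans (Multiset.map_id C)

theorem exists_propagate_of_substIrreducible (hS : S.status = .top) {L : Literal Sg V}
    (hmem : L ::ₘ C ∈ S.N ∪ S.U) (hground : Clause.Ground (Clause.subst (L ::ₘ C) σ))
    (hσ : SubstIrreducible (conv lt (lits S.trail)) σ) (hβ : LitBelow lt S.β (L.subst σ))
    (hundef : ¬ LitDefined (lits S.trail) (L.subst σ))
    (hirred : LitIrreducible (conv lt (lits S.trail)) (L.subst σ))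
    (hC : ClauseBetaFalse lt S.β (lits S.trail) (Clause.subst C σ)) :
    ∃ S' A, Step lt .propagate S S' ∧ S'.trail = S.trail ++ [A] ∧ A.clause ∈ S.N ∪ S.U ∧
      A.ground = L.subst σ := by
  obtain ⟨Γ, N, U, β, k, _⟩ := S
  obtain rfl : _ = Status.top := hS
  obtain ⟨b, s, t, rfl⟩ := L.exists_mk
  rw [← Multiset.singleton_add, add_comm] at hmem hground
  have hP : IsReductionChainApplication lt Γ
      ⟨k, Literal.subst ⟨b, s(s, t)⟩ Subst.id, Clause.subst C Subst.id, σ⟩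
      [.base ⟨b, s, t⟩ C σ] := by
    rw [Literal.subst_id, Clause.subst_id]
    exact isReductionChainApplication_singleton k hirred
  have hbelow : ClauseBelow lt β (Clause.subst (C + {⟨b, s(s, t)⟩}) σ) := by
    rw [add_comm, Multiset.singleton_add, Clause.subst_cons, clauseBelow_iff]
    exact Multiset.forall_mem_cons.2 ⟨hβ, clauseBelow_iff.1 hC.1⟩
  refine ⟨_, _, Step.propagate (E := []) (μ := Subst.id) (by simpa using hmem) hground hC.2
    (by simp) (by simpa using isMGU_id_empty) (Or.inr hundef) ?_ hσ hP rfl, rfl, ?_, rfl⟩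
  · rwa [Clause.subst_id]
  · rwa [add_comm, Multiset.singleton_add] at hmem

theorem exists_propagate (hlt : MonotonicOrdering lt) (hS : S.status = .top) {B : Literal Sg V}
    (hmem : B ::ₘ D ∈ gnd (S.N ∪ S.U)) (hβ : LitBelow lt S.β B)
    (hundef : ¬ LitDefined (lits S.trail) B)
    (hirred : LitIrreducible (conv lt (lits S.trail)) B)
    (hD : ClauseBetaFalse lt S.β (lits S.trail) D) :
    ∃ S' A, Step lt .propagate S S' ∧ S'.trail = S.trail ++ [A] ∧ A.clause ∈ S.N ∪ S.U ∧
      A.ground = B := by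
  obtain ⟨E, hE, δ, hδ, hground⟩ := hmem
  obtain ⟨L, C, rfl, rfl, rfl⟩ := Clause.exists_of_subst_eq_cons hδ.symm
  rw [hδ] at hground
  obtain ⟨δ', hirred', hnorm⟩ := exists_normalizesOn hlt (lits S.trail) (L ::ₘ C) δ
  have hL := hnorm.subst_eq (Multiset.mem_cons_self L C) hirred
  have hC := hnorm.clauseBetaFalse hlt (Multiset.subset_cons C L) hD
  rw [← hL] at hβ hundef hirred ⊢
  exact exists_propagate_of_substIrreducible hS hE (hnorm.ground hground) hirred' hβ hundef hirred
    hC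

end Runs

section Main

variable {Sg : FirstOrder.Language.{u, v}} {V : Type w} {lt : Sg.Term V → Sg.Term V → Prop}
  {β : Sg.Term V} {C E R : Clause Sg V} {L : Literal Sg V} {N : Set (Clause Sg V)}
  {σ δ : Subst Sg V} {Γ Γ₀ : List (AnnLit Sg V)} {A B : AnnLit Sg V} {S T : State Sg V}
  {i j m : ℕ}

/-! ### Learned clauses -/

theorem IsTrail.lt_of_level_lt (hΓ : IsTrail lt Γ) (hA : Γ[m]? = some A) (hB : Γ[i]? = some B)
    (h : B.level < A.level) : i < m :=
  not_le.1 fun hmi => h.not_ge (hΓ.level_mono hA hB hmi)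

theorem IsTrail.zeroBefore (hΓ : IsTrail lt Γ) (hA : Γ[j]? = some A) (h : 0 < A.level)
    (hjm : j ≤ m) : ZeroBefore Γ m :=
  fun _ _ hB hlevel => (hΓ.lt_of_level_lt hA hB (hlevel ▸ h)).trans_le hjm

theorem IsTrail.zeroBefore_length (hΓ : IsTrail lt Γ) (hpre : Γ₀ <+: Γ) (h : 0 < lastLevel Γ₀) :
    ZeroBefore Γ Γ₀.length := by
  rcases List.eq_nil_or_concat Γ₀ with rfl | ⟨Γ₁, B, rfl⟩
  · exact absurd h lastLevel_nil.not_gt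
  · obtain ⟨Δ, rfl⟩ := hpre
    rw [List.concat_eq_append] at *
    rw [lastLevel_concat] at h
    exact hΓ.zeroBefore (j := Γ₁.length) (A := B) (by simp) h (by simp)

theorem litLevel_le_clauseLevel (hL : L ∈ C) : litLevel Γ L ≤ clauseLevel Γ C :=
  Multiset.le_sup (Multiset.mem_map_of_mem _ hL)

theorem ClauseBetaFalse.take_of_clauseLevel_lt (hΓ : IsTrail lt Γ) (hA : Γ[m]? = some A)
    (hlevel : clauseLevel Γ C < A.level) (h : ClauseBetaFalse lt β (lits Γ) C) :
    ClauseBetaFalse lt β (lits (Γ.take m)) C := by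
  refine ⟨h.1, fun L hL => ?_⟩
  have hdefined : LitDefined (lits (Γ.take m)) L :=
    .take_of_level hΓ (Or.inr (h.2 L hL)) fun i B hB hBL =>
      hΓ.lt_of_level_lt hA hB (hBL ▸ (litLevel_le_clauseLevel hL).trans_lt hlevel)
  exact hdefined.resolve_left fun htrue =>
    hΓ.consistent.not_true_of_false (h.2 L hL) (htrue.mono (lits_take_subset Γ m))

namespace State.Invariant

theorem not_groundRedundant_of_ne_trail (hS : S.Invariant lt) (hΓ : IsTrail lt Γ)
    (hS₀ : Γ₀ <+: S.trail) (hne : Γ₀ ≠ S.trail) (hΓ₀ : Γ₀ <+: Γ) (hpos : 0 < lastLevel Γ₀)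
    (hC : ClauseBetaFalse lt S.β (lits Γ₀) C) :
    ¬ GroundRedundant (TrailLT lt S.β Γ) (gnd (S.N ∪ S.U)) C := by
  have hlength : Γ₀.length < S.trail.length :=
    hS₀.length_le.lt_of_ne fun h => hne (hS₀.eq_of_length h)
  have hno := hS.noEarlierConflict _ hlength
  rw [← List.prefix_iff_eq_take.1 hS₀] at hno
  refine not_groundRedundant_of_noConflict hΓ (hΓ.zeroBefore_length hΓ₀ hpos) hΓ₀.length_le ?_ ?_
  all_goals rwa [← List.prefix_iff_eq_take.1 hΓ₀]

theorem not_groundRedundant_of_decide (hlt : MonotonicOrdering lt) (hS : S.Invariant lt)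
    (hT : T.status = .top) (hsame : S.SameProblem T) (hA : S.trail = T.trail ++ [A])
    (hpos : 0 < A.level)
    (hdecide : ¬ ∃ S' B, Step lt .propagate T S' ∧ S'.trail = T.trail ++ [B] ∧
      B.clause ∈ T.N ∪ T.U ∧ A.ground = B.ground.comp)
    (hR : ClauseBetaFalse lt S.β (lits S.trail) R) (hlevel : clauseLevel S.trail R < A.level) :
    ¬ GroundRedundant (TrailLT lt S.β S.trail) (gnd (S.N ∪ S.U)) (A.ground.comp ::ₘ R) := by
  intro hred
  have hΓ := hS.trail.isTrail
  have hget : S.trail[T.trail.length]? = some A := by simp [hA]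
  have htake : S.trail.take T.trail.length = T.trail := by simp [hA]
  have hbelow : LitBelow lt S.β A.ground := (hS.trail.sound (List.mem_of_getElem? hget)).litBelow
  obtain ⟨D, hD, hDfalse⟩ := hred.exists_comp_cons_mem hlt.wf hΓ
    (hΓ.zeroBefore hget hpos le_rfl) hget hbelow (hR.take_of_clauseLevel_lt hΓ hget hlevel)
    (hS.noEarlierConflict _ (List.getElem?_eq_some_iff.1 hget).1)
  have hundef := hΓ.undefined _ _ hget
  have hirred := hΓ.irreducible _ _ hget
  rw [htake] at hDfalse hundef hirred
  rw [hsame.clauses] at hD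
  rw [hsame.bound] at hDfalse hbelow
  obtain ⟨S', B, hstep, htrail, hB, hground⟩ := exists_propagate hlt hT hD
    (litBelow_comp.2 hbelow) (mt litDefined_comp.1 hundef) hirred hDfalse
  exact hdecide ⟨S', B, hstep, htrail, hB, by rw [hground, Literal.comp_comp]⟩

theorem lastLevel_pos_of_backtrack {S' : State Sg V} (hS : S.Invariant lt)
    (h : Step lt .backtrack S S') (hC : S.status = .closure C σ) : 0 < lastLevel S.trail := by
  obtain ⟨D, L, -, hlevel⟩ := h.clauseLevel_lt_of_backtrack hC
  exact hS.level ▸ (Nat.zero_le _).trans_lt hlevel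

end State.Invariant

/-- Regular runs, except that Factorize need not have precedence and Propagate need not have
precedence over Decide at level zero. -/
structure IsSemiregularRun (lt : Sg.Term V → Sg.Term V → Prop) (N : Set (Clause Sg V)) (n : ℕ)
    (S : ℕ → State Sg V) (r : ℕ → Rule) : Prop extends IsRun lt N n S r where
  conflict_first : ∀ i < n, Applicable lt .conflict (S i) → r i = .conflict
  no_bad_decision : ∀ i < n, r i = .decide →
    ∀ A, (S (i + 1)).trail = (S i).trail ++ [A] →
    ¬ ∃ S' B, Step lt .propagate (S i) S' ∧ S'.trail = (S i).trail ++ [B] ∧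
      B.clause ∈ (S i).N ∪ (S i).U ∧ A.ground = B.ground.comp
  skip_once : ∀ b < n, r b = .backtrack → ∀ c, LastConflict r c b →
    AfterDecide r c ∨ ∃ j, c < j ∧ j < b ∧ r j = .skip
  backtrack_after_decide : ∀ b < n, r b = .backtrack → ∀ c, LastConflict r c b →
    AfterDecide r c → ∀ C σ, (S b).status = .closure C σ →
    ∃ A, (S b).trail.getLast? = some A ∧ A.ground.comp ∈ C.subst σ

section SemiregularRuns

variable {n b c d : ℕ} {S : ℕ → State Sg V} {r : ℕ → Rule}

theorem IsRegularRun.isSemiregularRun (h : IsRegularRun lt N n S r) :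
    IsSemiregularRun lt N n S r :=
  { h with }

namespace IsSemiregularRun

theorem invariant (hlt : MonotonicOrdering lt) (hrun : IsSemiregularRun lt N n S r) (hi : i ≤ n) :
    (S i).Invariant lt :=
  hrun.toIsRun.invariant hlt hrun.conflict_first hi

theorem not_groundRedundant_of_skip (hlt : MonotonicOrdering lt)
    (hrun : IsSemiregularRun lt N n S r) (hb : b < n) (hr : r b = .backtrack)
    (hphase : ∀ j, c < j → j ≤ b → (S j).InConflict)
    (hskip : ∃ j, c < j ∧ j < b ∧ r j = .skip) (hC : (S b).status = .closure C σ) (hci : c < i)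
    (hib : i ≤ b) :
    ¬ GroundRedundant (TrailLT lt (S i).β (S i).trail) (gnd ((S b).N ∪ (S b).U))
      (Clause.subst C σ) := by
  have hS := hrun.invariant hlt hb.le
  have hfalse := (hS.closure C σ hC).2
  obtain ⟨hsame, hpre, hne⟩ := hrun.conflict_resolution (hci.trans_le hib) hb.le hphase
  obtain ⟨hsame', hpre', -⟩ := hrun.conflict_resolution hib hb.le
    fun j hij hjb => hphase j (hci.trans_le hij) hjb
  rw [hsame.bound] at hfalse
  rw [← hsame'.bound, hsame.bound, hsame.clauses]
  exact (hrun.invariant hlt ((hci.trans_le hib).trans hb)).not_groundRedundant_of_ne_trail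
    (hrun.invariant hlt (hib.trans hb.le)).trail.isTrail hpre (hne.2 hskip) hpre'
    (hS.lastLevel_pos_of_backtrack (hr ▸ hrun.step b hb) hC) hfalse

theorem not_groundRedundant_of_decide (hlt : MonotonicOrdering lt)
    (hrun : IsSemiregularRun lt N n S r) (hb : b < n) (hr : r b = .backtrack)
    (hd : r d = .decide) (hc : LastConflict r (d + 1) b) (hS : (S b).SameProblem (S d))
    (htrail : (S b).trail = (S (d + 1)).trail) (hC : (S b).status = .closure C σ) :
    ¬ GroundRedundant (TrailLT lt (S b).β (S b).trail) (gnd ((S b).N ∪ (S b).U))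
      (Clause.subst C σ) := by
  have hdn : d < n := by have := hc.1; omega
  have hinv := hrun.invariant hlt hb.le
  obtain ⟨D, L, rfl, hlevel⟩ := (hr ▸ hrun.step b hb).clauseLevel_lt_of_backtrack hC
  have hdecide := hd ▸ hrun.step d hdn
  obtain ⟨-, A, hA, hAlevel⟩ := hdecide.sameProblem_of_decide
  have htrail' : (S b).trail = (S d).trail ++ [A] := htrail.trans hA
  obtain ⟨A', hA', hmem⟩ := hrun.backtrack_after_decide b hb hr (d + 1) hc ⟨d, rfl, hd⟩ _ _ hC
  obtain rfl : A = A' := by simpa [htrail'] using hA'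
  have hfalse := (hinv.closure _ _ hC).2
  rw [hinv.level, htrail', lastLevel_concat, ← htrail'] at hlevel
  have hget : (S b).trail[(S d).trail.length]? = some A := by simp [htrail']
  have hcomp : A.ground.comp ∉ Clause.subst D σ := fun h =>
    hlevel.not_ge <| ((definesAt_ground_comp hget).litLevel_eq hinv.trail.isTrail hget).ge.trans
      (litLevel_le_clauseLevel h)
  rw [Clause.subst_add, Clause.subst_singleton, add_comm, Multiset.singleton_add] at hfalse hmem ⊢
  rw [← (Multiset.mem_cons.1 hmem).resolve_right hcomp]
  exact hinv.not_groundRedundant_of_decide hlt hdecide.status_of_decide hS htrail'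
    (hAlevel ▸ Nat.succ_pos _) (hrun.no_bad_decision d hdn hd A hA)
    (hfalse.of_subset (Multiset.subset_cons _ _)) hlevel

theorem not_groundRedundant (hlt : MonotonicOrdering lt) (hrun : IsSemiregularRun lt N n S r)
    (hb : b < n) (hr : r b = .backtrack) (hC : (S b).status = .closure C σ) (hib : i ≤ b)
    (hi : ∀ j, i ≤ j → j ≤ b → (S j).InConflict) :
    ¬ GroundRedundant (TrailLT lt (S i).β (S i).trail) (gnd ((S b).N ∪ (S b).U))
      (Clause.subst C σ) := by
  obtain ⟨c, hc, hphase⟩ := hrun.exists_lastConflict hb.le ⟨C, σ, hC⟩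
  have hcb := hc.1
  have hcstep := hc.2.1 ▸ hrun.step c (hcb.trans hb)
  have hctop := State.not_inConflict_of_top hcstep.status_of_conflict
  have hci : c < i := not_le.1 fun hic => hctop (hi c hic hcb.le)
  by_cases hskip : ∃ j, c < j ∧ j < b ∧ r j = .skip
  · exact hrun.not_groundRedundant_of_skip hlt hb hr hphase hskip hC hci hib
  obtain ⟨d, rfl, hd⟩ : AfterDecide r c := (hrun.skip_once b hb hr c hc).resolve_right hskip
  obtain ⟨-, hconflict, htrail⟩ := hcstep.enter_conflict hctop (hphase _ (Nat.lt_succ_self _) hcb)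
  obtain ⟨hsame, -, hne⟩ := hrun.conflict_resolution hcb hb.le hphase
  obtain ⟨hsame', -, hne'⟩ := hrun.conflict_resolution hib hb.le hi
  have heq := not_not.1 (mt hne.1 hskip)
  have heq' := not_not.1 (mt hne'.1 fun ⟨j, hij, hjb, hj⟩ => hskip ⟨j, hci.trans_le hij, hjb, hj⟩)
  have hdecide := (hd ▸ hrun.step d (by omega)).sameProblem_of_decide.1
  rw [← hsame'.bound, ← heq']
  exact hrun.not_groundRedundant_of_decide hlt hb hr hd hc
    ((hsame.trans hconflict).trans hdecide) (heq.trans htrail) hC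

end IsSemiregularRun

end SemiregularRuns

/-! ### Justifications of propagated literals -/

theorem CanJustify.exists_eq (h : CanJustify lt β Γ j A E δ) :
    ∃ R, Clause.subst E δ = A.ground ::ₘ R ∧ ClauseBetaFalse lt β (lits (Γ.take j)) R := by
  obtain ⟨K, D, rfl, hK, hD, -⟩ := h
  exact ⟨Clause.subst D δ, hK ▸ Clause.subst_cons .., hD⟩

namespace State.Invariant

theorem groundClause_eq (hS : S.Invariant lt) (hA : S.trail[j]? = some A)
    (hpropagated : ¬ IsDecision (S.trail.take j) A) :
    ∃ R, A.groundClause = A.ground ::ₘ R ∧ ClauseBetaFalse lt S.β (lits (S.trail.take j)) R := by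
  obtain ⟨-, h⟩ := (hS.trail.annotation j A hA).resolve_right fun h => hpropagated h.1
  refine ⟨Clause.subst A.rest A.sub, Clause.subst_cons .., clauseBelow_iff.2 fun K hK => ?_,
    h.restFalse⟩
  exact clauseBelow_iff.1 h.below K (Multiset.mem_cons_of_mem hK)

theorem exists_canJustify (hlt : WellFounded lt) (hS : S.Invariant lt)
    (hA : S.trail[j]? = some A) (hpos : 0 < A.level)
    (hR : ClauseBetaFalse lt S.β (lits (S.trail.take j)) R) {G : Set (Clause Sg V × Subst Sg V)}
    (hG : ∀ E ∈ G, E.1 ∈ S.N ∪ S.U ∧ Clause.Ground (Clause.subst E.1 E.2) ∧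
      MulExt (TrailLT lt S.β S.trail) (Clause.subst E.1 E.2) (A.ground ::ₘ R))
    (h : Entails {D | ∃ E ∈ G, D = Clause.subst E.1 E.2} (A.ground ::ₘ R)) :
    ∃ E ∈ G, CanJustify lt S.β S.trail j A E.1 E.2 := by
  have hΓ := hS.trail.isTrail
  have hno := hS.noEarlierConflict j (List.getElem?_eq_some_iff.1 hA).1
  obtain ⟨D, ⟨E, hE, hD⟩, hDfalse⟩ := h.exists_cons_mem hlt hΓ (hΓ.zeroBefore hA hpos le_rfl) hA
    (hS.trail.sound (List.mem_of_getElem? hA)).litBelow hR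
    (by rintro _ ⟨E, hE, rfl⟩; exact (hG E hE).2.2)
    (by rintro _ ⟨E, hE, rfl⟩; exact hno _ ⟨E.1, (hG E hE).1, E.2, rfl, (hG E hE).2.1⟩)
  exact ⟨E, hE, hΓ.canJustify hA hD.symm (hG E hE).2.1 hDfalse⟩

theorem exists_canJustify_of_entailedBySmaller (hlt : WellFounded lt) (hS : S.Invariant lt)
    (hA : S.trail[j]? = some A) (hpos : 0 < A.level)
    (hR : ClauseBetaFalse lt S.β (lits (S.trail.take j)) R)
    (h : EntailedBySmaller (TrailLT lt S.β S.trail) (gnd (S.N ∪ S.U)) (A.ground ::ₘ R)) :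
    ∃ E ∈ S.N ∪ S.U, ∃ δ, CanJustify lt S.β S.trail j A E δ ∧
      MulExt (TrailLT lt S.β S.trail) (Clause.subst E δ) (A.ground ::ₘ R) := by
  obtain ⟨E, ⟨hE, -, hsmaller⟩, hjustify⟩ := hS.exists_canJustify hlt hA hpos hR
    (G := {E | E.1 ∈ S.N ∪ S.U ∧ Clause.Ground (Clause.subst E.1 E.2) ∧
      MulExt (TrailLT lt S.β S.trail) (Clause.subst E.1 E.2) (A.ground ::ₘ R)})
    (fun _ hE => hE)
    (h.mono <| by
      rintro _ ⟨⟨E, hE, δ, rfl, hground⟩, hsmaller⟩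
      exact ⟨(E, δ), ⟨hE, hground, hsmaller⟩, rfl⟩)
  exact ⟨E.1, hE, E.2, hjustify, hsmaller⟩

theorem exists_canJustify_not_entailedBySmaller (hlt : WellFounded lt) (hS : S.Invariant lt)
    (hA : S.trail[j]? = some A) (hpos : 0 < A.level)
    (hR : ClauseBetaFalse lt S.β (lits (S.trail.take j)) R)
    (h : EntailedBySmaller (TrailLT lt S.β S.trail) (gnd (S.N ∪ S.U)) (A.ground ::ₘ R)) :
    ∃ E ∈ S.N ∪ S.U, ∃ δ, CanJustify lt S.β S.trail j A E δ ∧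
      ¬ EntailedBySmaller (TrailLT lt S.β S.trail) (gnd (S.N ∪ S.U)) (Clause.subst E δ) := by
  obtain ⟨E₀, hE₀, δ₀, hjustify₀, -⟩ :=
    hS.exists_canJustify_of_entailedBySmaller hlt hA hpos hR h
  obtain ⟨D, ⟨E, hE, δ, hjustify, rfl⟩, hmin⟩ :=
    (wellFounded_mulExt (wellFounded_trailLT (β := S.β) hlt hS.trail.isTrail)).has_min
      {D | ∃ E ∈ S.N ∪ S.U, ∃ δ, CanJustify lt S.β S.trail j A E δ ∧ D = Clause.subst E δ}
      ⟨_, E₀, hE₀, δ₀, hjustify₀, rfl⟩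
  refine ⟨E, hE, δ, hjustify, fun hentailed => ?_⟩
  obtain ⟨R', hR', hfalse⟩ := hjustify.exists_eq
  rw [hR'] at hentailed hmin
  obtain ⟨E', hE', δ', hjustify', hsmaller⟩ :=
    hS.exists_canJustify_of_entailedBySmaller hlt hA hpos hfalse hentailed
  exact hmin _ ⟨E', hE', δ', hjustify', rfl⟩ hsmaller

end State.Invariant

end Main

end SCLEQ

theorem mainTheorem3_general {Sg : FirstOrder.Language.{u, v}} {V : Type w}
    (lt : Sg.Term V → Sg.Term V → Prop) (hlt : SCLEQ.MonotonicOrdering lt)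
    (N : Set (SCLEQ.Clause Sg V)) (n : ℕ) (S : ℕ → SCLEQ.State Sg V) (r : ℕ → SCLEQ.Rule)
    (hrun : SCLEQ.IsSemiregularRun lt N n S r) :
    (∀ b < n, r b = .backtrack → ∀ C σ, (S b).status = .closure C σ →
      ∀ i ≤ b, (∀ j, i ≤ j → j ≤ b → (S j).InConflict) →
        ¬ SCLEQ.Redundant (SCLEQ.TrailLT lt (S i).β (S i).trail) ((S b).N ∪ (S b).U) C ∧
        ¬ SCLEQ.GroundRedundant (SCLEQ.TrailLT lt (S i).β (S i).trail)
            (SCLEQ.gnd ((S b).N ∪ (S b).U)) (C.subst σ)) ∧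
    (∀ i ≤ n, ∀ (j : ℕ) (A : SCLEQ.AnnLit Sg V), (S i).trail[j]? = some A →
      ¬ SCLEQ.IsDecision ((S i).trail.take j) A → 0 < A.level →
      (∀ G : Set (SCLEQ.Clause Sg V × SCLEQ.Subst Sg V),
        (∀ E ∈ G, E.1 ∈ (S i).N ∪ (S i).U ∧ (E.1.subst E.2).Ground ∧
          SCLEQ.MulExt (SCLEQ.TrailLT lt (S i).β (S i).trail) (E.1.subst E.2) A.groundClause) →
        SCLEQ.Entails {D | ∃ E ∈ G, D = E.1.subst E.2} A.groundClause →
        ∃ E ∈ G, SCLEQ.CanJustify lt (S i).β (S i).trail j A E.1 E.2) ∧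
      (SCLEQ.EntailedBySmaller (SCLEQ.TrailLT lt (S i).β (S i).trail)
          (SCLEQ.gnd ((S i).N ∪ (S i).U)) A.groundClause →
        ∃ E ∈ (S i).N ∪ (S i).U, ∃ δ : SCLEQ.Subst Sg V,
          SCLEQ.CanJustify lt (S i).β (S i).trail j A E δ ∧
          ¬ SCLEQ.EntailedBySmaller (SCLEQ.TrailLT lt (S i).β (S i).trail)
            (SCLEQ.gnd ((S i).N ∪ (S i).U)) (E.subst δ))) := by
  refine ⟨fun b hb hr C σ hC i hib hi => ?_, fun i hi j A hA hpropagated hpos => ?_⟩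
  · have hnot := hrun.not_groundRedundant hlt hb hr hC hib hi
    have hground := ((hrun.invariant hlt hb.le).closure C σ hC).1
    exact ⟨fun hred => hnot (hred _ ⟨C, rfl, σ, rfl, hground⟩), hnot⟩
  · have hS := hrun.invariant hlt hi
    obtain ⟨R, hAR, hR⟩ := hS.groundClause_eq hA hpropagated
    rw [hAR]
    exact ⟨fun G hG hent => hS.exists_canJustify hlt.wf hA hpos hR hG hent,
      fun hent => hS.exists_canJustify_not_entailedBySmaller hlt.wf hA hpos hR hent⟩

theorem mainTheorem3 {Sg : FirstOrder.Language.{u, v}} {V : Type w} [Infinite V]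
    (lt : Sg.Term V → Sg.Term V → Prop) (hlt : SCLEQ.DesiredOrdering lt)
    (N : Set (SCLEQ.Clause Sg V)) (n : ℕ) (S : ℕ → SCLEQ.State Sg V) (r : ℕ → SCLEQ.Rule)
    (hrun : SCLEQ.IsRegularRun lt N n S r) :
    -- the clause `C` learned by Backtrack is not redundant, and neither is its instance `Cσ`,
    -- for the ordering induced by the trail of any state `S i` of this conflict resolution
    (∀ b < n, r b = .backtrack → ∀ C σ, (S b).status = .closure C σ →
      ∀ i ≤ b, (∀ j, i ≤ j → j ≤ b → (S j).InConflict) →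
        ¬ SCLEQ.Redundant (SCLEQ.TrailLT lt (S i).β (S i).trail) ((S b).N ∪ (S b).U) C ∧
        ¬ SCLEQ.GroundRedundant (SCLEQ.TrailLT lt (S i).β (S i).trail)
            (SCLEQ.gnd ((S b).N ∪ (S b).U)) (C.subst σ)) ∧
    -- only non-redundant clauses have to be considered as justifications on the trail
    (∀ i ≤ n, ∀ (j : ℕ) (A : SCLEQ.AnnLit Sg V), (S i).trail[j]? = some A →
      ¬ SCLEQ.IsDecision ((S i).trail.take j) A → 0 < A.level →
      (∀ G : Set (SCLEQ.Clause Sg V × SCLEQ.Subst Sg V),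
        (∀ E ∈ G, E.1 ∈ (S i).N ∪ (S i).U ∧ (E.1.subst E.2).Ground ∧
          SCLEQ.MulExt (SCLEQ.TrailLT lt (S i).β (S i).trail) (E.1.subst E.2) A.groundClause) →
        SCLEQ.Entails {D | ∃ E ∈ G, D = E.1.subst E.2} A.groundClause →
        ∃ E ∈ G, SCLEQ.CanJustify lt (S i).β (S i).trail j A E.1 E.2) ∧
      (SCLEQ.EntailedBySmaller (SCLEQ.TrailLT lt (S i).β (S i).trail)
          (SCLEQ.gnd ((S i).N ∪ (S i).U)) A.groundClause →
        ∃ E ∈ (S i).N ∪ (S i).U, ∃ δ : SCLEQ.Subst Sg V,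
          SCLEQ.CanJustify lt (S i).β (S i).trail j A E δ ∧
          ¬ SCLEQ.EntailedBySmaller (SCLEQ.TrailLT lt (S i).β (S i).trail)
            (SCLEQ.gnd ((S i).N ∪ (S i).U)) (E.subst δ))) :=
  mainTheorem3_general lt hlt.monotonicOrdering N n S r hrun.isSemiregularRun
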